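/- Let $\mathbb K$ be $\mathbb R$ or $\mathbb C$. A topological space $X$ is a *$k$-space* if a subset is open whenever its preimage under every continuous map $K\to X$ from a compact Hausdorff space $K$ is open; $kX$ denotes the $k$-ification of a space $X$. An *$hk$-space* is a $k$-space $X$ whose diagonal is closed in $k(X\times X)$. Let $hk\mathsf{Top}$ be the category of $hk$-spaces and continuous maps, with its cartesian symmetric monoidal structure (the product of $X$ and $Y$ is $k(X\times Y)$, again written $X\times Y$). For spaces $X,Y$ let $Y^X$ be the $k$-ification of the set of continuous maps $X\to Y$ with the topology generated by the sets $\{f\mid f(i(K))\subseteq U\}$, where $i:K\to X$ is continuous, $K$ is compact Hausdorff and $U\subseteq Y$ is open. For an $hk$-space $X$ let $C_b(X)=\operatorname{colim}_n\,(nD)^X$ be the space of bounded continuous functions $X\to\mathbb K$, with the colimit topology over the balls $nD=\{z\in\mathbb K : |z|\le n\}$; let $C_b(X)^\wedge$ be the space of continuous linear functionals on $C_b(X)$, as a (closed) subspace of $\mathbb K^{C_b(X)}$; and let $\mathcal M(X)\subseteq C_b(X)^\wedge$ be the closure of the linear span of the evaluation functionals $f\mapsto f(x)$, $x\in X$. Let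 $\mathcal P(X)\subseteq\mathcal M(X)$ be the closed subspace of positive functionals $\varphi$ with $\varphi(1)=1$. A *$k$-regular probability measure* on $X$ is a probability measure $\mu$ on the Baire $\sigma$-algebra (generated by the continuous functions $X\to\mathbb K$) for which $f\mapsto\int f\,d\mu$ belongs to $\mathcal M(X)$. **Theorem.** For every $hk$-space $X$, the assignment $\mu\mapsto\int(-)\,d\mu$ is a bijection from the set of $k$-regular probability measures on $X$ onto $\mathcal P(X)$; identify the two, writing $\mu(f)=\int f\,d\mu$. Then $\mathcal P$, with pushforward of measures on morphisms, is an endofunctor of $hk\mathsf{Top}$, and $$\delta_\bullet: X\to\mathcal P(X),\ x\mapsto\delta_x,\qquad \textstyle\int:\mathcal P(\mathcal P(X))\to\mathcal P(X),\ \int(\pi)(f)=\int_{\mathcal P(X)}\mu(f)\,d\pi(\mu),$$ $$\otimes:\mathcal P(X)\times\mathcal P(Y)\to\mathcal P(X\times Y),\quad (\mu\otimes\nu)(f)=\int_Y\int_X f(x,y)\,d\mu(x)\,d\nu(y),$$ are well-defined continuous maps, natural in $X$ and $Y$, such that $(\mathcal P,\delta_\bullet,\int,\otimes)$ is a commutative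 monad on $hk\mathsf{Top}$: $(\mathcal P,\delta_\bullet,\int)$ is a monad, $\otimes$ together with $\delta:1\to\mathcal P(1)$ makes $\mathcal P$ a lax symmetric monoidal functor, and $\delta_\bullet$ and $\int$ are monoidal natural transformations. Moreover: 1. $\mathcal P$ restricts to the Radon monad on the category of compact Hausdorff spaces, that is, to the monad sending $X$ to the set of Radon probability measures on $X$ (Borel probability measures that are inner regular with respect to compact sets) with the topology of weak convergence, with pushforward of measures, Dirac measures as unit and multiplication $\pi\mapsto\big(A\mapsto\int m(A)\,d\pi(m)\big)$ for Borel sets $A$; a Radon measure $m$ corresponds to the functional $f\mapsto\int f\,dm$. 2. $\mathcal P$ restricts to a monad on the full subcategory $h\mathsf{QCB}$ of those $hk$-spaces that are QCB spaces, i.e. topological quotients of second countable spaces. Here a monad $T$ on $\mathcal C$ *restricts* to a monad $S$ on a full subcategory $J:\mathcal D\hookrightarrow\mathcal C$ if there is a natural isomorphism $JS\cong TJ$ under which the units and the multiplications agree. -/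

import Mathlib

open CategoryTheory MonoidalCategory Topology MeasureTheory

universe u v

noncomputable section

namespace HK

/-! ### `k`-spaces and `hk`-spaces -/

/-- The family of all compact Hausdorff spaces, used as test spaces. -/
abbrev Test : CompHaus.{u} → Type u := fun K => K

/-- The `k`-ification of a topological space: the same points, and a set is open if and only if its
preimage under every continuous map from a compact Hausdorff space is open. -/
abbrev Kify (X : Type v) [TopologicalSpace X] : Type v :=
  WithGeneratedByTopology Test.{u} X

/-- The identity map `kX → X`. -/
abbrev unk {X : Type v} [TopologicalSpace X] : Kify.{u} X ≃ X :=
  WithGeneratedByTopology.equiv (X := Test.{u}) (Y := X)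

/-- The identity map `X → kX`. -/
abbrev mk {X : Type v} [TopologicalSpace X] : X ≃ Kify.{u} X :=
  (WithGeneratedByTopology.equiv (X := Test.{u}) (Y := X)).symm

/-- An `hk`-space is a `k`-space (the topology is determined by the continuous maps from compact
Hausdorff spaces) which is `k`-Hausdorff (the diagonal is closed in the product `k(X × X)` of
`k`-spaces). -/
structure IsHKSpace (X : Type u) [TopologicalSpace X] : Prop where
  kSpace : IsGeneratedBy Test.{u} X
  kHausdorff : IsClosed {p : Kify.{u} (X × X) | (unk p).1 = (unk p).2}

/-- The property of a topological space of being an `hk`-space. -/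
def isHK : ObjectProperty TopCat.{u} := fun X => IsHKSpace X

/-- The category of `hk`-spaces and continuous maps. -/
abbrev HKTop : Type (u + 1) := isHK.{u}.FullSubcategory

/-- The underlying set of an `hk`-space. -/
abbrev HKTop.carrier (X : HKTop.{u}) : Type u := X.obj

/-- A topological space which is an `hk`-space, as an object of the category of `hk`-spaces. -/
abbrev HKTop.of (X : Type u) [TopologicalSpace X] (h : IsHKSpace X) : HKTop.{u} :=
  ⟨TopCat.of X, h⟩

/-- A continuous map of `hk`-spaces as a morphism. -/
abbrev HKTop.ofHom {X Y : HKTop.{u}} (f : C(X.carrier, Y.carrier)) : X ⟶ Y :=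
  ObjectProperty.homMk (TopCat.ofHom f)

/-- The continuous map underlying a morphism of `hk`-spaces. -/
abbrev HKTop.toMap {X Y : HKTop.{u}} (f : X ⟶ Y) : C(X.carrier, Y.carrier) := f.hom.hom

lemma continuous_kify_map {X : Type v} {Y : Type*} [TopologicalSpace X] [TopologicalSpace Y]
    {g : X → Y} (hg : Continuous g) :
    Continuous (fun x : Kify.{u} X => (mk (g (unk x)) : Kify.{u} Y)) :=
  (IsGeneratedBy.equiv_symm_comp_continuous_iff Test.{u} _).2
    (hg.comp WithGeneratedByTopology.continuous_equiv)

lemma isHKSpace_of_t2 (X : Type u) [TopologicalSpace X] [T2Space X]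
    (h : IsGeneratedBy Test.{u} X) : IsHKSpace X where
  kSpace := h
  kHausdorff := isClosed_diagonal.preimage
    (WithGeneratedByTopology.continuous_equiv (X := Test.{u}) (Y := X × X))

instance closedTest (K : CompHaus.{u}) (F : TopologicalSpace.Closeds (Test K)) :
    IsGeneratedBy Test.{u} F :=
  haveI : CompactSpace F := isCompact_iff_compactSpace.1 F.isClosed.isCompact
  inferInstanceAs (IsGeneratedBy Test.{u} (Test (CompHaus.of F)))

lemma isHKSpace_compHaus (K : CompHaus.{u}) : IsHKSpace K :=
  isHKSpace_of_t2 K (inferInstanceAs (IsGeneratedBy Test.{u} (Test K)))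

/-! ### The cartesian monoidal structure: products are `k(X × Y)` -/

lemma isHKSpace_prod (X Y : HKTop.{u}) : IsHKSpace (Kify.{u} (X.carrier × Y.carrier)) where
  kSpace := inferInstance
  kHausdorff := by
    have h1 : Continuous (fun p : Kify.{u} (X.carrier × Y.carrier) => (unk p).1) :=
      continuous_fst.comp WithGeneratedByTopology.continuous_equiv
    have h2 : Continuous (fun p : Kify.{u} (X.carrier × Y.carrier) => (unk p).2) :=
      continuous_snd.comp WithGeneratedByTopology.continuous_equiv
    have h1' := X.property.kHausdorff.preimage (continuous_kify_map.{u} (h1.prodMap h1))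
    have h2' := Y.property.kHausdorff.preimage (continuous_kify_map.{u} (h2.prodMap h2))
    convert h1'.inter h2' using 1
    ext p
    exact Prod.ext_iff

/-- The product of two `hk`-spaces. -/
abbrev prodObj (X Y : HKTop.{u}) : HKTop.{u} := HKTop.of _ (isHKSpace_prod X Y)

/-- The one-point space. -/
abbrev unitObj : HKTop.{u} := HKTop.of PUnit.{u + 1} (isHKSpace_of_t2 _ inferInstance)

/-- The universal property of the product of two `hk`-spaces. -/
def prodCone (X Y : HKTop.{u}) : Limits.LimitCone (Limits.pair X Y) where
  cone := Limits.BinaryFan.mk (P := prodObj X Y)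
    (HKTop.ofHom ⟨fun p => (unk.{u} p).1, continuous_fst.comp WithGeneratedByTopology.continuous_equiv⟩)
    (HKTop.ofHom ⟨fun p => (unk.{u} p).2, continuous_snd.comp WithGeneratedByTopology.continuous_equiv⟩)
  isLimit := Limits.BinaryFan.IsLimit.mk _
    (fun {T} f g => HKTop.ofHom ⟨fun t => mk.{u} (HKTop.toMap f t, HKTop.toMap g t), by
      have := T.property.kSpace
      exact (IsGeneratedBy.equiv_symm_comp_continuous_iff Test.{u} _).2
        ((HKTop.toMap f).continuous.prodMk (HKTop.toMap g).continuous)⟩)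
    (fun _ _ => rfl) (fun _ _ => rfl)
    (fun f g m hf hg => by
      subst hf hg
      rfl)

/-- The one-point space is terminal. -/
def unitCone : Limits.LimitCone (Functor.empty.{0} HKTop.{u}) where
  cone := Limits.asEmptyCone unitObj
  isLimit := Limits.IsTerminal.ofUniqueHom (fun _ => HKTop.ofHom ⟨fun _ => PUnit.unit, continuous_const⟩)
    (fun _ _ => rfl)

/-- `hk`-spaces with their cartesian product. -/
instance : CartesianMonoidalCategory HKTop.{u} :=
  .ofChosenFiniteProducts unitCone prodCone

/-- The symmetry `X ⊗ Y ≅ Y ⊗ X`. -/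
instance : BraidedCategory HKTop.{u} := .ofCartesianMonoidalCategory

/-- The point `(x, y)` of the product of two `hk`-spaces. -/
def pair {X Y : HKTop.{u}} (x : X.carrier) (y : Y.carrier) : (X ⊗ Y).carrier :=
  (mk (x, y) : Kify.{u} (X.carrier × Y.carrier))

/-! ### Spaces of continuous maps -/

/-- Continuous maps with the compact-open topology of the theory of `k`-spaces, whose subbasic open
sets are `{f | f (i K) ⊆ U}` for continuous maps `i : K → X` from a compact Hausdorff space and open
sets `U`. Equivalently, it is the coarsest topology for which every restriction `f ↦ f ∘ i` into
`C(K, Y)` with its compact-open topology is continuous. -/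
structure CO (X : Type u) (Y : Type v) [TopologicalSpace X] [TopologicalSpace Y] :
    Type (max u v) where
  toMap : C(X, Y)

instance (X : Type u) (Y : Type v) [TopologicalSpace X] [TopologicalSpace Y] :
    TopologicalSpace (CO X Y) :=
  ⨅ (K : CompHaus.{u}) (i : C(K, X)),
    TopologicalSpace.induced (fun f : CO X Y => f.toMap.comp i) ContinuousMap.compactOpen

/-- The exponential `Y ^ X`: continuous maps with the `k`-ification of the compact-open topology. -/
abbrev Exp (X : Type u) (Y : Type v) [TopologicalSpace X] [TopologicalSpace Y] : Type (max u v) :=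
  Kify.{u} (CO X Y)

/-- A point of `Y ^ X` as a continuous map. -/
abbrev Exp.toMap {X : Type u} {Y : Type v} [TopologicalSpace X] [TopologicalSpace Y]
    (f : Exp X Y) : C(X, Y) := (unk.{u} f).toMap

/-- A continuous map as a point of `Y ^ X`. -/
abbrev Exp.ofMap {X : Type u} {Y : Type v} [TopologicalSpace X] [TopologicalSpace Y]
    (f : C(X, Y)) : Exp X Y := mk.{u} (⟨f⟩ : CO X Y)

section Exp

variable {W X : Type u} {Y : Type v} [TopologicalSpace W] [TopologicalSpace X] [TopologicalSpace Y]

lemma Exp.continuous_eval (x : X) : Continuous (fun f : Exp X Y => f.toMap x) := by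
  have h : Continuous (fun f : CO X Y =>
      f.toMap.comp (ContinuousMap.const (CompHaus.of PUnit.{u + 1}) x)) :=
    continuous_iInf_dom (i := CompHaus.of PUnit.{u + 1})
      (continuous_iInf_dom (i := ContinuousMap.const _ x) continuous_induced_dom)
  exact ((continuous_eval_const (PUnit.unit : CompHaus.of PUnit.{u + 1})).comp h).comp
    WithGeneratedByTopology.continuous_equiv

lemma Exp.continuous_precomp (g : C(W, X)) :
    Continuous (fun f : Exp X Y => Exp.ofMap (f.toMap.comp g)) := by
  have h : Continuous (fun f : CO X Y => (⟨f.toMap.comp g⟩ : CO W Y)) :=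
    continuous_iInf_rng.2 fun K => continuous_iInf_rng.2 fun i => continuous_induced_rng.2
      (continuous_iInf_dom (i := K) (continuous_iInf_dom (i := g.comp i) continuous_induced_dom))
  exact continuous_kify_map.{u} h

end Exp

/-! ### Bounded continuous functions, natural duals, measures as functionals -/

section Functionals

variable (𝕜 : Type) [RCLike 𝕜] (X : Type u) [TopologicalSpace X]

/-- The vector space of bounded continuous functions. -/
def boundedSubmodule : Submodule 𝕜 C(X, 𝕜) where
  carrier := {f | ∃ n : ℕ, ∀ x, ‖f x‖ ≤ n}
  add_mem' := by
    rintro f g ⟨n, hn⟩ ⟨m, hm⟩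
    refine ⟨n + m, fun x => ?_⟩
    push_cast
    exact (norm_add_le _ _).trans (add_le_add (hn x) (hm x))
  zero_mem' := ⟨0, fun x => by simp⟩
  smul_mem' := by
    rintro c f ⟨n, hn⟩
    obtain ⟨m, hm⟩ := exists_nat_ge (‖c‖ * n)
    refine ⟨m, fun x => le_trans ?_ hm⟩
    simpa [norm_smul] using mul_le_mul_of_nonneg_left (hn x) (norm_nonneg c)

/-- The linear `hk`-space `C_b(X)` of bounded continuous functions. -/
def Cb : Type u := boundedSubmodule 𝕜 X

instance : AddCommGroup (Cb 𝕜 X) := inferInstanceAs (AddCommGroup (boundedSubmodule 𝕜 X))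
instance : Module 𝕜 (Cb 𝕜 X) := inferInstanceAs (Module 𝕜 (boundedSubmodule 𝕜 X))

variable {𝕜 X}

/-- The continuous function underlying an element of `C_b(X)`. -/
def Cb.toMap (f : Cb 𝕜 X) : C(X, 𝕜) := f.1

instance : FunLike (Cb 𝕜 X) X 𝕜 where
  coe f := f.toMap
  coe_injective _ _ h := Subtype.ext (DFunLike.coe_injective h)

/-- The inclusion `(nD)^X → C_b(X)`, where `D` is the closed unit disk of the scalars. -/
def Cb.ofBall (n : ℕ) (f : Exp X (Metric.closedBall (0 : 𝕜) n)) : Cb 𝕜 X :=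
  ⟨(⟨Subtype.val, continuous_subtype_val⟩ : C(Metric.closedBall (0 : 𝕜) n, 𝕜)).comp f.toMap,
    n, fun x => mem_closedBall_zero_iff.1 (f.toMap x).2⟩

variable (𝕜 X) in
/-- The topology of `C_b(X)` as the colimit of the spaces `D^X ⊆ (2D)^X ⊆ (3D)^X ⊆ ...`. -/
instance : TopologicalSpace (Cb 𝕜 X) :=
  ⨆ n : ℕ, TopologicalSpace.coinduced (Cb.ofBall n) inferInstance

lemma Cb.continuous_ofBall (n : ℕ) : Continuous (Cb.ofBall (𝕜 := 𝕜) (X := X) n) :=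
  continuous_iSup_rng (i := n) continuous_coinduced_rng

lemma Cb.continuous_eval (x : X) : Continuous (fun f : Cb 𝕜 X => f x) :=
  continuous_iSup_dom.2 fun n => continuous_coinduced_dom.2
    (continuous_subtype_val.comp (Exp.continuous_eval (Y := Metric.closedBall (0 : 𝕜) n) x))

instance : T2Space (Cb 𝕜 X) :=
  T2Space.of_injective_continuous (f := fun (f : Cb 𝕜 X) (x : X) => f x)
    DFunLike.coe_injective (continuous_pi fun x => Cb.continuous_eval x)

variable (𝕜 X) in
lemma isHKSpace_Cb : IsHKSpace (Cb 𝕜 X) :=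
  isHKSpace_of_t2 _ (IsGeneratedBy.iSup fun _ => IsGeneratedBy.coinduced _)

/-- The constant function `1`. -/
def Cb.one : Cb 𝕜 X := ⟨ContinuousMap.const X 1, 1, fun x => by simp⟩

/-- Composition with a continuous map, as a linear map `C_b(Y) → C_b(X)`. -/
def Cb.pullbackₗ {Y : Type u} [TopologicalSpace Y] (g : C(X, Y)) : Cb 𝕜 Y →ₗ[𝕜] Cb 𝕜 X where
  toFun f := ⟨f.toMap.comp g, f.2.choose, fun x => f.2.choose_spec (g x)⟩
  map_add' _ _ := rfl
  map_smul' _ _ := rfl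

/-- Composition with a continuous map, as a continuous linear map `C_b(Y) → C_b(X)`. -/
def Cb.pullback {Y : Type u} [TopologicalSpace Y] (g : C(X, Y)) : Cb 𝕜 Y →L[𝕜] Cb 𝕜 X where
  toLinearMap := Cb.pullbackₗ g
  cont := by
    refine continuous_iSup_dom.2 fun n => continuous_coinduced_dom.2 ?_
    exact (Cb.continuous_ofBall n).comp
      (Exp.continuous_precomp (Y := Metric.closedBall (0 : 𝕜) n) g)

variable (𝕜) in
/-- The natural dual of a linear `k`-space: its continuous linear functionals, as a subspace of the
exponential `𝕜 ^ V`. -/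
def NDual (V : Type u) [AddCommGroup V] [Module 𝕜 V] [TopologicalSpace V] : Type u := V →L[𝕜] 𝕜

section NDual

variable (V : Type u) [AddCommGroup V] [Module 𝕜 V] [TopologicalSpace V]

instance : AddCommGroup (NDual 𝕜 V) := inferInstanceAs (AddCommGroup (V →L[𝕜] 𝕜))
instance : Module 𝕜 (NDual 𝕜 V) := inferInstanceAs (Module 𝕜 (V →L[𝕜] 𝕜))
instance : FunLike (NDual 𝕜 V) V 𝕜 := inferInstanceAs (FunLike (V →L[𝕜] 𝕜) V 𝕜)
instance : ContinuousLinearMapClass (NDual 𝕜 V) 𝕜 V 𝕜 :=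
  inferInstanceAs (ContinuousLinearMapClass (V →L[𝕜] 𝕜) 𝕜 V 𝕜)

variable {V}

/-- The inclusion of the natural dual into the exponential `𝕜 ^ V`. -/
def NDual.toExp (φ : NDual 𝕜 V) : Exp V 𝕜 := Exp.ofMap ⟨φ, map_continuous φ⟩

instance : TopologicalSpace (NDual 𝕜 V) := TopologicalSpace.induced NDual.toExp inferInstance

lemma NDual.continuous_toExp : Continuous (NDual.toExp (𝕜 := 𝕜) (V := V)) :=
  continuous_induced_dom

lemma NDual.continuous_eval (v : V) : Continuous (fun φ : NDual 𝕜 V => φ v) :=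
  (Exp.continuous_eval v).comp NDual.continuous_toExp

lemma NDual.toExp_injective : Function.Injective (NDual.toExp (𝕜 := 𝕜) (V := V)) := fun _ _ h =>
  DFunLike.coe_injective (funext fun v => congrArg (fun f : Exp V 𝕜 => f.toMap v) h)

lemma NDual.isClosedEmbedding_toExp : IsClosedEmbedding (NDual.toExp (𝕜 := 𝕜) (V := V)) := by
  refine ⟨⟨⟨rfl⟩, NDual.toExp_injective⟩, ?_⟩
  have h : Set.range (NDual.toExp (𝕜 := 𝕜) (V := V)) =
      (⋂ (v : V) (w : V), {f : Exp V 𝕜 | f.toMap (v + w) = f.toMap v + f.toMap w}) ∩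
      ⋂ (c : 𝕜) (v : V), {f : Exp V 𝕜 | f.toMap (c • v) = c • f.toMap v} := by
    ext f
    simp only [Set.mem_range, Set.mem_inter_iff, Set.mem_iInter, Set.mem_ofPred_eq]
    constructor
    · rintro ⟨φ, rfl⟩
      exact ⟨map_add φ, map_smul φ⟩
    · rintro ⟨h1, h2⟩
      exact ⟨(⟨⟨⟨f.toMap, h1⟩, h2⟩, f.toMap.continuous⟩ : V →L[𝕜] 𝕜), rfl⟩
  rw [h]
  refine IsClosed.inter ?_ ?_
  · exact isClosed_iInter fun v => isClosed_iInter fun w => isClosed_eq (Exp.continuous_eval _)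
      ((Exp.continuous_eval _).add (Exp.continuous_eval _))
  · exact isClosed_iInter fun c => isClosed_iInter fun v => isClosed_eq (Exp.continuous_eval _)
      ((Exp.continuous_eval _).const_smul c)

instance : T2Space (NDual 𝕜 V) :=
  T2Space.of_injective_continuous (f := fun (φ : NDual 𝕜 V) (v : V) => φ v)
    DFunLike.coe_injective (continuous_pi fun v => NDual.continuous_eval v)

instance : IsGeneratedBy Test.{u} (NDual 𝕜 V) := NDual.isClosedEmbedding_toExp.isGeneratedBy

/-- The transpose of a continuous linear map. -/
def NDual.transpose {W : Type u} [AddCommGroup W] [Module 𝕜 W] [TopologicalSpace W]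
    (A : V →L[𝕜] W) : NDual 𝕜 W →ₗ[𝕜] NDual 𝕜 V where
  toFun φ := (show W →L[𝕜] 𝕜 from φ).comp A
  map_add' _ _ := rfl
  map_smul' _ _ := rfl

lemma NDual.continuous_transpose {W : Type u} [AddCommGroup W] [Module 𝕜 W] [TopologicalSpace W]
    (A : V →L[𝕜] W) : Continuous (NDual.transpose A) := by
  refine continuous_induced_rng.2 ?_
  exact (Exp.continuous_precomp (⟨A, A.continuous⟩ : C(V, W))).comp (NDual.continuous_toExp)

end NDual

/-- The evaluation functional at a point. -/
def delta (x : X) : NDual 𝕜 (Cb 𝕜 X) :=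
  (⟨⟨⟨fun f => f x, fun _ _ => rfl⟩, fun _ _ => rfl⟩, Cb.continuous_eval x⟩ : Cb 𝕜 X →L[𝕜] 𝕜)

variable (𝕜 X) in
/-- The set `M(X)` of functionals on `C_b(X)`: the closed linear span of the evaluation functionals
in the natural dual of `C_b(X)`. -/
def M : Set (NDual 𝕜 (Cb 𝕜 X)) := closure (Submodule.span 𝕜 (Set.range delta) : Submodule 𝕜 (NDual 𝕜 (Cb 𝕜 X)))

open scoped ComplexOrder in
variable (𝕜 X) in
/-- The set of positive normalised functionals in `M(X)`. -/
def P : Set (NDual 𝕜 (Cb 𝕜 X)) :=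
  {φ | φ ∈ M 𝕜 X ∧ (∀ f : Cb 𝕜 X, (∀ x, 0 ≤ f x) → 0 ≤ φ f) ∧ φ Cb.one = 1}

open scoped ComplexOrder in
lemma isClosed_P : IsClosed (P 𝕜 X) := by
  have h : P 𝕜 X = M 𝕜 X ∩ ((⋂ (f : Cb 𝕜 X) (_ : ∀ x, 0 ≤ f x),
      {φ | 0 ≤ RCLike.re (φ f)} ∩ {φ | RCLike.im (φ f) = 0}) ∩ {φ | φ Cb.one = 1}) := by
    ext φ
    simp only [P, Set.mem_inter_iff, Set.mem_iInter, Set.mem_ofPred_eq, RCLike.nonneg_iff (K := 𝕜)]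
  rw [h]
  refine isClosed_closure.inter (IsClosed.inter (isClosed_iInter fun f => isClosed_iInter fun _ => ?_) ?_)
  · exact (isClosed_le continuous_const (RCLike.continuous_re.comp (NDual.continuous_eval f))).inter
      (isClosed_eq (RCLike.continuous_im.comp (NDual.continuous_eval f)) continuous_const)
  · exact isClosed_eq (NDual.continuous_eval _) continuous_const

variable (𝕜 X) in
lemma isHKSpace_P : IsHKSpace (P 𝕜 X) :=
  isHKSpace_of_t2 _ isClosed_P.isGeneratedBy

lemma transpose_mem_P {Y : Type u} [TopologicalSpace Y] (g : C(X, Y)) {φ : NDual 𝕜 (Cb 𝕜 X)}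
    (hφ : φ ∈ P 𝕜 X) : NDual.transpose (Cb.pullback g) φ ∈ P 𝕜 Y := by
  refine ⟨?_, fun f hf => hφ.2.1 _ fun x => hf (g x), hφ.2.2⟩
  have h : Set.MapsTo (NDual.transpose (Cb.pullback (𝕜 := 𝕜) g))
      (Submodule.span 𝕜 (Set.range (delta (𝕜 := 𝕜) (X := X))) : Set (NDual 𝕜 (Cb 𝕜 X)))
      (Submodule.span 𝕜 (Set.range (delta (𝕜 := 𝕜) (X := Y))) : Set (NDual 𝕜 (Cb 𝕜 Y))) := by
    intro ψ hψ
    have h1 := Submodule.mem_map_of_mem (f := NDual.transpose (Cb.pullback (𝕜 := 𝕜) g)) hψ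
    rw [Submodule.map_span] at h1
    refine Submodule.span_mono ?_ h1
    rintro _ ⟨_, ⟨x, rfl⟩, rfl⟩
    exact ⟨g x, rfl⟩
  exact h.closure (NDual.continuous_transpose _) hφ.1

end Functionals

/-! ### The functor of `k`-regular probability measures -/

section Probability

variable (𝕜 : Type) [RCLike 𝕜]

/-- The `hk`-space `P(X)` of `k`-regular probability measures, as a closed subspace of the natural
dual of `C_b(X)`. -/
def prob (X : HKTop.{u}) : HKTop.{u} := HKTop.of (P 𝕜 X.carrier) (isHKSpace_P 𝕜 X.carrier)

variable {𝕜} in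
/-- The value `φ(f)` of an element of `P(X)` at a bounded continuous function. -/
def ev {X : HKTop.{u}} (φ : (prob 𝕜 X).carrier) (f : Cb 𝕜 X.carrier) : 𝕜 :=
  (show P 𝕜 X.carrier from φ).1 f

/-- The functor `P`; on morphisms `(P g)(φ)(f) = φ(f ∘ g)`. -/
def probFunctor : HKTop.{u} ⥤ HKTop.{u} where
  obj X := prob 𝕜 X
  map {X Y} g := HKTop.ofHom (X := prob 𝕜 X) (Y := prob 𝕜 Y)
    ⟨fun φ : P 𝕜 X.carrier =>
        (⟨NDual.transpose (Cb.pullback (HKTop.toMap g)) φ.1, transpose_mem_P _ φ.2⟩ : P 𝕜 Y.carrier),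
      ((NDual.continuous_transpose _).comp continuous_subtype_val).subtype_mk _⟩
  map_id _ := rfl
  map_comp _ _ := rfl

/-- The Baire `σ`-algebra, generated by all continuous functions. -/
abbrev baire (X : Type u) [TopologicalSpace X] : MeasurableSpace X :=
  ⨆ f : C(X, 𝕜), (borel 𝕜).comap f

/-- A `k`-regular probability measure is a probability measure on the Baire `σ`-algebra such that
integration against it is a functional in `M(X)`. -/
structure KRegularProb (X : Type u) [TopologicalSpace X] : Type u where
  measure : @Measure X (baire 𝕜 X)
  isProbabilityMeasure : IsProbabilityMeasure measure
  regular : ∃ φ ∈ M 𝕜 X, ∀ f : Cb 𝕜 X, φ f = ∫ x, f x ∂measure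

end Probability

/-! ### Commutative monads and restrictions of monads -/

/-- The structure of a commutative (that is, symmetric monoidal) monad on an endofunctor `F` of a
symmetric monoidal category: a monad, with a natural transformation `F X ⊗ F Y ⟶ F (X ⊗ Y)` that
makes `F` a lax symmetric monoidal functor, such that unit and multiplication are monoidal natural
transformations. In particular the unit constraint `𝟙_ ⟶ F 𝟙_` is the unit of the monad. -/
structure CommutativeMonad {C : Type*} [Category C] [MonoidalCategory C] [BraidedCategory C]
    (F : C ⥤ C) where
  unit : 𝟭 C ⟶ F
  mult : F ⋙ F ⟶ F
  assoc : ∀ X, F.map (mult.app X) ≫ mult.app X = mult.app (F.obj X) ≫ mult.app X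
  left_unit : ∀ X, unit.app (F.obj X) ≫ mult.app X = 𝟙 (F.obj X)
  right_unit : ∀ X, F.map (unit.app X) ≫ mult.app X = 𝟙 (F.obj X)
  lax : F.LaxBraided
  unit_monoidal : letI := lax; NatTrans.IsMonoidal unit
  mult_monoidal : letI := lax; NatTrans.IsMonoidal mult

/-- The underlying monad. -/
def CommutativeMonad.toMonad {C : Type*} [Category C] [MonoidalCategory C] [BraidedCategory C]
    {F : C ⥤ C} (T : CommutativeMonad F) : Monad C where
  toFunctor := F
  η := T.unit
  μ := T.mult
  assoc := T.assoc
  left_unit := T.left_unit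
  right_unit := T.right_unit

/-- The natural transformation `F X ⊗ F Y ⟶ F (X ⊗ Y)`. -/
def CommutativeMonad.tensor {C : Type*} [Category C] [MonoidalCategory C] [BraidedCategory C]
    {F : C ⥤ C} (T : CommutativeMonad F) (X Y : C) : F.obj X ⊗ F.obj Y ⟶ F.obj (X ⊗ Y) :=
  letI := T.lax
  Functor.LaxMonoidal.μ F X Y

/-- The monad `T` on `C` restricts, along the inclusion `J : D ⥤ C` of a full subcategory, to the
monad `S` on `D`: on objects of `D` the two functors agree up to a natural isomorphism, and under
this identification units and multiplications agree. -/
structure Restriction {C D : Type*} [Category C] [Category D] (T : Monad C) (J : D ⥤ C)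
    (S : Monad D) where
  iso : S.toFunctor ⋙ J ≅ J ⋙ T.toFunctor
  unit : ∀ X, J.map (S.η.app X) ≫ iso.hom.app X = T.η.app (J.obj X)
  mult : ∀ X, J.map (S.μ.app X) ≫ iso.hom.app X =
    iso.hom.app (S.obj X) ≫ T.map (iso.hom.app X) ≫ T.μ.app (J.obj X)

/-! ### The Radon monad on compact Hausdorff spaces -/

/-- Compact Hausdorff spaces are `hk`-spaces. -/
def compHausToHK : CompHaus.{u} ⥤ HKTop.{u} :=
  isHK.lift compHausToTop isHKSpace_compHaus

/-- Radon probability measures: Borel probability measures for which the measure of every Borel set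
is the supremum of the measures of its compact subsets. -/
structure Radon (X : Type u) [TopologicalSpace X] : Type u where
  measure : @Measure X (borel X)
  isProbabilityMeasure : @IsProbabilityMeasure X (borel X) measure
  innerRegular : @Measure.InnerRegular X (borel X) _ measure

/-- The topology of weak convergence of measures. -/
instance (X : Type u) [TopologicalSpace X] : TopologicalSpace (Radon X) :=
  letI : MeasurableSpace X := borel X
  have : BorelSpace X := ⟨rfl⟩
  TopologicalSpace.induced
    (fun m : Radon X => (⟨m.measure, m.isProbabilityMeasure⟩ : ProbabilityMeasure X))
    (inferInstanceAs (TopologicalSpace (ProbabilityMeasure X)))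

/-- The monad `R` is the Radon monad: `R X` is the space of Radon probability measures on `X` with
the topology of weak convergence, `R f` is the pushforward of measures, the unit is given by Dirac
measures, and the multiplication by `(μ π)(A) = ∫ m(A) dπ(m)` for every Borel set `A`. -/
structure RadonMonad (R : Monad CompHaus.{u}) where
  homeo : ∀ X : CompHaus.{u}, R.obj X ≃ₜ Radon X
  map_eq : ∀ {X Y : CompHaus.{u}} (f : X ⟶ Y) (m : R.obj X),
    (homeo Y (R.map f m)).measure = @Measure.map X Y (borel X) (borel Y) f (homeo X m).measure
  unit_eq : ∀ (X : CompHaus.{u}) (x : X),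
    (homeo X (R.η.app X x)).measure = @Measure.dirac X (borel X) x
  mult_eq : ∀ (X : CompHaus.{u}) (π : R.obj (R.obj X)) (A : Set X), MeasurableSet[borel X] A →
    (homeo X (R.μ.app X π)).measure A =
      ∫⁻ m, (homeo X m).measure A ∂(homeo (R.obj X) π).measure

/-! ### QCB spaces -/

/-- The property of an `hk`-space of being a QCB space, that is, a topological quotient of a
second countable space. -/
def isQCB : ObjectProperty HKTop.{u} := fun X =>
  ∃ (Y : TopCat.{u}) (p : Y → X.carrier), SecondCountableTopology Y ∧ IsQuotientMap p

/-- The category of `hk`-spaces which are QCB spaces. -/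
abbrev HQCB : Type (u + 1) := isQCB.{u}.FullSubcategory

end HK

end

/-!
For an `hk`-space `X` everything reduces to maps out of compact Hausdorff spaces `K`. A map
`K → C_b(X)` is continuous if and only if it is uniformly bounded and `(k, l) ↦ F k (p l)` is
continuous for every continuous `p : L → X` with `L` compact Hausdorff (`Cb.continuous_iff`); the
boundedness is the only use of the colimit over the balls. Likewise `K → C_b(X)^` is continuous if
and only if it is jointly continuous along compact families (`NDual.continuous_iff`). All the
continuity statements about unit, multiplication and tensor product follow from these two criteria.

*Functionals are measures.* A uniformly bounded sequence which converges uniformly on compact sets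
is, together with its limit, a compact family in `C_b(X)`. By Dini's theorem a decreasing sequence of
functions with pointwise limit zero is of this kind, so that an element of `P(X)` is a Daniell
functional (`isDaniell_of_continuous`), and the Daniell–Stone theorem represents it by a unique
probability measure on the Baire `σ`-algebra (`IsDaniell.exists_measure`, `ext_of_integral`). The
measure is obtained from the outer measure induced by the content
`U ↦ sup {φ(f) | 0 ≤ f ≤ 1, f = 0 outside U}` on cozero sets.

*The commutative monad.* Unit, multiplication and tensor product are transposes of operators between
function spaces, which makes nearly all of the axioms hold by definition. The exceptions are symmetry
of the tensor product and its compatibility with the multiplication, and both are instances of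
Fubini's theorem `tensor_swap`. It holds since `φ ↦ ψ(y ↦ φ(f(·, y)))` and `φ ↦ φ(x ↦ ψ(f(x, ·)))` are
continuous, linear, and agree on evaluations, whose span is dense in `M(X)`.

*Compact Hausdorff spaces.* For compact `X` the positive normalised functionals are equicontinuous.
Hence pointwise convergence of them implies convergence in `P(X)`, and `P(X)` is the compact space of
all states (`ofState`); states in the span of evaluations are dense by a convexity argument
(`mem_closure_span`). The Riesz–Markov–Kakutani theorem then identifies `P(X)` with the space of Radon
probability measures (`radonHomeo`). That the barycenter of `Φ` is `A ↦ ∫ φ(A) dΦ(φ)` on Borel sets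
(`radonOf_join`) follows from the case of open sets, where the lower semicontinuous function
`φ ↦ φ(U)` is approximated from below by the functions `φ ↦ φ(f)` by compactness.

*QCB spaces.* A QCB `hk`-space has a countable family of subsets that separates compact sets from the
complements of their neighbourhoods (`IsQCBSpace.exists_network`). For second countable Hausdorff `Y`,
a point `f` of `Y ^ X` is presented by a set of pairs `(N, V)` with `f(N) ⊆ V` that determines `f` on
compact sets. Such presentations form a second countable space, and every convergent sequence of the
sequential space `Y ^ X` lifts to it, so that `Y ^ X` is a QCB space (`IsQCBSpace.exp`). Applied
twice, this shows that `P(X)`, a closed subspace of `𝕜 ^ C_b(X)`, is a QCB space.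

Monads preserving a full subcategory restrict to it (`restrictMonadRestriction`), which gives both
restrictions from the corresponding statements about objects.
-/

noncomputable section

namespace HK

open Filter

/-! ### Continuity tested on compact Hausdorff spaces -/

/-- A subset of a compact set all of whose subsets are closed is finite. -/
lemma finite_of_forall_subset_isClosed {X : Type*} [TopologicalSpace X] {C S : Set X}
    (hC : IsCompact C) (hS : S ⊆ C) (h : ∀ A ⊆ S, IsClosed A) : S.Finite := by
  have hdisc : DiscreteTopology S := by
    refine discreteTopology_iff_forall_isClosed.2 fun A => ?_
    have := (h (Subtype.val '' A) (by rintro _ ⟨a, _, rfl⟩; exact a.2)).preimage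
      (continuous_subtype_val (p := fun a => a ∈ S))
    rwa [Set.preimage_image_eq _ Subtype.val_injective] at this
  have := isCompact_iff_compactSpace.1 (hC.of_isClosed_subset (h S subset_rfl) hS)
  have := finite_of_compact_of_discrete (X := S)
  exact Set.toFinite S

section Plots

variable {K : Type u} [TopologicalSpace K] [CompactSpace K] [T2Space K]

lemma isGeneratedBy_of_compact : IsGeneratedBy Test.{u} K :=
  inferInstanceAs (IsGeneratedBy Test.{u} (Test (CompHaus.of K)))

/-- Continuity on a `k`-space is tested on compact Hausdorff spaces. -/
lemma continuous_of_compact {X : Type*} {Z : Type*} [TopologicalSpace X] [TopologicalSpace Z]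
    [IsGeneratedBy Test.{u} X] {g : X → Z}
    (h : ∀ (K : Type u) [TopologicalSpace K] [CompactSpace K] [T2Space K] (p : K → X),
      Continuous p → Continuous (fun k => g (p k))) : Continuous g :=
  (IsGeneratedBy.continuous_iff Test.{u} g).2 fun K p => h K p p.continuous

lemma isOpen_of_compact {X : Type*} [TopologicalSpace X] [IsGeneratedBy Test.{u} X] {U : Set X}
    (h : ∀ (K : Type u) [TopologicalSpace K] [CompactSpace K] [T2Space K] (p : K → X),
      Continuous p → IsOpen (p ⁻¹' U)) : IsOpen U :=
  (IsGeneratedBy.isOpen_iff Test.{u}).2 fun K p => h K p p.continuous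

lemma isClosed_of_compact {X : Type*} [TopologicalSpace X] [IsGeneratedBy Test.{u} X] {U : Set X}
    (h : ∀ (K : Type u) [TopologicalSpace K] [CompactSpace K] [T2Space K] (p : K → X),
      Continuous p → IsClosed (p ⁻¹' U)) : IsClosed U :=
  (IsGeneratedBy.isClosed_iff Test.{u}).2 fun K p => h K p p.continuous

lemma continuous_mk_iff {W : Type*} {Y : Type*} [TopologicalSpace W] [TopologicalSpace Y]
    [IsGeneratedBy Test.{u} W] {g : W → Y} :
    Continuous (fun w => (mk (g w) : Kify.{u} Y)) ↔ Continuous g :=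
  IsGeneratedBy.equiv_symm_comp_continuous_iff Test.{u} g

/-- The exponential law for maps out of a compact Hausdorff space. -/
lemma Exp.continuous_iff {X : Type u} {Y : Type v} [TopologicalSpace X] [TopologicalSpace Y]
    {F : K → C(X, Y)} :
    Continuous (fun k => Exp.ofMap (F k)) ↔
      ∀ (L : Type u) [TopologicalSpace L] [CompactSpace L] [T2Space L] (p : L → X),
        Continuous p → Continuous (fun z : K × L => F z.1 (p z.2)) := by
  have := isGeneratedBy_of_compact (K := K)
  rw [continuous_mk_iff, continuous_iInf_rng]
  constructor
  · intro h L _ _ _ p hp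
    have h1 := continuous_induced_rng.1 (continuous_iInf_rng.1 (h (CompHaus.of L)) ⟨p, hp⟩)
    let G : C(K, C(L, Y)) := ⟨_, h1⟩
    exact G.uncurry.continuous
  · intro h L
    refine continuous_iInf_rng.2 fun i => continuous_induced_rng.2 ?_
    exact ContinuousMap.continuous_of_continuous_uncurry _ (h L i i.continuous)

lemma Exp.continuous_iff' {X : Type u} {Y : Type v} [TopologicalSpace X] [TopologicalSpace Y]
    {F : K → Exp X Y} :
    Continuous F ↔
      ∀ (L : Type u) [TopologicalSpace L] [CompactSpace L] [T2Space L] (p : L → X),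
        Continuous p → Continuous (fun z : K × L => (F z.1).toMap (p z.2)) :=
  Exp.continuous_iff (F := fun k => (F k).toMap)

variable {𝕜 : Type} [RCLike 𝕜] {X : Type u} [TopologicalSpace X]

@[ext]
lemma Cb.ext {f g : Cb 𝕜 X} (h : ∀ x, f x = g x) : f = g := DFunLike.ext _ _ h

lemma Cb.continuous (f : Cb 𝕜 X) : Continuous f := f.toMap.continuous

lemma Cb.exists_bound (f : Cb 𝕜 X) : ∃ n : ℕ, ∀ x, ‖f x‖ ≤ n := f.2

@[simp] lemma Cb.add_apply (f g : Cb 𝕜 X) (x : X) : (f + g) x = f x + g x := rfl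
@[simp] lemma Cb.zero_apply (x : X) : (0 : Cb 𝕜 X) x = 0 := rfl
@[simp] lemma Cb.smul_apply (c : 𝕜) (f : Cb 𝕜 X) (x : X) : (c • f) x = c * f x := rfl
@[simp] lemma Cb.one_apply (x : X) : (Cb.one : Cb 𝕜 X) x = 1 := rfl
@[simp] lemma Cb.ofBall_apply (n : ℕ) (f : Exp X (Metric.closedBall (0 : 𝕜) n)) (x : X) :
    Cb.ofBall n f x = f.toMap x := rfl

/-- A bounded continuous function as an element of `C_b(X)`. -/
def Cb.ofFun (f : X → 𝕜) (hf : Continuous f) (hb : ∃ n : ℕ, ∀ x, ‖f x‖ ≤ n) : Cb 𝕜 X :=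
  ⟨⟨f, hf⟩, hb⟩

instance : IsGeneratedBy Test.{u} (Cb 𝕜 X) := (isHKSpace_Cb 𝕜 X).kSpace

/-- The map `C_b(X) → 𝕜 ^ X` is continuous. -/
lemma Cb.continuous_toExp : Continuous (fun f : Cb 𝕜 X => Exp.ofMap f.toMap) := by
  refine continuous_iSup_dom.2 fun n => continuous_coinduced_dom.2 ?_
  refine continuous_of_compact fun K _ _ _ p hp => ?_
  refine Exp.continuous_iff.2 fun L _ _ _ q hq => ?_
  exact continuous_subtype_val.comp (Exp.continuous_iff'.1 hp L q hq)

omit [TopologicalSpace K] [CompactSpace K] [T2Space K] in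
lemma t2Space_exp {Y : Type v} [TopologicalSpace Y] [T2Space Y] : T2Space (Exp X Y) :=
  T2Space.of_injective_continuous (f := fun (f : Exp X Y) (x : X) => f.toMap x)
    (fun f g h => by
      have : (unk.{u} f).toMap = (unk.{u} g).toMap := DFunLike.coe_injective h
      have h2 : ∀ a b : CO X Y, a.toMap = b.toMap → a = b := by
        rintro ⟨a⟩ ⟨b⟩ rfl; rfl
      exact unk.injective (h2 _ _ this))
    (continuous_pi fun x => Exp.continuous_eval x)

omit [T2Space K] in
/-- A compact family in `C_b(X)` is uniformly bounded: an unbounded one would contain an infinite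
set meeting every stage `(nD)^X` of the colimit in a finite set, all of whose subsets are therefore
closed. -/
lemma Cb.exists_bound_of_compact {F : K → Cb 𝕜 X} (hF : Continuous F) :
    ∃ n : ℕ, ∀ k x, ‖F k x‖ ≤ n := by
  by_contra! hcon
  choose k x hkx using hcon
  have hclosed : ∀ A : Set (Cb 𝕜 X), A ⊆ Set.range (fun n => F (k n)) → IsClosed A := by
    intro A hA
    refine isClosed_iSup_iff.2 fun m => isClosed_coinduced.2 ?_
    have := t2Space_exp (X := X) (Y := Metric.closedBall (0 : 𝕜) m)
    refine Set.Finite.isClosed ?_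
    refine Set.Finite.of_finite_image (f := Cb.ofBall m) ?_ ?_
    · refine (Set.finite_le_nat m).image (fun n => F (k n)) |>.subset ?_
      rintro _ ⟨f, hf, rfl⟩
      obtain ⟨n, hn⟩ := hA hf
      refine ⟨n, ?_, hn⟩
      have h1 := hkx n
      simp only at hn
      rw [hn, Cb.ofBall_apply] at h1
      have h2 := mem_closedBall_zero_iff.1 (f.toMap (x n)).2
      have : (n : ℝ) < m := h1.trans_le h2
      exact_mod_cast this.le
    · intro f _ g _ hfg
      have h2 : ∀ a b : CO X (Metric.closedBall (0 : 𝕜) m), a.toMap = b.toMap → a = b := by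
        rintro ⟨a⟩ ⟨b⟩ rfl; rfl
      refine unk.injective (h2 _ _ (ContinuousMap.ext fun y => Subtype.ext ?_))
      exact DFunLike.congr_fun hfg y
  have hfin := finite_of_forall_subset_isClosed (isCompact_range hF)
    (by rintro _ ⟨n, rfl⟩; exact ⟨_, rfl⟩) hclosed
  choose b hb using fun f : Cb 𝕜 X => f.exists_bound
  obtain ⟨N, hN⟩ := (hfin.image b).bddAbove
  have h1 : b (F (k N)) ≤ N := hN ⟨_, ⟨N, rfl⟩, rfl⟩
  exact absurd ((hkx N).trans_le ((hb _ _).trans (Nat.cast_le.2 h1))) (lt_irrefl _)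

/-- A family in `C_b(X)` indexed by a compact Hausdorff space is continuous if and only if it is
uniformly bounded and jointly continuous on compact sets. -/
lemma Cb.continuous_iff {F : K → Cb 𝕜 X} :
    Continuous F ↔ (∃ n : ℕ, ∀ k x, ‖F k x‖ ≤ n) ∧
      ∀ (L : Type u) [TopologicalSpace L] [CompactSpace L] [T2Space L] (p : L → X),
        Continuous p → Continuous (fun z : K × L => F z.1 (p z.2)) := by
  refine ⟨fun hF => ⟨Cb.exists_bound_of_compact hF, ?_⟩, ?_⟩
  · exact Exp.continuous_iff'.1 (Cb.continuous_toExp.comp hF)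
  · rintro ⟨⟨n, hn⟩, h⟩
    let G : K → C(X, Metric.closedBall (0 : 𝕜) n) := fun k =>
      ⟨fun x => ⟨F k x, mem_closedBall_zero_iff.2 (hn k x)⟩, (F k).continuous.subtype_mk _⟩
    have hG : Continuous (fun k => Exp.ofMap (G k)) :=
      Exp.continuous_iff.2 fun L _ _ _ p hp => (h L p hp).subtype_mk _
    exact (Cb.continuous_ofBall n).comp hG

section NDual

variable {V : Type u} [AddCommGroup V] [Module 𝕜 V] [TopologicalSpace V]

lemma NDual.continuous_iff {F : K → NDual 𝕜 V} :
    Continuous F ↔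
      ∀ (L : Type u) [TopologicalSpace L] [CompactSpace L] [T2Space L] (p : L → V),
        Continuous p → Continuous (fun z : K × L => F z.1 (p z.2)) :=
  continuous_induced_rng.trans Exp.continuous_iff

/-- Evaluation is continuous along compact families of functionals and of vectors. -/
lemma NDual.continuous_apply {F : K → NDual 𝕜 V} (hF : Continuous F) {p : K → V}
    (hp : Continuous p) : Continuous (fun k => F k (p k)) :=
  (NDual.continuous_iff.1 hF K p hp).comp (continuous_id.prodMk continuous_id)

@[ext]
lemma NDual.ext {φ ψ : NDual 𝕜 V} (h : ∀ v, φ v = ψ v) : φ = ψ := DFunLike.ext _ _ h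

@[simp] lemma NDual.add_apply (φ ψ : NDual 𝕜 V) (v : V) : (φ + ψ) v = φ v + ψ v := rfl
@[simp] lemma NDual.smul_apply (c : 𝕜) (φ : NDual 𝕜 V) (v : V) : (c • φ) v = c * φ v := rfl
@[simp] lemma NDual.transpose_apply {W : Type u} [AddCommGroup W] [Module 𝕜 W]
    [TopologicalSpace W] (A : V →L[𝕜] W) (φ : NDual 𝕜 W) (v : V) :
    NDual.transpose A φ v = φ (A v) := rfl

end NDual

lemma Cb.continuous_apply {F : K → Cb 𝕜 X} (hF : Continuous F) {p : K → X}
    (hp : Continuous p) : Continuous (fun k => F k (p k)) :=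
  ((Cb.continuous_iff.1 hF).2 K p hp).comp (continuous_id.prodMk continuous_id)

lemma continuous_delta (hX : IsGeneratedBy Test.{u} X) :
    Continuous (delta : X → NDual 𝕜 (Cb 𝕜 X)) := by
  refine continuous_of_compact fun K _ _ _ p hp => NDual.continuous_iff.2 fun L _ _ _ q hq => ?_
  exact Cb.continuous_apply (hq.comp continuous_snd) (hp.comp continuous_fst)

/-! ### Convergent sequences in `C_b(X)` -/

/-- A uniformly bounded sequence of functions converging uniformly on compact sets, together with
its limit, is a compact family in `C_b(X)`. -/
lemma Cb.continuous_sequence {f : ℕ → Cb 𝕜 X} {g : Cb 𝕜 X} {N : ℕ} (hN : ∀ n x, ‖f n x‖ ≤ N)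
    (h : ∀ (L : Type u) [TopologicalSpace L] [CompactSpace L] [T2Space L] (p : L → X),
      Continuous p → TendstoUniformly (fun n l => f n (p l)) (fun l => g (p l)) atTop) :
    Continuous (fun z : ULift.{u} (OnePoint ℕ) => z.down.elim g f) := by
  refine Cb.continuous_iff.2 ⟨⟨N, ?_⟩, fun L _ _ _ p hp => ?_⟩
  · rintro ⟨z⟩ x
    induction z using OnePoint.rec with
    | coe n => exact hN n x
    | infty =>
      have h1 := (h PUnit (fun _ => x) continuous_const).tendsto_at PUnit.unit
      exact le_of_tendsto' h1.norm fun n => hN n x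
  · let φ : OnePoint ℕ → C(L, 𝕜) := fun z => (z.elim g f).toMap.comp ⟨p, hp⟩
    have hφ : Continuous φ := by
      rw [OnePoint.continuous_iff_from_nat, ContinuousMap.tendsto_iff_tendstoUniformly]
      exact h L p hp
    let G : C(OnePoint ℕ, C(L, 𝕜)) := ⟨φ, hφ⟩
    exact G.uncurry.continuous.comp
      ((continuous_uliftDown.comp continuous_fst).prodMk continuous_snd)

/-- Continuous functionals on `C_b(X)` are sequentially continuous for bounded convergence that is
uniform on compact sets. -/
lemma NDual.tendsto_of_tendstoUniformly (φ : NDual 𝕜 (Cb 𝕜 X)) {f : ℕ → Cb 𝕜 X} {g : Cb 𝕜 X}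
    {N : ℕ} (hN : ∀ n x, ‖f n x‖ ≤ N)
    (h : ∀ (L : Type u) [TopologicalSpace L] [CompactSpace L] [T2Space L] (p : L → X),
      Continuous p → TendstoUniformly (fun n l => f n (p l)) (fun l => g (p l)) atTop) :
    Tendsto (fun n => φ (f n)) atTop (𝓝 (φ g)) := by
  have h1 := ((map_continuous φ).comp (Cb.continuous_sequence hN h)).comp
    (continuous_uliftUp (X := OnePoint ℕ))
  exact (OnePoint.continuous_iff_from_nat _).1 h1

/-- A compact family of functionals on `C_b(X)` is uniformly bounded on the unit ball. -/
lemma NDual.exists_bound {F : K → NDual 𝕜 (Cb 𝕜 X)} (hF : Continuous F) :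
    ∃ C : ℝ, ∀ k (f : Cb 𝕜 X), (∀ x, ‖f x‖ ≤ 1) → ‖F k f‖ ≤ C := by
  by_contra! hcon
  choose k f hf hk using fun n : ℕ => hcon ((n + 1 : ℝ) * (n + 1))
  -- the functions `f n / (n + 1)` tend to zero uniformly, but their values do not stay bounded
  let g : ℕ → Cb 𝕜 X := fun n => ((n + 1 : ℝ) : 𝕜)⁻¹ • f n
  have hnorm : ∀ n : ℕ, ‖((n + 1 : ℝ) : 𝕜)⁻¹‖ = (n + 1 : ℝ)⁻¹ := fun n => by
    rw [norm_inv, RCLike.norm_ofReal, abs_of_pos (by positivity)]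
  have hg : ∀ n x, ‖g n x‖ ≤ (n + 1 : ℝ)⁻¹ := fun n x => by
    rw [Cb.smul_apply, norm_mul, hnorm]
    exact mul_le_of_le_one_right (by positivity) (hf n x)
  have hseq : Continuous (fun z : ULift.{u} (OnePoint ℕ) => z.down.elim (0 : Cb 𝕜 X) g) := by
    refine Cb.continuous_sequence (N := 1) (fun n x => (hg n x).trans ?_) fun L _ _ _ p hp => ?_
    · rw [Nat.cast_one]
      exact inv_le_one_of_one_le₀ (by linarith [n.cast_nonneg (α := ℝ)])
    · rw [Metric.tendstoUniformly_iff]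
      intro ε hε
      filter_upwards [tendsto_one_div_add_atTop_nhds_zero_nat.eventually (gt_mem_nhds hε)] with n hn l
      rw [Cb.zero_apply, dist_zero_left]
      refine (hg n _).trans_lt ?_
      rwa [← one_div]
  have hcont := NDual.continuous_iff.1 hF _ _ hseq
  obtain ⟨C, hC⟩ := (isCompact_range hcont.norm).bddAbove
  obtain ⟨n, hn⟩ := exists_nat_ge C
  have h1 : ‖F (k n) (g n)‖ ≤ C := hC ⟨(k n, ⟨(n : OnePoint ℕ)⟩), rfl⟩
  have h2 : ‖F (k n) (g n)‖ = (n + 1 : ℝ)⁻¹ * ‖F (k n) (f n)‖ := by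
    rw [map_smul, norm_smul, hnorm]
  have h3 : (n + 1 : ℝ) < ‖F (k n) (g n)‖ := by
    rw [h2, inv_mul_eq_div, lt_div_iff₀ (by positivity)]
    exact hk n
  linarith

end Plots

/-! ### Baire probability measures from functionals -/

section Daniell

open scoped BoundedContinuousFunction ENNReal

variable {X : Type u} [TopologicalSpace X]

/-- A function with values in `[0, 1]` which vanishes outside `U`. -/
def IsUnitOn (f : X → ℝ) (U : Set X) : Prop := ∀ x, 0 ≤ f x ∧ f x ≤ 1 ∧ (x ∉ U → f x = 0)

/-- A continuous function with values in `[0, 1]`. -/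
def unitFun (f : X → ℝ) (hf : Continuous f) (h : ∀ x, 0 ≤ f x ∧ f x ≤ 1) : X →ᵇ ℝ :=
  BoundedContinuousFunction.ofNormedAddCommGroup f hf 1 fun x => by
    rw [Real.norm_of_nonneg (h x).1]; exact (h x).2

@[simp] lemma unitFun_apply (f : X → ℝ) (hf h) (x : X) : unitFun f hf h x = f x := rfl

/-- The set where a continuous function is positive. -/
def IsCozero (U : Set X) : Prop :=
  ∃ g : X → ℝ, Continuous g ∧ (∀ x, 0 ≤ g x ∧ g x ≤ 1) ∧ U = {x | 0 < g x}

lemma isCozero_of_continuous {g : X → ℝ} (hg : Continuous g) : IsCozero {x | 0 < g x} :=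
  ⟨fun x => min 1 (max 0 (g x)), by fun_prop, fun x => ⟨by positivity, min_le_left _ _⟩, by
    ext x; simp⟩

lemma isCozero_empty : IsCozero (∅ : Set X) := ⟨fun _ => 0, continuous_const, by simp, by simp⟩

lemma isCozero_univ : IsCozero (Set.univ : Set X) :=
  ⟨fun _ => 1, continuous_const, by simp, by simp⟩

lemma IsCozero.inter {U V : Set X} (hU : IsCozero U) (hV : IsCozero V) : IsCozero (U ∩ V) := by
  obtain ⟨g, hg, h1, rfl⟩ := hU
  obtain ⟨k, hk, h2, rfl⟩ := hV
  convert isCozero_of_continuous (hg.min hk) using 1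
  ext x
  simp

lemma IsCozero.iUnion {U : ℕ → Set X} (hU : ∀ n, IsCozero (U n)) : IsCozero (⋃ n, U n) := by
  choose g hg h1 h2 using hU
  have hb : ∀ n x, ‖(1 / 2 : ℝ) ^ n * g n x‖ ≤ (1 / 2 : ℝ) ^ n := fun n x => by
    rw [Real.norm_of_nonneg (mul_nonneg (by positivity) (h1 n x).1)]
    exact mul_le_of_le_one_right (by positivity) (h1 n x).2
  have hs : Summable (fun n : ℕ => (1 / 2 : ℝ) ^ n) := summable_geometric_two
  convert isCozero_of_continuous (continuous_tsum (fun n => ((hg n).const_mul ((1 / 2 : ℝ) ^ n))) hs hb) using 1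
  ext x
  have hsx : Summable (fun n => (1 / 2 : ℝ) ^ n * g n x) := .of_norm_bounded hs (hb · x)
  have hpos : ∀ n, 0 ≤ (1 / 2 : ℝ) ^ n * g n x := fun n => mul_nonneg (by positivity) (h1 n x).1
  simp only [Set.mem_iUnion, Set.mem_ofPred_eq, h2]
  constructor
  · rintro ⟨n, hn⟩
    exact hsx.tsum_pos hpos n (by positivity)
  · intro h
    by_contra! hcon
    have : ∀ n, (1 / 2 : ℝ) ^ n * g n x = 0 := fun n => by
      rw [le_antisymm (hcon n) (h1 n x).1, mul_zero]
    rw [tsum_congr this, tsum_zero] at h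
    exact lt_irrefl _ h

/-- A positive normalised functional on bounded continuous functions which is continuous along
decreasing sequences with pointwise limit zero. -/
structure IsDaniell (Λ : (X →ᵇ ℝ) →ₗ[ℝ] ℝ) : Prop where
  nonneg : ∀ f : X →ᵇ ℝ, (∀ x, 0 ≤ f x) → 0 ≤ Λ f
  one : Λ 1 = 1
  tendsto : ∀ f : ℕ → X →ᵇ ℝ, (∀ n x, 0 ≤ f n x ∧ f n x ≤ 1) → (∀ x, Antitone (f · x)) →
    (∀ x, Tendsto (f · x) atTop (𝓝 0)) → Tendsto (fun n => Λ (f n)) atTop (𝓝 0)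

variable {Λ : (X →ᵇ ℝ) →ₗ[ℝ] ℝ}

lemma IsDaniell.mono (hΛ : IsDaniell Λ) {f g : X →ᵇ ℝ} (h : ∀ x, f x ≤ g x) : Λ f ≤ Λ g := by
  have := hΛ.nonneg (g - f) fun x => by simpa using h x
  rw [map_sub] at this
  linarith

lemma IsDaniell.const (hΛ : IsDaniell Λ) (c : ℝ) : Λ (c • 1) = c := by
  rw [map_smul, hΛ.one, smul_eq_mul, mul_one]

variable (Λ) in
/-- The content of a set: the supremum of the values of the functional at the functions with values
in `[0, 1]` which vanish outside the set. -/
def content (U : Set X) : ℝ≥0∞ := ⨆ (f : X →ᵇ ℝ) (_ : IsUnitOn f U), ENNReal.ofReal (Λ f)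

lemma le_content {U : Set X} {f : X →ᵇ ℝ} (hf : IsUnitOn f U) :
    ENNReal.ofReal (Λ f) ≤ content Λ U := le_iSup₂_of_le f hf le_rfl

lemma content_mono {U V : Set X} (h : U ⊆ V) : content Λ U ≤ content Λ V :=
  iSup₂_le fun _ hf => le_content fun x =>
    ⟨(hf x).1, (hf x).2.1, fun hx => (hf x).2.2 fun hU => hx (h hU)⟩

lemma content_empty : content Λ ∅ = 0 := by
  refine le_antisymm (iSup₂_le fun f hf => ?_) zero_le
  have : f = 0 := by ext x; exact (hf x).2.2 (Set.notMem_empty x)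
  simp [this]

lemma IsDaniell.content_univ (hΛ : IsDaniell Λ) : content Λ Set.univ = 1 := by
  refine le_antisymm (iSup₂_le fun f hf => ?_) ?_
  · rw [← ENNReal.ofReal_one]
    refine ENNReal.ofReal_le_ofReal ?_
    rw [← hΛ.one]
    exact hΛ.mono fun x => (hf x).2.1
  · refine le_trans ?_ (le_content (f := 1) fun x => by simp)
    simp [hΛ.one]

/-- Countable subadditivity: the functions `f hₖ / max (1/(n+1), h₀ + ... + hₙ)` decompose a
function on the union of the sets `{hₖ > 0}`, up to an error which decreases to zero. -/
lemma IsDaniell.content_iUnion_le (hΛ : IsDaniell Λ) {U : ℕ → Set X} (hU : ∀ n, IsCozero (U n)) :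
    content Λ (⋃ n, U n) ≤ ∑' n, content Λ (U n) := by
  choose h hc h01 hU using hU
  refine iSup₂_le fun f hf => ?_
  let s : ℕ → X → ℝ := fun n x => ∑ k ∈ Finset.range (n + 1), h k x
  have hs0 : ∀ n x, 0 ≤ s n x := fun n x => Finset.sum_nonneg fun k _ => (h01 k x).1
  have hsc : ∀ n, Continuous (s n) := fun n => continuous_finsetSum _ fun k _ => hc k
  have hsm : ∀ x, Monotone (s · x) := fun x => monotone_nat_of_le_succ fun n => by
    simp only [s]
    rw [Finset.sum_range_succ _ (n + 1)]
    linarith [(h01 (n + 1) x).1]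
  let d : ℕ → X → ℝ := fun n x => max (1 / (n + 1 : ℝ)) (s n x)
  have hd0 : ∀ n x, 0 < d n x := fun n x => lt_max_of_lt_left Nat.one_div_pos_of_nat
  have hdc : ∀ n, Continuous (d n) := fun n => continuous_const.max (hsc n)
  have hle : ∀ n k x, k ∈ Finset.range (n + 1) → h k x ≤ d n x := fun n k x hk =>
    (Finset.single_le_sum (f := fun k => h k x) (fun j _ => (h01 j x).1) hk).trans (le_max_right _ _)
  have hunit : ∀ n k x, k ∈ Finset.range (n + 1) → 0 ≤ f x * h k x / d n x ∧
      f x * h k x / d n x ≤ 1 := fun n k x hk =>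
    ⟨div_nonneg (mul_nonneg (hf x).1 (h01 k x).1) (hd0 n x).le, by
      rw [div_le_one (hd0 n x)]
      exact (mul_le_of_le_one_left (h01 k x).1 (hf x).2.1).trans (hle n k x hk)⟩
  let F : ℕ → ℕ → X →ᵇ ℝ := fun n k => if hk : k ∈ Finset.range (n + 1) then
    unitFun (fun x => f x * h k x / d n x)
      ((f.continuous.mul (hc k)).div (hdc n) fun x => (hd0 n x).ne') (hunit n k · hk) else 0
  have hF : ∀ n k x, k ∈ Finset.range (n + 1) → F n k x = f x * h k x / d n x := by
    intro n k x hk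
    simp only [F, dif_pos hk, unitFun_apply]
  have hFsum : ∀ n x, (∑ k ∈ Finset.range (n + 1), F n k) x = f x * (s n x / d n x) := by
    intro n x
    rw [BoundedContinuousFunction.sum_apply, Finset.sum_congr rfl (fun k hk => hF n k x hk),
      ← Finset.sum_div, ← Finset.mul_sum, mul_div_assoc]
  have hr1 : ∀ n x, s n x / d n x ≤ 1 := fun n x => (div_le_one (hd0 n x)).2 (le_max_right _ _)
  have hr0 : ∀ n x, 0 ≤ s n x / d n x := fun n x => div_nonneg (hs0 n x) (hd0 n x).le
  have hrm : ∀ x, Monotone (fun n => s n x / d n x) := by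
    intro x n m hnm
    rw [div_le_div_iff₀ (hd0 n x) (hd0 m x)]
    have e1 : (1 : ℝ) / (m + 1) ≤ 1 / (n + 1) := Nat.one_div_le_one_div hnm
    have e2 := hsm x hnm
    simp only at e2
    rw [mul_comm (s m x)]
    have a1 := hs0 n x
    have a2 := hs0 m x
    rcases le_total (1 / (m + 1 : ℝ)) (s m x) with h3 | h3
    · have : d m x = s m x := max_eq_right h3
      rw [this]
      exact mul_le_mul_of_nonneg_right (le_max_right _ _) a2
    · have : d m x = 1 / (m + 1 : ℝ) := max_eq_left h3
      rw [this, mul_comm]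
      calc 1 / (m + 1 : ℝ) * s n x ≤ 1 / (n + 1 : ℝ) * s m x :=
            mul_le_mul e1 e2 a1 (by positivity)
        _ ≤ d n x * s m x := mul_le_mul_of_nonneg_right (le_max_left _ _) a2
  have hrt : ∀ x ∈ ⋃ n, U n, ∀ᶠ n in atTop, s n x / d n x = 1 := by
    intro x hx
    obtain ⟨k, hk⟩ := Set.mem_iUnion.1 hx
    have hk : 0 < h k x := by rwa [hU k] at hk
    filter_upwards [tendsto_one_div_add_atTop_nhds_zero_nat.eventually (gt_mem_nhds hk),
      eventually_ge_atTop k] with n hn hkn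
    have h3 : h k x ≤ s n x := Finset.single_le_sum (f := fun k => h k x)
      (fun j _ => (h01 j x).1) (Finset.mem_range.2 (Nat.lt_succ_of_le hkn))
    have : d n x = s n x := max_eq_right (hn.le.trans h3)
    rw [this, div_self (hk.trans_le h3).ne']
  have hval : ∀ n x, (f - ∑ k ∈ Finset.range (n + 1), F n k) x = f x * (1 - s n x / d n x) := by
    intro n x
    rw [BoundedContinuousFunction.sub_apply, hFsum]
    ring
  have hlim := hΛ.tendsto (fun n => f - ∑ k ∈ Finset.range (n + 1), F n k)
    (fun n x => by
      rw [hval]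
      exact ⟨mul_nonneg (hf x).1 (sub_nonneg.2 (hr1 n x)),
        mul_le_one₀ (hf x).2.1 (sub_nonneg.2 (hr1 n x)) (by linarith [hr0 n x])⟩)
    (fun x n m hnm => by
      simp only [hval]
      exact mul_le_mul_of_nonneg_left (sub_le_sub_left (hrm x hnm) _) (hf x).1)
    (fun x => by
      refine tendsto_const_nhds.congr' ?_
      by_cases hx : x ∈ ⋃ n, U n
      · filter_upwards [hrt x hx] with n hn
        rw [hval, hn, sub_self, mul_zero]
      · filter_upwards with n
        rw [hval, (hf x).2.2 hx, zero_mul])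
  have hlim2 : Tendsto (fun n => ENNReal.ofReal (Λ (∑ k ∈ Finset.range (n + 1), F n k))) atTop
      (𝓝 (ENNReal.ofReal (Λ f))) := by
    refine ENNReal.tendsto_ofReal ?_
    have := (tendsto_const_nhds (x := Λ f)).sub hlim
    simpa using this
  refine le_of_tendsto' hlim2 fun n => ?_
  rw [map_sum]
  refine (ENNReal.ofReal_sum_of_nonneg fun k hk => ?_).le.trans ?_
  · exact hΛ.nonneg _ fun x => by rw [hF n k x hk]; exact (hunit n k x hk).1
  · refine (Finset.sum_le_sum fun k hk => le_content (U := U k) fun x => ?_).trans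
      (ENNReal.sum_le_tsum _)
    rw [hF n k x hk]
    refine ⟨(hunit n k x hk).1, (hunit n k x hk).2, fun hx => ?_⟩
    have : h k x = 0 := by
      rw [hU k] at hx
      exact le_antisymm (not_lt.1 hx) (h01 k x).1
    rw [this, mul_zero, zero_div]

variable (Λ) in
/-- The outer measure of a Daniell functional, defined by covers with cozero sets. -/
def outer : OuterMeasure X :=
  inducedOuterMeasure (P := IsCozero) (fun U _ => content Λ U) isCozero_empty content_empty

lemma outer_apply (hΛ : IsDaniell Λ) {U : Set X} (hU : IsCozero U) :
    outer Λ U = content Λ U :=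
  inducedOuterMeasure_eq' (P := IsCozero) (fun _ h => IsCozero.iUnion h)
    (fun _ h => hΛ.content_iUnion_le h) (fun _ _ _ _ h => content_mono h) hU

lemma isCaratheodory_of_isCozero (hΛ : IsDaniell Λ) {U : Set X} (hU : IsCozero U) :
    MeasurableSet[(outer Λ).caratheodory] U := by
  refine (inducedOuterMeasure_caratheodory (P := IsCozero) (fun _ h => IsCozero.iUnion h)
    (fun _ h => hΛ.content_iUnion_le h) (fun _ _ _ _ h => content_mono h) U).2 fun V hV => ?_
  change outer Λ (V ∩ U) + outer Λ (V \ U) ≤ outer Λ V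
  rw [outer_apply hΛ hV, outer_apply hΛ (hV.inter hU)]
  refine (ENNReal.biSup_add' ⟨0, fun x => by simp⟩ _).trans_le (iSup₂_le fun f hf => ?_)
  refine ENNReal.le_of_forall_pos_le_add fun δ hδ _ => ?_
  -- the part of `V` where `f` is small is a cozero set containing `V \ U`
  have hW : IsCozero (V ∩ {x | 0 < (δ : ℝ) - f x}) :=
    hV.inter (isCozero_of_continuous (continuous_const.sub f.continuous))
  have hsub : V \ U ⊆ V ∩ {x | 0 < (δ : ℝ) - f x} := fun x hx => ⟨hx.1, by
    change 0 < (δ : ℝ) - f x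
    rw [(hf x).2.2 fun h => hx.2 h.2, sub_zero]
    exact_mod_cast hδ⟩
  refine (add_le_add_right ((measure_mono hsub).trans_eq (outer_apply hΛ hW)) _).trans ?_
  unfold content
  rw [add_comm]
  refine (ENNReal.biSup_add' ⟨0, fun x => by simp⟩ _).trans_le (iSup₂_le fun g hg => ?_)
  let k : X →ᵇ ℝ := unitFun (fun x => max 0 (f x - δ))
    (continuous_const.max (f.continuous.sub continuous_const)) fun x =>
      ⟨le_max_left _ _, max_le zero_le_one (by linarith [(hf x).2.1, δ.coe_nonneg])⟩
  have hk : ∀ x, k x = max 0 (f x - δ) := fun x => rfl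
  have h0 : 0 ≤ Λ g := hΛ.nonneg _ fun x => (hg x).1
  have h1 : Λ f ≤ Λ k + δ := by
    have := hΛ.mono (f := f) (g := k + (δ : ℝ) • 1) fun x => by
      simp only [BoundedContinuousFunction.coe_add, Pi.add_apply, hk,
        BoundedContinuousFunction.coe_smul, BoundedContinuousFunction.coe_one, Pi.one_apply,
        smul_eq_mul, mul_one]
      linarith [le_max_right 0 (f x - δ)]
    rwa [map_add, hΛ.const] at this
  have h2 : ENNReal.ofReal (Λ (g + k)) ≤ content Λ V := by
    refine le_content fun x => ?_
    rw [BoundedContinuousFunction.add_apply, hk]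
    by_cases hx : x ∈ V ∩ {x | 0 < (δ : ℝ) - f x}
    · have h3 : 0 < (δ : ℝ) - f x := hx.2
      rw [max_eq_left (by linarith), add_zero]
      exact ⟨(hg x).1, (hg x).2.1, fun h => absurd hx.1 h⟩
    · rw [(hg x).2.2 hx, zero_add]
      refine ⟨le_max_left _ _, max_le zero_le_one (by linarith [(hf x).2.1, δ.coe_nonneg]),
        fun hxV => ?_⟩
      rw [(hf x).2.2 fun h => hxV h.1]
      exact max_eq_left (by linarith [δ.coe_nonneg])
  calc ENNReal.ofReal (Λ g) + ENNReal.ofReal (Λ f)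
      ≤ ENNReal.ofReal (Λ g) + ENNReal.ofReal (Λ k + δ) := by gcongr
    _ ≤ ENNReal.ofReal (Λ g) + (ENNReal.ofReal (Λ k) + ENNReal.ofReal δ) := by
        gcongr; exact ENNReal.ofReal_add_le
    _ = ENNReal.ofReal (Λ (g + k)) + δ := by
        rw [map_add, ENNReal.ofReal_add h0 (hΛ.nonneg _ fun x => le_max_left _ _), add_assoc,
          ENNReal.ofReal_coe_nnreal]
    _ ≤ content Λ V + δ := by gcongr

lemma baire_eq_generateFrom :
    baire ℝ X = MeasurableSpace.generateFrom {U : Set X | IsCozero U} := by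
  refine le_antisymm (iSup_le fun g => ?_) (MeasurableSpace.generateFrom_le fun U hU => ?_)
  · rw [borel_eq_generateFrom_Ioi, MeasurableSpace.comap_generateFrom]
    refine MeasurableSpace.generateFrom_le ?_
    rintro _ ⟨_, ⟨a, rfl⟩, rfl⟩
    refine MeasurableSpace.measurableSet_generateFrom ?_
    change IsCozero (g ⁻¹' Set.Ioi a)
    convert isCozero_of_continuous (g.continuous.sub (continuous_const (y := a))) using 1
    ext x
    exact (sub_pos (a := g x) (b := a)).symm
  · obtain ⟨g, hg, -, rfl⟩ := hU
    exact le_iSup (fun f : C(X, ℝ) => (borel ℝ).comap f) ⟨g, hg⟩ _ ⟨Set.Ioi 0,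
      borel_eq_generateFrom_Ioi ℝ ▸ MeasurableSpace.measurableSet_generateFrom ⟨0, rfl⟩, rfl⟩

section Baire

variable (𝕜 : Type) [RCLike 𝕜]

lemma measurable_baire {f : X → 𝕜} (hf : Continuous f) : Measurable[baire 𝕜 X] f := by
  rw [(BorelSpace.measurable_eq : RCLike.measurableSpace = borel 𝕜)]
  exact (comap_measurable f).mono (le_iSup (fun f : C(X, 𝕜) => (borel 𝕜).comap f) ⟨f, hf⟩) le_rfl

/-- The Baire `σ`-algebra does not depend on the scalars. -/
lemma baire_eq : baire 𝕜 X = baire ℝ X := by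
  refine le_antisymm (iSup_le fun f => ?_) (iSup_le fun f => ?_)
  · rw [← (BorelSpace.measurable_eq : RCLike.measurableSpace = borel 𝕜)]
    refine Measurable.comap_le ?_
    let _ := baire ℝ X
    have h1 := measurable_baire ℝ (RCLike.continuous_re.comp f.continuous)
    have h2 := measurable_baire ℝ (RCLike.continuous_im.comp f.continuous)
    have h3 : Measurable fun x => (RCLike.re (f x) : 𝕜) + (RCLike.im (f x) : 𝕜) * RCLike.I :=
      (RCLike.measurable_ofReal.comp h1).add ((RCLike.measurable_ofReal.comp h2).mul_const _)
    simpa only [RCLike.re_add_im] using h3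
  · rw [← (BorelSpace.measurable_eq : Real.measurableSpace = borel ℝ)]
    refine Measurable.comap_le ?_
    let _ := baire 𝕜 X
    have h1 := measurable_baire 𝕜 (RCLike.continuous_ofReal.comp f.continuous)
    simpa [Function.comp_def] using RCLike.measurable_re.comp h1

end Baire

lemma isPiSystem_isCozero : IsPiSystem {U : Set X | IsCozero U} :=
  fun _ hU _ hV _ => hU.inter hV

lemma sum_clamp (t : ℝ) (ht : 0 ≤ t) (n : ℕ) :
    ∑ k ∈ Finset.range n, min 1 (max 0 (t - k)) = min (n : ℝ) t := by
  induction n with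
  | zero => simp [ht]
  | succ n ih =>
    rw [Finset.sum_range_succ, ih]
    push_cast
    rcases le_total t n with h | h
    · rw [max_eq_left (by linarith), min_eq_right h, min_eq_right (by linarith : t ≤ n + 1)]
      simp
    · rw [max_eq_right (by linarith), min_eq_left h, ← min_add_add_left]
      congr 1
      ring

lemma sum_indicator_le (t : ℝ) (ht : 0 ≤ t) (n : ℕ) :
    ∑ k ∈ Finset.range n, (if (k : ℝ) < t then 1 else 0 : ℝ) ≤ min (n : ℝ) (t + 1) := by
  induction n with
  | zero => simpa using by linarith
  | succ n ih =>
    rw [Finset.sum_range_succ]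
    push_cast
    split_ifs with h
    · exact le_min (by linarith [min_le_left (n : ℝ) (t + 1)])
        (by linarith [min_le_left (n : ℝ) (t + 1)])
    · rw [add_zero]
      exact ih.trans (min_le_min_right _ (by linarith))

/-- A functional is dominated by the integral with respect to a measure extending its content: a
function is the average of its truncated slices. -/
lemma le_integral_of_content [m : MeasurableSpace X] (hm : m = baire ℝ X)
    {μ : Measure X} [IsProbabilityMeasure μ] (hμ : ∀ U, IsCozero U → μ U = content Λ U)
    {f : X →ᵇ ℝ} (hf : ∀ x, 0 ≤ f x ∧ f x ≤ 1) : Λ f ≤ ∫ x, f x ∂μ := by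
  have hmeas : ∀ g : X → ℝ, Continuous g → Measurable g := fun g hg => by
    rw [hm]; exact measurable_baire ℝ hg
  have hint : Integrable f μ := Integrable.of_bound (hmeas f f.continuous).aestronglyMeasurable 1
    (ae_of_all _ fun x => by rw [Real.norm_of_nonneg (hf x).1]; exact (hf x).2)
  have key : ∀ n : ℕ, n * Λ f ≤ n * ∫ x, f x ∂μ + 1 := by
    intro n
    let F : ℕ → X →ᵇ ℝ := fun k => unitFun (fun x => min 1 (max 0 (n * f x - k)))
      (by fun_prop) (fun x => ⟨by positivity, min_le_left _ _⟩)
    have hsum : (n : ℝ) • f = ∑ k ∈ Finset.range n, F k := by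
      ext x
      rw [BoundedContinuousFunction.sum_apply]
      have h1 := sum_clamp (n * f x) (mul_nonneg n.cast_nonneg (hf x).1) n
      rw [min_eq_right (mul_le_of_le_one_right n.cast_nonneg (hf x).2)] at h1
      exact h1.symm
    have hU : ∀ k : ℕ, IsCozero {x | 0 < n * f x - k} := fun k =>
      isCozero_of_continuous (by fun_prop)
    have hUm : ∀ k : ℕ, MeasurableSet {x | 0 < n * f x - k} := fun k => by
      rw [hm, baire_eq_generateFrom]
      exact MeasurableSpace.measurableSet_generateFrom (hU k)
    have h2 : ∀ k, Λ (F k) ≤ ∫ x, (if (k : ℝ) < n * f x then 1 else 0 : ℝ) ∂μ := by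
      intro k
      have e : (fun x => (if (k : ℝ) < n * f x then 1 else 0 : ℝ)) =
          Set.indicator {x | 0 < n * f x - k} 1 := by
        ext x
        simp [Set.indicator_apply]
      rw [e, integral_indicator_one (hUm k), Measure.real, hμ _ (hU k),
        ← ENNReal.ofReal_le_iff_le_toReal (by rw [← hμ _ (hU k)]; exact measure_ne_top _ _)]
      refine le_content fun x => ⟨le_min zero_le_one (le_max_left _ _), min_le_left _ _, fun hx => ?_⟩
      have hx : ¬ 0 < n * f x - k := hx
      rw [unitFun_apply, max_eq_left (not_lt.1 hx)]
      simp
    have hint2 : ∀ k : ℕ, Integrable (fun x => (if (k : ℝ) < n * f x then 1 else 0 : ℝ)) μ :=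
      fun k => Integrable.of_bound (Measurable.ite
        (by simpa using hUm k) measurable_const measurable_const).aestronglyMeasurable 1
        (ae_of_all _ fun x => by split_ifs <;> simp)
    calc n * Λ f = ∑ k ∈ Finset.range n, Λ (F k) := by
          rw [← map_sum, ← hsum, map_smul, smul_eq_mul]
      _ ≤ ∑ k ∈ Finset.range n, ∫ x, (if (k : ℝ) < n * f x then 1 else 0 : ℝ) ∂μ :=
          Finset.sum_le_sum fun k _ => h2 k
      _ = ∫ x, ∑ k ∈ Finset.range n, (if (k : ℝ) < n * f x then 1 else 0 : ℝ) ∂μ :=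
          (integral_finsetSum _ fun k _ => hint2 k).symm
      _ ≤ ∫ x, (n * f x + 1) ∂μ := integral_mono (integrable_finsetSum _ fun k _ => hint2 k)
          ((hint.const_mul _).add (integrable_const _)) fun x =>
            (sum_indicator_le _ (mul_nonneg n.cast_nonneg (hf x).1) n).trans (min_le_right _ _)
      _ = n * ∫ x, f x ∂μ + 1 := by
          rw [integral_add (hint.const_mul _) (integrable_const _), integral_const_mul]
          simp
  by_contra! hlt
  obtain ⟨n, hn⟩ := exists_nat_gt (1 / (Λ f - ∫ x, f x ∂μ))
  rw [div_lt_iff₀ (sub_pos.2 hlt)] at hn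
  linarith [key n]

/-- The Daniell–Stone theorem for bounded continuous functions. -/
theorem IsDaniell.exists_measure (hΛ : IsDaniell Λ) :
    ∃ μ : @Measure X (baire ℝ X), IsProbabilityMeasure μ ∧ ∀ f : X →ᵇ ℝ, Λ f = ∫ x, f x ∂μ := by
  let _ : MeasurableSpace X := baire ℝ X
  have hle : baire ℝ X ≤ (outer Λ).caratheodory := by
    rw [baire_eq_generateFrom]
    exact MeasurableSpace.generateFrom_le fun U hU => isCaratheodory_of_isCozero hΛ hU
  let μ : Measure X := (outer Λ).toMeasure hle
  have hmeas : ∀ U, IsCozero U → MeasurableSet U := fun U hU =>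
    (baire_eq_generateFrom (X := X)).ge _ (MeasurableSpace.measurableSet_generateFrom hU)
  have hμ : ∀ U, IsCozero U → μ U = content Λ U := fun U hU => by
    rw [toMeasure_apply _ _ (hmeas U hU),
      outer_apply hΛ hU]
  have hprob : IsProbabilityMeasure μ := ⟨by rw [hμ _ isCozero_univ, hΛ.content_univ]⟩
  refine ⟨μ, hprob, fun f => ?_⟩
  have hint : ∀ f : X →ᵇ ℝ, Integrable f μ := fun f =>
    Integrable.of_bound (measurable_baire ℝ f.continuous).aestronglyMeasurable ‖f‖
      (ae_of_all _ f.norm_coe_le_norm)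
  have h1 : ∀ f : X →ᵇ ℝ, (∀ x, 0 ≤ f x ∧ f x ≤ 1) → Λ f = ∫ x, f x ∂μ := by
    intro f hf
    refine le_antisymm (le_integral_of_content rfl hμ hf) ?_
    have h2 := le_integral_of_content rfl hμ (f := 1 - f) fun x => by
      simpa using ⟨(hf x).2, (hf x).1⟩
    rw [map_sub, hΛ.one] at h2
    have h3 : ∫ x, (1 - f) x ∂μ = 1 - ∫ x, f x ∂μ := by
      simp only [BoundedContinuousFunction.coe_sub, BoundedContinuousFunction.coe_one,
        Pi.sub_apply, Pi.one_apply]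
      rw [integral_sub (integrable_const _) (hint f)]
      simp
    linarith
  -- reduce to values in the unit interval by an affine change
  set c : ℝ := ‖f‖ + 1 with hc
  have hc0 : 0 < c := by positivity
  have hb : ∀ x, -c ≤ f x ∧ f x ≤ c := fun x => by
    have := abs_le.1 (f.norm_coe_le_norm x)
    exact ⟨by linarith, by linarith⟩
  have h4 := h1 ((2 * c)⁻¹ • (f + c • 1)) fun x => by
    simp only [BoundedContinuousFunction.coe_smul, BoundedContinuousFunction.coe_add,
      BoundedContinuousFunction.coe_one, Pi.add_apply, Pi.one_apply, smul_eq_mul, mul_one]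
    rw [inv_mul_eq_div]
    exact ⟨div_nonneg (by linarith [(hb x).1]) (by positivity),
      (div_le_one (by positivity)).2 (by linarith [(hb x).2])⟩
  rw [map_smul, map_add, hΛ.const] at h4
  simp only [BoundedContinuousFunction.coe_smul, BoundedContinuousFunction.coe_add,
      BoundedContinuousFunction.coe_one, Pi.add_apply, Pi.one_apply, smul_eq_mul, mul_one] at h4
  rw [integral_const_mul, integral_add (hint f) (integrable_const _)] at h4
  have h5 := mul_left_cancel₀ (by positivity) h4
  simpa using h5

/-- A Baire probability measure is determined by the integrals of bounded continuous functions. -/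
theorem ext_of_integral {μ ν : @Measure X (baire ℝ X)} (hμ : IsProbabilityMeasure μ)
    (hν : IsProbabilityMeasure ν) (h : ∀ f : X →ᵇ ℝ, ∫ x, f x ∂μ = ∫ x, f x ∂ν) : μ = ν := by
  let _ : MeasurableSpace X := baire ℝ X
  refine ext_of_generate_finite _ baire_eq_generateFrom isPiSystem_isCozero ?_ (by simp)
  rintro _ ⟨g, hg, h01, rfl⟩
  have hlim : ∀ ρ : Measure X, IsProbabilityMeasure ρ →
      Tendsto (fun n : ℕ => ∫ x, min 1 (n * g x) ∂ρ) atTop (𝓝 (ρ.real {x | 0 < g x})) := by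
    intro ρ hρ
    have hmeas : MeasurableSet {x | 0 < g x} := measurable_baire ℝ hg measurableSet_Ioi
    rw [← integral_indicator_one hmeas]
    refine tendsto_integral_of_dominated_convergence (fun _ => 1)
      (fun n => (measurable_baire ℝ (by fun_prop)).aestronglyMeasurable)
      (integrable_const _) (fun n => ae_of_all _ fun x => ?_) (ae_of_all _ fun x => ?_)
    · rw [Real.norm_of_nonneg (le_min zero_le_one (mul_nonneg n.cast_nonneg (h01 x).1))]
      exact min_le_left _ _
    · refine tendsto_const_nhds.congr' ?_
      by_cases hx : 0 < g x
      · obtain ⟨N, hN⟩ := exists_nat_gt (1 / g x)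
        filter_upwards [eventually_ge_atTop N] with n hn
        rw [Set.indicator_of_mem (show x ∈ {x | 0 < g x} from hx), Pi.one_apply, min_eq_left]
        rw [div_lt_iff₀ hx] at hN
        exact hN.le.trans (mul_le_mul_of_nonneg_right (Nat.cast_le.2 hn) hx.le)
      · filter_upwards with n
        rw [Set.indicator_of_notMem (show x ∉ {x | 0 < g x} from hx),
          le_antisymm (not_lt.1 hx) (h01 x).1]
        simp
  have h1 := hlim μ hμ
  have h2 : ∀ n : ℕ, ∫ x, min 1 (n * g x) ∂μ = ∫ x, min 1 (n * g x) ∂ν := fun n =>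
    h (unitFun (fun x => min 1 (n * g x)) (by fun_prop) fun x =>
      ⟨le_min zero_le_one (mul_nonneg n.cast_nonneg (h01 x).1), min_le_left _ _⟩)
  simp only [h2] at h1
  have h3 := tendsto_nhds_unique h1 (hlim ν hν)
  exact (measureReal_eq_measureReal_iff (measure_ne_top _ _) (measure_ne_top _ _)).1 h3

end Daniell

/-! ### Functionals in `P(X)` are integrals against `k`-regular probability measures -/

section Representation

open scoped BoundedContinuousFunction ComplexOrder

variable {𝕜 : Type} [RCLike 𝕜] {X : Type u} [TopologicalSpace X]

variable (𝕜) in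
/-- Real-valued bounded continuous functions as elements of `C_b(X)`. -/
def Cb.ofReal (f : X →ᵇ ℝ) : Cb 𝕜 X :=
  Cb.ofFun (fun x => (f x : 𝕜)) (RCLike.continuous_ofReal.comp f.continuous)
    ⟨⌈‖f‖⌉₊, fun x => by
      rw [RCLike.norm_ofReal]
      exact (f.norm_coe_le_norm x).trans (Nat.le_ceil _)⟩

@[simp] lemma Cb.ofReal_apply (f : X →ᵇ ℝ) (x : X) : Cb.ofReal 𝕜 f x = (f x : 𝕜) := rfl

/-- A real-valued bounded continuous function extracted from an element of `C_b(X)`. -/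
def Cb.realPart (f : Cb 𝕜 X) (r : 𝕜 → ℝ) (hr : Continuous r) (h : ∀ z, |r z| ≤ ‖z‖) : X →ᵇ ℝ :=
  BoundedContinuousFunction.ofNormedAddCommGroup (fun x => r (f x)) (hr.comp f.continuous)
    f.exists_bound.choose fun x => (h _).trans (f.exists_bound.choose_spec x)

/-- The real part of an element of `C_b(X)`. -/
def Cb.re (f : Cb 𝕜 X) : X →ᵇ ℝ :=
  f.realPart RCLike.re RCLike.continuous_re RCLike.abs_re_le_norm

/-- The imaginary part of an element of `C_b(X)`. -/
def Cb.im (f : Cb 𝕜 X) : X →ᵇ ℝ :=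
  f.realPart RCLike.im RCLike.continuous_im RCLike.abs_im_le_norm

lemma Cb.re_apply (f : Cb 𝕜 X) (x : X) : f.re x = RCLike.re (f x) := rfl
lemma Cb.im_apply (f : Cb 𝕜 X) (x : X) : f.im x = RCLike.im (f x) := rfl

lemma Cb.eq_re_add_im (f : Cb 𝕜 X) :
    f = Cb.ofReal 𝕜 f.re + (RCLike.I : 𝕜) • Cb.ofReal 𝕜 f.im := by
  ext x
  rw [Cb.add_apply, Cb.smul_apply, Cb.ofReal_apply, Cb.ofReal_apply, Cb.re_apply, Cb.im_apply,
    mul_comm, RCLike.re_add_im]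

lemma Cb.integrable {m : MeasurableSpace X} {μ : Measure X} [IsFiniteMeasure μ] (f : Cb 𝕜 X)
    (hm : Measurable f) : Integrable (fun x => f x) μ := by
  obtain ⟨n, hn⟩ := f.exists_bound
  exact Integrable.of_bound hm.aestronglyMeasurable n (ae_of_all _ hn)

/-- Positive normalised linear functionals on `C_b(X)`. -/
structure IsState (φ : Cb 𝕜 X → 𝕜) : Prop where
  add : ∀ f g, φ (f + g) = φ f + φ g
  smul : ∀ (c : 𝕜) f, φ (c • f) = c * φ f
  nonneg : ∀ f : Cb 𝕜 X, (∀ x, 0 ≤ f x) → 0 ≤ φ f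
  one : φ Cb.one = 1

lemma isState_of_mem {φ : NDual 𝕜 (Cb 𝕜 X)} (hφ : φ ∈ P 𝕜 X) : IsState (φ : Cb 𝕜 X → 𝕜) :=
  ⟨map_add φ, map_smul φ, hφ.2.1, hφ.2.2⟩

/-- A state is real on real functions. -/
lemma IsState.im_ofReal {φ : Cb 𝕜 X → 𝕜} (hφ : IsState φ) (f : X →ᵇ ℝ) :
    RCLike.im (φ (Cb.ofReal 𝕜 f)) = 0 := by
  have h := hφ.nonneg (Cb.ofReal 𝕜 f + (‖f‖ : 𝕜) • Cb.one) fun x => by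
    rw [Cb.add_apply, Cb.smul_apply, Cb.ofReal_apply, Cb.one_apply, mul_one, ← RCLike.ofReal_add]
    have := (abs_le.1 (f.norm_coe_le_norm x)).1
    exact RCLike.ofReal_nonneg.2 (by linarith)
  rw [hφ.add, hφ.smul, hφ.one, mul_one] at h
  simpa using (RCLike.nonneg_iff.1 h).2

/-- The real functional underlying a state. -/
def IsState.real {φ : Cb 𝕜 X → 𝕜} (hφ : IsState φ) : (X →ᵇ ℝ) →ₗ[ℝ] ℝ where
  toFun f := RCLike.re (φ (Cb.ofReal 𝕜 f))
  map_add' f g := by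
    have : Cb.ofReal 𝕜 (f + g) = Cb.ofReal 𝕜 f + Cb.ofReal 𝕜 g := by
      ext x
      simp
    rw [this, hφ.add, map_add]
  map_smul' c f := by
    have : Cb.ofReal 𝕜 (c • f) = (c : 𝕜) • Cb.ofReal 𝕜 f := by
      ext x
      simp
    rw [this, hφ.smul, RCLike.re_ofReal_mul]
    rfl

lemma IsState.ofReal_real {φ : Cb 𝕜 X → 𝕜} (hφ : IsState φ) (f : X →ᵇ ℝ) :
    (hφ.real f : 𝕜) = φ (Cb.ofReal 𝕜 f) := by
  rw [← RCLike.re_add_im (φ (Cb.ofReal 𝕜 f)), hφ.im_ofReal]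
  simp [IsState.real]

lemma IsState.real_nonneg {φ : Cb 𝕜 X → 𝕜} (hφ : IsState φ) (f : X →ᵇ ℝ) (hf : ∀ x, 0 ≤ f x) :
    0 ≤ hφ.real f :=
  (RCLike.nonneg_iff.1 (hφ.nonneg (Cb.ofReal 𝕜 f) fun x => RCLike.ofReal_nonneg.2 (hf x))).1

lemma IsState.real_one {φ : Cb 𝕜 X → 𝕜} (hφ : IsState φ) : hφ.real 1 = 1 := by
  have : Cb.ofReal 𝕜 (1 : X →ᵇ ℝ) = Cb.one := by ext x; simp
  change RCLike.re (φ (Cb.ofReal 𝕜 1)) = 1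
  rw [this, hφ.one, RCLike.one_re]

/-- If the real functional of a state is given by a measure, so is the state. -/
lemma IsState.eq_integral {φ : Cb 𝕜 X → 𝕜} (hφ : IsState φ) {m : MeasurableSpace X}
    (hm : ∀ f : X →ᵇ ℝ, Measurable f) {μ : Measure X} [IsProbabilityMeasure μ]
    (h : ∀ f : X →ᵇ ℝ, hφ.real f = ∫ x, f x ∂μ) (f : Cb 𝕜 X) : φ f = ∫ x, f x ∂μ := by
  have hi : ∀ g : X →ᵇ ℝ, Integrable g μ := fun g =>
    Integrable.of_bound (hm g).aestronglyMeasurable ‖g‖ (ae_of_all _ g.norm_coe_le_norm)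
  have h1 : ∀ g : X →ᵇ ℝ, φ (Cb.ofReal 𝕜 g) = ∫ x, (g x : 𝕜) ∂μ := fun g => by
    rw [integral_ofReal, ← h, hφ.ofReal_real]
  calc φ f = φ (Cb.ofReal 𝕜 f.re) + RCLike.I * φ (Cb.ofReal 𝕜 f.im) := by
        rw [← hφ.smul, ← hφ.add, ← Cb.eq_re_add_im]
    _ = ∫ x, ((f.re x : 𝕜) + RCLike.I * (f.im x : 𝕜)) ∂μ := by
        rw [integral_add (hi _).ofReal ((hi _).ofReal.const_mul _), integral_const_mul, h1, h1]
    _ = ∫ x, f x ∂μ := by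
        congr 1
        ext x
        rw [mul_comm]
        exact RCLike.re_add_im (f x)

/-- Integration against a Borel or Baire probability measure is a state. -/
lemma isState_integral {m : MeasurableSpace X} (hm : ∀ f : Cb 𝕜 X, Measurable f)
    (μ : Measure X) [IsProbabilityMeasure μ] : IsState fun f : Cb 𝕜 X => ∫ x, f x ∂μ where
  add f g := integral_add (f.integrable (hm f)) (g.integrable (hm g))
  smul c f := integral_const_mul _ _
  nonneg f hf := by
    have h : ∀ x, f x = ((RCLike.re (f x) : ℝ) : 𝕜) := fun x => by
      conv_lhs => rw [← RCLike.re_add_im (f x), (RCLike.nonneg_iff.1 (hf x)).2]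
      simp
    rw [integral_congr_ae (ae_of_all _ h), integral_ofReal]
    exact RCLike.ofReal_nonneg.2 (integral_nonneg fun x => (RCLike.nonneg_iff.1 (hf x)).1)
  one := by simp

/-- A continuous state is a Daniell functional: by Dini's theorem, pointwise decreasing convergence
to zero is uniform on compact sets. -/
lemma isDaniell_of_continuous {φ : NDual 𝕜 (Cb 𝕜 X)} (hφ : IsState (φ : Cb 𝕜 X → 𝕜)) :
    IsDaniell hφ.real where
  nonneg := hφ.real_nonneg
  one := hφ.real_one
  tendsto f h01 hanti hlim := by
    have h := φ.tendsto_of_tendstoUniformly (f := fun n => Cb.ofReal 𝕜 (f n)) (g := 0) (N := 1)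
      (fun n x => by
        rw [Cb.ofReal_apply, RCLike.norm_ofReal, abs_of_nonneg (h01 n x).1, Nat.cast_one]
        exact (h01 n x).2)
      (fun L _ _ _ p hp => by
        have h1 := Antitone.tendstoUniformly_of_forall_tendsto (F := fun n l => f n (p l))
          (f := fun _ => (0 : ℝ)) (fun n => (f n).continuous.comp hp) (fun n m hnm l => hanti (p l) hnm)
          continuous_const (fun l => hlim (p l))
        rw [Metric.tendstoUniformly_iff] at h1 ⊢
        simpa [dist_eq_norm] using h1)
    have h2 := (RCLike.continuous_re.tendsto _).comp h
    rw [map_zero, map_zero] at h2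
    exact h2

lemma exists_measure_of_mem {φ : NDual 𝕜 (Cb 𝕜 X)} (hφ : φ ∈ P 𝕜 X) :
    ∃ μ : @Measure X (baire 𝕜 X), IsProbabilityMeasure μ ∧ ∀ f : Cb 𝕜 X, φ f = ∫ x, f x ∂μ := by
  have key : ∀ m : MeasurableSpace X, m = baire ℝ X →
      ∃ μ : Measure X, IsProbabilityMeasure μ ∧ ∀ f : Cb 𝕜 X, φ f = ∫ x, f x ∂μ := by
    rintro _ rfl
    obtain ⟨μ, hμ, h⟩ := (isDaniell_of_continuous (isState_of_mem hφ)).exists_measure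
    exact ⟨μ, hμ, (isState_of_mem hφ).eq_integral (fun f => measurable_baire ℝ f.continuous) h⟩
  exact key _ (baire_eq 𝕜)

lemma ext_of_integral_Cb {μ ν : @Measure X (baire 𝕜 X)} (hμ : IsProbabilityMeasure μ)
    (hν : IsProbabilityMeasure ν) (h : ∀ f : Cb 𝕜 X, ∫ x, f x ∂μ = ∫ x, f x ∂ν) : μ = ν := by
  have key : ∀ m : MeasurableSpace X, m = baire ℝ X → ∀ μ ν : Measure X, IsProbabilityMeasure μ →
      IsProbabilityMeasure ν → (∀ f : Cb 𝕜 X, ∫ x, f x ∂μ = ∫ x, f x ∂ν) → μ = ν := by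
    rintro _ rfl μ ν hμ hν h
    refine ext_of_integral hμ hν fun f => ?_
    have h1 := h (Cb.ofReal 𝕜 f)
    simp only [Cb.ofReal_apply, integral_ofReal] at h1
    exact RCLike.ofReal_injective h1
  exact key _ (baire_eq 𝕜) μ ν hμ hν h

/-- Integration against a `k`-regular probability measure. -/
def KRegularProb.functional (m : KRegularProb 𝕜 X) : P 𝕜 X :=
  ⟨m.regular.choose, by
    have := m.isProbabilityMeasure
    have h := isState_integral (𝕜 := 𝕜) (fun f => measurable_baire 𝕜 f.continuous) m.measure
    obtain ⟨h1, h2⟩ := m.regular.choose_spec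
    refine ⟨h1, fun f hf => ?_, ?_⟩
    · rw [h2]; exact h.nonneg f hf
    · rw [h2]; exact h.one⟩

lemma KRegularProb.functional_apply (m : KRegularProb 𝕜 X) (f : Cb 𝕜 X) :
    m.functional.1 f = ∫ x, f x ∂m.measure := m.regular.choose_spec.2 f

lemma KRegularProb.ext {m n : KRegularProb 𝕜 X} (h : m.measure = n.measure) : m = n := by
  cases m; cases n; cases h; rfl

lemma KRegularProb.functional_bijective :
    Function.Bijective (KRegularProb.functional (𝕜 := 𝕜) (X := X)) := by
  constructor
  · intro m n h
    refine KRegularProb.ext (ext_of_integral_Cb m.isProbabilityMeasure n.isProbabilityMeasure ?_)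
    intro f
    rw [← m.functional_apply, ← n.functional_apply, h]
  · rintro ⟨φ, hφ⟩
    obtain ⟨μ, hμ, h⟩ := exists_measure_of_mem hφ
    refine ⟨⟨μ, hμ, φ, hφ.1, h⟩, Subtype.ext (NDual.ext fun f => ?_)⟩
    exact (KRegularProb.functional_apply _ f).trans (h f).symm

variable (𝕜) in
/-- The bijection between `k`-regular probability measures and functionals in `P(X)`. -/
def regularEquiv (X : HKTop.{u}) : KRegularProb 𝕜 X.carrier ≃ (prob 𝕜 X).carrier :=
  Equiv.ofBijective (β := P 𝕜 X.carrier) _ KRegularProb.functional_bijective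

lemma ev_regularEquiv (X : HKTop.{u}) (m : KRegularProb 𝕜 X.carrier) (f : Cb 𝕜 X.carrier) :
    ev (regularEquiv 𝕜 X m) f = ∫ x, f x ∂m.measure := m.functional_apply f

lemma ev_eq_integral {X : HKTop.{u}} (φ : (prob 𝕜 X).carrier) (f : Cb 𝕜 X.carrier) :
    ev φ f = ∫ x, f x ∂((regularEquiv 𝕜 X).symm φ).measure := by
  rw [← ev_regularEquiv, Equiv.apply_symm_apply]

/-- The measure of a functional in `P(X)` is characterised by its integrals. -/
lemma measure_eq_of_ev {X : HKTop.{u}} {φ : (prob 𝕜 X).carrier}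
    {μ : @Measure X.carrier (baire 𝕜 X.carrier)} (hμ : IsProbabilityMeasure μ)
    (h : ∀ f : Cb 𝕜 X.carrier, ev φ f = ∫ x, f x ∂μ) :
    ((regularEquiv 𝕜 X).symm φ).measure = μ :=
  ext_of_integral_Cb (KRegularProb.isProbabilityMeasure _) hμ fun f => by
    rw [← ev_eq_integral, h]

/-- States are contractions for the supremum norm. -/
lemma norm_le_of_mem {φ : NDual 𝕜 (Cb 𝕜 X)} (hφ : φ ∈ P 𝕜 X) {f : Cb 𝕜 X} {C : ℝ}
    (hf : ∀ x, ‖f x‖ ≤ C) : ‖φ f‖ ≤ C := by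
  obtain ⟨μ, hμ, h⟩ := exists_measure_of_mem hφ
  rw [h]
  simpa using norm_integral_le_of_norm_le_const (μ := μ) (ae_of_all _ hf)

end Representation

/-! ### Continuous families of functions and functionals -/

section Families

variable {𝕜 : Type} [RCLike 𝕜]

lemma NDual.continuous_of_compact {V : Type u} [AddCommGroup V] [Module 𝕜 V] [TopologicalSpace V]
    {Z : Type*} [TopologicalSpace Z] [IsGeneratedBy Test.{u} Z] {F : Z → NDual 𝕜 V}
    (h : ∀ (K : Type u) [TopologicalSpace K] [CompactSpace K] [T2Space K] (p : K → Z) (q : K → V),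
      Continuous p → Continuous q → Continuous (fun k => F (p k) (q k))) : Continuous F :=
  HK.continuous_of_compact fun K _ _ _ p hp => NDual.continuous_iff.2 fun L _ _ _ q hq =>
    h (K × L) (fun z => p z.1) (fun z => q z.2) (hp.comp continuous_fst) (hq.comp continuous_snd)

lemma Cb.continuous_of_compact {X : Type u} [TopologicalSpace X]
    {Z : Type*} [TopologicalSpace Z] [IsGeneratedBy Test.{u} Z] {F : Z → Cb 𝕜 X}
    (hb : ∀ (K : Type u) [TopologicalSpace K] [CompactSpace K] [T2Space K] (p : K → Z),
      Continuous p → ∃ n : ℕ, ∀ k x, ‖F (p k) x‖ ≤ n)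
    (h : ∀ (K : Type u) [TopologicalSpace K] [CompactSpace K] [T2Space K] (p : K → Z) (q : K → X),
      Continuous p → Continuous q → Continuous (fun k => F (p k) (q k))) : Continuous F :=
  HK.continuous_of_compact fun K _ _ _ p hp => Cb.continuous_iff.2 ⟨hb K p hp, fun L _ _ _ q hq =>
    h (K × L) (fun z => p z.1) (fun z => q z.2) (hp.comp continuous_fst) (hq.comp continuous_snd)⟩

section Submodule

variable {X : Type u} [TopologicalSpace X]

lemma NDual.continuous_add_const {V : Type u} [AddCommGroup V] [Module 𝕜 V] [TopologicalSpace V]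
    (ψ : NDual 𝕜 V) : Continuous (fun φ => φ + ψ) :=
  NDual.continuous_of_compact fun _ _ _ _ _ _ hp hq =>
    (NDual.continuous_apply hp hq).add ((map_continuous ψ).comp hq)

lemma NDual.continuous_const_smul {V : Type u} [AddCommGroup V] [Module 𝕜 V] [TopologicalSpace V]
    (c : 𝕜) : Continuous (fun φ : NDual 𝕜 V => c • φ) :=
  NDual.continuous_of_compact fun _ _ _ _ _ _ hp hq =>
    (NDual.continuous_apply hp hq).const_smul c

lemma delta_mem_M (x : X) : delta x ∈ M 𝕜 X := subset_closure (Submodule.subset_span ⟨x, rfl⟩)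

lemma smul_mem_M (c : 𝕜) {φ : NDual 𝕜 (Cb 𝕜 X)} (hφ : φ ∈ M 𝕜 X) : c • φ ∈ M 𝕜 X :=
  Set.MapsTo.closure (fun _ h => Submodule.smul_mem _ c h) (NDual.continuous_const_smul c) hφ

/-- Addition is only separately continuous, so that the two summands are treated in turn. -/
lemma add_mem_M {φ ψ : NDual 𝕜 (Cb 𝕜 X)} (hφ : φ ∈ M 𝕜 X) (hψ : ψ ∈ M 𝕜 X) : φ + ψ ∈ M 𝕜 X := by
  have h1 : ∀ χ ∈ Submodule.span 𝕜 (Set.range (delta (𝕜 := 𝕜) (X := X))), φ + χ ∈ M 𝕜 X :=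
    fun χ hχ => Set.MapsTo.closure (fun _ h => Submodule.add_mem _ h hχ)
      (NDual.continuous_add_const χ) hφ
  have h2 : ψ + φ ∈ closure (M 𝕜 X) :=
    Set.MapsTo.closure (fun χ h => by rw [add_comm]; exact h1 χ h)
      (NDual.continuous_add_const φ) hψ
  rwa [M, closure_closure, ← M, add_comm] at h2

lemma span_subset_M {φ : NDual 𝕜 (Cb 𝕜 X)} {s : Set (NDual 𝕜 (Cb 𝕜 X))} (hs : s ⊆ M 𝕜 X)
    (hφ : φ ∈ Submodule.span 𝕜 s) : φ ∈ M 𝕜 X := by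
  induction hφ using Submodule.span_induction with
  | mem φ h => exact hs h
  | zero => exact subset_closure (Submodule.zero_mem _)
  | add φ ψ _ _ h1 h2 => exact add_mem_M h1 h2
  | smul c φ _ h => exact smul_mem_M c h

variable {Y : Type u} [TopologicalSpace Y]

lemma transpose_mem_M {A : Cb 𝕜 Y →L[𝕜] Cb 𝕜 X}
    (hA : ∀ x, NDual.transpose A (delta x) ∈ M 𝕜 Y) {φ : NDual 𝕜 (Cb 𝕜 X)} (hφ : φ ∈ M 𝕜 X) :
    NDual.transpose A φ ∈ M 𝕜 Y := by
  have h : Set.MapsTo (NDual.transpose A)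
      (Submodule.span 𝕜 (Set.range (delta (𝕜 := 𝕜) (X := X))) : Set (NDual 𝕜 (Cb 𝕜 X)))
      (M 𝕜 Y) := by
    intro ψ hψ
    have h1 := Submodule.mem_map_of_mem (f := NDual.transpose A) hψ
    rw [Submodule.map_span] at h1
    refine span_subset_M ?_ h1
    rintro _ ⟨_, ⟨x, rfl⟩, rfl⟩
    exact hA x
  have h2 := h.closure (NDual.continuous_transpose A) hφ
  rwa [M, closure_closure] at h2

open scoped ComplexOrder in
/-- A positive unital operator whose transpose maps evaluations into `M(Y)` induces a map
`P(X) → P(Y)`. -/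
lemma transpose_mem_P' {A : Cb 𝕜 Y →L[𝕜] Cb 𝕜 X}
    (hA : ∀ x, NDual.transpose A (delta x) ∈ M 𝕜 Y)
    (hpos : ∀ f : Cb 𝕜 Y, (∀ y, 0 ≤ f y) → ∀ x, 0 ≤ A f x) (hone : A Cb.one = Cb.one)
    {φ : NDual 𝕜 (Cb 𝕜 X)} (hφ : φ ∈ P 𝕜 X) : NDual.transpose A φ ∈ P 𝕜 Y :=
  ⟨transpose_mem_M hA hφ.1, fun f hf => hφ.2.1 _ (hpos f hf), by
    rw [NDual.transpose_apply, hone]; exact hφ.2.2⟩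

instance : IsGeneratedBy Test.{u} (P 𝕜 X) := (isHKSpace_P 𝕜 X).kSpace

lemma delta_mem_P (x : X) : delta x ∈ P 𝕜 X := ⟨delta_mem_M x, fun _ h => h x, rfl⟩

/-! ### The multiplication -/

lemma P.continuous_apply {K : Type u} [TopologicalSpace K] [CompactSpace K] [T2Space K]
    {p : K → P 𝕜 X} {q : K → Cb 𝕜 X} (hp : Continuous p) (hq : Continuous q) :
    Continuous (fun k => (p k).1 (q k)) :=
  NDual.continuous_apply (continuous_subtype_val.comp hp) hq

variable (𝕜 X) in
/-- The operator `C_b(X) → C_b(P(X))` that maps `f` to `φ ↦ φ(f)`. -/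
def evOp : Cb 𝕜 X →L[𝕜] Cb 𝕜 (P 𝕜 X) where
  toFun f := Cb.ofFun (fun φ => φ.1 f) ((NDual.continuous_eval f).comp continuous_subtype_val)
    ⟨f.exists_bound.choose, fun φ => norm_le_of_mem φ.2 f.exists_bound.choose_spec⟩
  map_add' f g := by ext φ; exact map_add φ.1 f g
  map_smul' c f := by ext φ; exact map_smul φ.1 c f
  cont := Cb.continuous_of_compact
    (fun K _ _ _ p hp => by
      obtain ⟨n, hn⟩ := Cb.exists_bound_of_compact hp
      exact ⟨n, fun k φ => norm_le_of_mem φ.2 (hn k)⟩)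
    (fun K _ _ _ p q hp hq => P.continuous_apply hq hp)

/-- The barycenter of an element of `P(P(X))`. -/
def join (Φ : P 𝕜 (P 𝕜 X)) : P 𝕜 X :=
  ⟨NDual.transpose (evOp 𝕜 X) Φ.1, transpose_mem_P' (fun φ => φ.2.1)
    (fun _ hf φ => φ.2.2.1 _ hf) (Cb.ext fun φ => φ.2.2.2) Φ.2⟩

lemma continuous_join : Continuous (join : P 𝕜 (P 𝕜 X) → P 𝕜 X) :=
  ((NDual.continuous_transpose _).comp continuous_subtype_val).subtype_mk _

end Submodule

/-! ### Tensor products of functionals -/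

section Tensor

variable {X Y : Type u} [TopologicalSpace X] [TopologicalSpace Y]

lemma NDual.norm_apply_le {φ : NDual 𝕜 (Cb 𝕜 X)} {C : ℝ}
    (h : ∀ f : Cb 𝕜 X, (∀ x, ‖f x‖ ≤ 1) → ‖φ f‖ ≤ C) {f : Cb 𝕜 X} {n : ℕ}
    (hf : ∀ x, ‖f x‖ ≤ n) : ‖φ f‖ ≤ (n + 1) * C := by
  have hn : ‖((n + 1 : ℝ) : 𝕜)‖ = n + 1 := by
    rw [RCLike.norm_ofReal, abs_of_pos (by positivity)]
  have h1 := h (((n + 1 : ℝ) : 𝕜)⁻¹ • f) fun x => by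
    rw [Cb.smul_apply, norm_mul, norm_inv, hn, inv_mul_le_one₀ (by positivity)]
    linarith [hf x]
  rwa [map_smul, norm_smul, norm_inv, hn, inv_mul_le_iff₀ (by positivity)] at h1

variable [IsGeneratedBy Test.{u} X] [IsGeneratedBy Test.{u} Y]

variable (X) in
/-- The inclusion `x ↦ (x, y)` of a slice of the product. -/
def slice (y : Y) : C(X, Kify.{u} (X × Y)) :=
  ⟨fun x => mk (x, y), continuous_mk_iff.2 (continuous_id.prodMk continuous_const)⟩

/-- The section `x ↦ f(x, y)` of a function on the product. -/
def Cb.section (f : Cb 𝕜 (Kify.{u} (X × Y))) (y : Y) : Cb 𝕜 X := Cb.pullback (slice X y) f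

section

variable {K : Type u} [TopologicalSpace K] [CompactSpace K] [T2Space K]

omit [IsGeneratedBy Test.{u} X] [IsGeneratedBy Test.{u} Y] in
lemma continuous_kify_pair {p : K → X} {q : K → Y} (hp : Continuous p) (hq : Continuous q) :
    Continuous (fun k => (mk (p k, q k) : Kify.{u} (X × Y))) :=
  have := isGeneratedBy_of_compact (K := K)
  continuous_mk_iff.2 (hp.prodMk hq)

omit [IsGeneratedBy Test.{u} Y] in
lemma Cb.continuous_section {f : K → Cb 𝕜 (Kify.{u} (X × Y))} (hf : Continuous f) {q : K → Y}
    (hq : Continuous q) : Continuous (fun k => (f k).section (q k)) := by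
  refine Cb.continuous_iff.2 ⟨?_, fun L _ _ _ p hp => ?_⟩
  · obtain ⟨n, hn⟩ := Cb.exists_bound_of_compact hf
    exact ⟨n, fun k x => hn k _⟩
  · exact Cb.continuous_apply (hf.comp continuous_fst)
      (continuous_kify_pair (hp.comp continuous_snd) (hq.comp continuous_fst))

end

/-- The function `y ↦ φ(f(·, y))`. -/
def partialApply (φ : NDual 𝕜 (Cb 𝕜 X)) (f : Cb 𝕜 (Kify.{u} (X × Y))) : Cb 𝕜 Y :=
  Cb.ofFun (fun y => φ (f.section y))
    (continuous_of_compact fun K _ _ _ p hp =>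
      (map_continuous φ).comp (Cb.continuous_section continuous_const hp))
    (by
      obtain ⟨C, hC⟩ := NDual.exists_bound (K := PUnit) (continuous_const (y := φ))
      obtain ⟨n, hn⟩ := f.exists_bound
      refine ⟨⌈(n + 1) * C⌉₊, fun y => le_trans ?_ (Nat.le_ceil _)⟩
      exact NDual.norm_apply_le (hC PUnit.unit) fun x => hn _)

lemma continuous_partialApply {K : Type u} [TopologicalSpace K] [CompactSpace K] [T2Space K]
    {φ : K → NDual 𝕜 (Cb 𝕜 X)} {f : K → Cb 𝕜 (Kify.{u} (X × Y))} (hφ : Continuous φ)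
    (hf : Continuous f) : Continuous (fun k => partialApply (φ k) (f k)) := by
  refine Cb.continuous_iff.2 ⟨?_, fun L _ _ _ p hp => ?_⟩
  · obtain ⟨C, hC⟩ := NDual.exists_bound hφ
    obtain ⟨n, hn⟩ := Cb.exists_bound_of_compact hf
    refine ⟨⌈(n + 1) * C⌉₊, fun k y => le_trans ?_ (Nat.le_ceil _)⟩
    exact NDual.norm_apply_le (hC k) fun x => hn k _
  · exact NDual.continuous_apply (hφ.comp continuous_fst)
      (Cb.continuous_section (hf.comp continuous_fst) (hp.comp continuous_snd))

/-- Partial application of a functional, as a continuous linear operator. -/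
def partialOp (φ : NDual 𝕜 (Cb 𝕜 X)) : Cb 𝕜 (Kify.{u} (X × Y)) →L[𝕜] Cb 𝕜 Y where
  toFun := partialApply φ
  map_add' f g := by ext y; exact map_add φ (f.section y) (g.section y)
  map_smul' c f := by ext y; exact map_smul φ c (f.section y)
  cont := continuous_of_compact fun K _ _ _ p hp => continuous_partialApply continuous_const hp

/-- The tensor product `f ↦ ψ(y ↦ φ(f(·, y)))` of functionals. -/
def tensor (φ : NDual 𝕜 (Cb 𝕜 X)) (ψ : NDual 𝕜 (Cb 𝕜 Y)) :
    NDual 𝕜 (Cb 𝕜 (Kify.{u} (X × Y))) :=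
  NDual.transpose (partialOp φ) ψ

lemma tensor_mem_P {φ : NDual 𝕜 (Cb 𝕜 X)} (hφ : φ ∈ P 𝕜 X) {ψ : NDual 𝕜 (Cb 𝕜 Y)}
    (hψ : ψ ∈ P 𝕜 Y) : tensor φ ψ ∈ P 𝕜 (Kify.{u} (X × Y)) :=
  transpose_mem_P' (A := partialOp φ)
    -- the tensor product of `φ` with an evaluation is the image of `φ` under a slice
    (fun y => (transpose_mem_P (slice X y) hφ).1)
    (fun _ hf _ => hφ.2.1 _ fun _ => hf _) (Cb.ext fun _ => hφ.2.2) hψ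

/-- The tensor product of elements of `P(X)` and `P(Y)`. -/
def tensorP (p : Kify.{u} (P 𝕜 X × P 𝕜 Y)) : P 𝕜 (Kify.{u} (X × Y)) :=
  ⟨tensor (unk p).1.1 (unk p).2.1, tensor_mem_P (unk p).1.2 (unk p).2.2⟩

lemma continuous_tensorP : Continuous (tensorP (𝕜 := 𝕜) (X := X) (Y := Y)) := by
  refine Continuous.subtype_mk (NDual.continuous_of_compact fun K _ _ _ p q hp hq => ?_) _
  have hp' := WithGeneratedByTopology.continuous_equiv.comp hp
  exact NDual.continuous_apply (continuous_subtype_val.comp (continuous_snd.comp hp'))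
    (continuous_partialApply (continuous_subtype_val.comp (continuous_fst.comp hp')) hq)

variable (X Y) in
/-- The symmetry of the product of `k`-spaces. -/
def kswap : C(Kify.{u} (Y × X), Kify.{u} (X × Y)) :=
  ⟨fun p => mk ((unk p).2, (unk p).1), continuous_kify_map continuous_swap⟩

/-- Fubini's theorem: the two iterated applications agree for evaluations, hence on their closed
linear span. -/
theorem tensor_swap {φ : NDual 𝕜 (Cb 𝕜 X)} (hφ : φ ∈ M 𝕜 X) (ψ : NDual 𝕜 (Cb 𝕜 Y))
    (f : Cb 𝕜 (Kify.{u} (X × Y))) :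
    ψ (partialApply φ f) = φ (partialApply ψ (Cb.pullback (kswap X Y) f)) := by
  have hclosed : IsClosed {φ : NDual 𝕜 (Cb 𝕜 X) |
      ψ (partialApply φ f) = φ (partialApply ψ (Cb.pullback (kswap X Y) f))} := by
    refine isClosed_eq ?_ (NDual.continuous_eval _)
    exact continuous_of_compact fun K _ _ _ p hp =>
      (map_continuous ψ).comp (continuous_partialApply hp continuous_const)
  refine closure_minimal (fun χ hχ => ?_) hclosed hφ
  induction hχ using Submodule.span_induction with
  | mem χ h =>
    obtain ⟨x, rfl⟩ := h
    exact congrArg ψ (Cb.ext fun y => rfl)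
  | zero =>
    have : partialApply (0 : NDual 𝕜 (Cb 𝕜 X)) f = 0 := Cb.ext fun y => rfl
    change ψ (partialApply (0 : NDual 𝕜 (Cb 𝕜 X)) f) = 0
    rw [this, map_zero]
  | add χ χ' _ _ h1 h2 =>
    have : partialApply (χ + χ') f = partialApply χ f + partialApply χ' f := Cb.ext fun y => rfl
    change ψ (partialApply (χ + χ') f) = _
    rw [this, map_add, NDual.add_apply]
    exact congrArg₂ _ h1 h2
  | smul c χ _ h =>
    have : partialApply (c • χ) f = c • partialApply χ f := Cb.ext fun y => rfl
    change ψ (partialApply (c • χ) f) = _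
    rw [this, map_smul, NDual.smul_apply]
    exact congrArg _ h

end Tensor

end Families

/-! ### The commutative monad -/

section CommMonad

instance (X : HKTop.{u}) : IsGeneratedBy Test.{u} X.carrier := X.property.kSpace

lemma HKTop.hom_ext {X Y : HKTop.{u}} {f g : X ⟶ Y} (h : ∀ x, HKTop.toMap f x = HKTop.toMap g x) :
    f = g :=
  ObjectProperty.hom_ext _ (ConcreteCategory.hom_ext _ _ h)

variable (𝕜 : Type) [RCLike 𝕜]

variable {𝕜} in
lemma prob_ext {X : HKTop.{u}} {φ ψ : (prob 𝕜 X).carrier} (h : ∀ f, ev φ f = ev ψ f) : φ = ψ :=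
  Subtype.ext (NDual.ext h)

variable {𝕜} in
lemma prob_hom_ext {X Y : HKTop.{u}} {f g : Y ⟶ prob 𝕜 X}
    (h : ∀ y k, ev (HKTop.toMap f y) k = ev (HKTop.toMap g y) k) : f = g :=
  HKTop.hom_ext fun y => prob_ext (h y)

/-- The unit of the monad of probability measures. -/
def unitHom (X : HKTop.{u}) : X ⟶ prob 𝕜 X :=
  HKTop.ofHom (Y := prob 𝕜 X) ⟨fun x => (⟨delta x, delta_mem_P x⟩ : P 𝕜 X.carrier),
    (continuous_delta X.property.kSpace).subtype_mk _⟩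

/-- The multiplication of the monad of probability measures. -/
def multHom (X : HKTop.{u}) : prob 𝕜 (prob 𝕜 X) ⟶ prob 𝕜 X :=
  HKTop.ofHom (X := prob 𝕜 (prob 𝕜 X)) (Y := prob 𝕜 X)
    ⟨(join : P 𝕜 (P 𝕜 X.carrier) → P 𝕜 X.carrier), continuous_join⟩

/-- The tensor product of probability measures. -/
def tensorHom (X Y : HKTop.{u}) : prob 𝕜 X ⊗ prob 𝕜 Y ⟶ prob 𝕜 (X ⊗ Y) :=
  HKTop.ofHom (X := prob 𝕜 X ⊗ prob 𝕜 Y) (Y := prob 𝕜 (X ⊗ Y))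
    ⟨(tensorP : Kify.{u} (P 𝕜 X.carrier × P 𝕜 Y.carrier) → P 𝕜 (Kify.{u} (X.carrier × Y.carrier))),
      continuous_tensorP⟩

/-- The unit as a natural transformation. -/
def unitNat : 𝟭 HKTop.{u} ⟶ probFunctor 𝕜 where
  app X := unitHom 𝕜 X
  naturality _ _ _ := rfl

/-- The multiplication as a natural transformation. -/
def multNat : probFunctor.{u} 𝕜 ⋙ probFunctor 𝕜 ⟶ probFunctor 𝕜 where
  app X := multHom 𝕜 X
  naturality _ _ _ := rfl

/-- The tensor product of probability measures makes `P` a lax monoidal functor. -/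
@[reducible] def laxMonoidal : (probFunctor.{u} 𝕜).LaxMonoidal where
  ε := unitHom 𝕜 (𝟙_ HKTop.{u})
  μ X Y := tensorHom 𝕜 X Y
  μ_natural_left _ _ := rfl
  μ_natural_right _ _ := rfl
  associativity _ _ _ := rfl
  left_unitality _ := rfl
  right_unitality _ := rfl

/-- By Fubini's theorem, `P` is a lax symmetric monoidal functor. -/
@[reducible] def laxBraided : (probFunctor.{u} 𝕜).LaxBraided where
  toLaxMonoidal := laxMonoidal 𝕜
  braided X Y := by
    refine prob_hom_ext fun p k => ?_
    exact tensor_swap (show P 𝕜 X.carrier from (unk.{u} p).1).2.1 _ (Cb.pullback _ k)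

variable {𝕜} in
/-- The function `(μ, y) ↦ μ(f(·, y))` on `P(X) × Y`. -/
def evSection {X Y : Type u} [TopologicalSpace X] [TopologicalSpace Y] [IsGeneratedBy Test.{u} X]
    [IsGeneratedBy Test.{u} Y] (f : Cb 𝕜 (Kify.{u} (X × Y))) : Cb 𝕜 (Kify.{u} (P 𝕜 X × Y)) :=
  Cb.ofFun (fun p => (unk p).1.1 (f.section (unk p).2))
    (continuous_of_compact fun K _ _ _ p hp => by
      have hp' := WithGeneratedByTopology.continuous_equiv.comp hp
      exact P.continuous_apply (continuous_fst.comp hp')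
        (Cb.continuous_section continuous_const (continuous_snd.comp hp')))
    ⟨f.exists_bound.choose, fun p =>
      norm_le_of_mem (unk p).1.2 fun _ => f.exists_bound.choose_spec _⟩

variable {𝕜} in
lemma join_join_apply {X : Type u} [TopologicalSpace X] (Φ : P 𝕜 (P 𝕜 (P 𝕜 X))) (f : Cb 𝕜 X) :
    Φ.1 (Cb.pullback ⟨join, continuous_join⟩ (evOp 𝕜 X f)) = Φ.1 (evOp 𝕜 _ (evOp 𝕜 X f)) :=
  rfl

variable {𝕜} in
/-- The multiplication is compatible with tensor products: this is Fubini's theorem for the function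
`(μ, y) ↦ μ(f(·, y))`. -/
lemma tensor_join_apply {X Y : Type u} [TopologicalSpace X] [TopologicalSpace Y]
    [IsGeneratedBy Test.{u} X] [IsGeneratedBy Test.{u} Y] (Φ : P 𝕜 (P 𝕜 X)) (Ψ : P 𝕜 (P 𝕜 Y))
    (f : Cb 𝕜 (Kify.{u} (X × Y))) :
    tensor Φ.1 Ψ.1 (Cb.pullback ⟨tensorP, continuous_tensorP⟩ (evOp 𝕜 (Kify.{u} (X × Y)) f)) =
      tensor (join Φ).1 (join Ψ).1 f :=
  congrArg Ψ.1 (Cb.ext fun ν => (tensor_swap Φ.2.1 ν.1 (evSection f)).symm)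

/-- The commutative monad of `k`-regular probability measures. -/
def probMonad : CommutativeMonad (probFunctor.{u} 𝕜) where
  unit := unitNat 𝕜
  mult := multNat 𝕜
  assoc X := prob_hom_ext fun Φ k =>
    join_join_apply (show P 𝕜 (P 𝕜 (P 𝕜 X.carrier)) from Φ) k
  left_unit _ := rfl
  right_unit _ := rfl
  lax := laxBraided 𝕜
  unit_monoidal := by
    let _ := laxBraided.{u} 𝕜
    exact { unit := rfl, tensor := fun _ _ => rfl }
  mult_monoidal := by
    let _ := laxBraided.{u} 𝕜
    refine { unit := rfl, tensor := fun X Y => prob_hom_ext fun p k => ?_ }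
    exact tensor_join_apply (show P 𝕜 (P 𝕜 X.carrier) from (unk.{u} p).1)
      (show P 𝕜 (P 𝕜 Y.carrier) from (unk.{u} p).2) k

end CommMonad

/-! ### Quotients of second countable spaces -/

section QCB

open TopologicalSpace

/-- A topological quotient of a second countable space. -/
def IsQCBSpace (X : Type u) [TopologicalSpace X] : Prop :=
  ∃ (A : TopCat.{u}) (q : A → X), SecondCountableTopology A ∧ IsQuotientMap q

variable {X : Type u} [TopologicalSpace X]

lemma IsHKSpace.isClosed_range (hX : IsHKSpace X) {K : Type u} [TopologicalSpace K]
    [CompactSpace K] [T2Space K] {p : K → X} (hp : Continuous p) : IsClosed (Set.range p) := by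
  have := hX.kSpace
  refine isClosed_of_compact fun L _ _ _ r hr => ?_
  have h1 : Continuous fun z : K × L => (HK.mk (p z.1, r z.2) : Kify.{u} (X × X)) :=
    continuous_kify_pair (hp.comp continuous_fst) (hr.comp continuous_snd)
  convert isClosedMap_snd_of_compactSpace _ (hX.kHausdorff.preimage h1) using 1
  ext l
  constructor
  · rintro ⟨k, hk⟩
    exact ⟨(k, l), hk, rfl⟩
  · rintro ⟨⟨k, _⟩, hk, rfl⟩
    exact ⟨k, hk⟩

lemma IsHKSpace.isClosed_singleton (hX : IsHKSpace X) (x : X) : IsClosed ({x} : Set X) := by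
  have := hX.isClosed_range (K := PUnit) (p := fun _ => x) continuous_const
  rwa [Set.range_const] at this

/-- A QCB space which is an `hk`-space has a countable family of subsets that separates compact sets
from the complements of their open neighbourhoods: the images of finite unions of basic open
sets. -/
lemma IsQCBSpace.exists_network (hX : IsHKSpace X) (hQ : IsQCBSpace X) :
    ∃ 𝒩 : Set (Set X), 𝒩.Countable ∧
      ∀ (K : Type u) [TopologicalSpace K] [CompactSpace K] [T2Space K] (p : K → X),
        Continuous p → ∀ U : Set X, IsOpen U → Set.range p ⊆ U →
          ∃ N ∈ 𝒩, Set.range p ⊆ N ∧ N ⊆ U := by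
  obtain ⟨A, q, hA, hq⟩ := hQ
  let B : Set (Set A) := insert ∅ (countableBasis A)
  have hB : B.Countable := (countable_countableBasis A).insert _
  have hBo : ∀ b ∈ B, IsOpen b := by
    rintro b (rfl | hb)
    · exact isOpen_empty
    · exact isOpen_of_mem_countableBasis hb
  refine ⟨(fun F : Set (Set A) => q '' ⋃₀ F) '' {F | F.Finite ∧ F ⊆ B},
    (Set.countable_ofPred_finite_subset hB).image _, fun K _ _ _ p hp U hU hpU => ?_⟩
  obtain ⟨b, hb⟩ := Set.Countable.exists_eq_range (s := {b ∈ B | b ⊆ q ⁻¹' U})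
    (hB.mono fun _ h => h.1) ⟨∅, Or.inl rfl, Set.empty_subset _⟩
  have hbB : ∀ i, b i ∈ B ∧ b i ⊆ q ⁻¹' U := fun i => hb.ge ⟨i, rfl⟩
  have hbcover : ∀ a ∈ q ⁻¹' U, ∃ i, a ∈ b i := fun a ha => by
    obtain ⟨v, hv, hav, hvU⟩ := (isBasis_countableBasis A).exists_subset_of_mem_open ha
      (hU.preimage hq.continuous)
    obtain ⟨i, rfl⟩ := hb.le ⟨Or.inr hv, hvU⟩
    exact ⟨i, hav⟩
  by_contra! hcon
  have hx : ∀ n, ∃ x ∈ Set.range p, ∀ i ≤ n, x ∉ q '' b i := by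
    intro n
    by_contra! hn
    refine hcon _ ⟨b '' Set.Iic n, ⟨(Set.finite_Iic n).image _, ?_⟩, rfl⟩ ?_ ?_
    · rintro _ ⟨i, -, rfl⟩
      exact (hbB i).1
    · intro x hx
      obtain ⟨i, hi, a, ha, rfl⟩ := hn x hx
      exact ⟨a, ⟨b i, ⟨i, hi, rfl⟩, ha⟩, rfl⟩
    · rintro _ ⟨a, ⟨_, ⟨i, -, rfl⟩, ha⟩, rfl⟩
      exact (hbB i).2 ha
  choose x hxp hxb using hx
  -- each basic open set meets only finitely many of the fibres over the points `x n`
  have hclosed : ∀ S ⊆ Set.range x, IsClosed S := by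
    intro S hS
    rw [← hq.isClosed_preimage, ← isOpen_compl_iff, isOpen_iff_mem_nhds]
    intro a ha
    by_cases haU : q a ∈ U
    · obtain ⟨j, hj⟩ := hbcover a haU
      have hfin : (S ∩ x '' Set.Iio j).Finite := ((Set.finite_Iio j).image x).inter_of_right _
      have hfc : IsClosed (S ∩ x '' Set.Iio j) := by
        rw [← Set.biUnion_of_singleton (S ∩ x '' Set.Iio j)]
        exact hfin.isClosed_biUnion fun y _ => hX.isClosed_singleton y
      filter_upwards [(hBo _ (hbB j).1).mem_nhds hj,
        (hfc.preimage hq.continuous).isOpen_compl.mem_nhds fun h => ha h.1] with c hc1 hc2 hcS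
      obtain ⟨n, hn⟩ := hS hcS
      refine hc2 ⟨hcS, n, ?_, hn⟩
      by_contra hnj
      exact hxb n j (not_lt.1 hnj) ⟨c, hc1, hn.symm⟩
    · filter_upwards [((hX.isClosed_range hp).preimage hq.continuous).isOpen_compl.mem_nhds
        fun h => haU (hpU h)] with c hc hcS
      obtain ⟨n, hn⟩ := hS hcS
      exact hc (show q c ∈ Set.range p from hn ▸ hxp n)
  have hfin := finite_of_forall_subset_isClosed (isCompact_range hp)
    (by rintro _ ⟨n, rfl⟩; exact hxp n) hclosed
  have hj : ∀ s ∈ Set.range x, ∃ j, s ∈ q '' b j := by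
    rintro _ ⟨n, rfl⟩
    obtain ⟨a, ha⟩ := hq.surjective (x n)
    obtain ⟨j, hj⟩ := hbcover a (show q a ∈ U from ha ▸ hpU (hxp n))
    exact ⟨j, a, hj, ha⟩
  choose! j hj using hj
  obtain ⟨J, hJ⟩ := (hfin.image j).bddAbove
  exact hxb J _ (hJ ⟨x J, ⟨J, rfl⟩, rfl⟩) (hj _ ⟨J, rfl⟩)

lemma exists_open_network (Y : Type*) [TopologicalSpace Y] [SecondCountableTopology Y] :
    ∃ 𝒱 : Set (Set Y), 𝒱.Countable ∧ (∀ V ∈ 𝒱, IsOpen V) ∧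
      ∀ C U : Set Y, IsCompact C → IsOpen U → C ⊆ U → ∃ V ∈ 𝒱, C ⊆ V ∧ V ⊆ U := by
  refine ⟨(fun F : Set (Set Y) => ⋃₀ F) '' {F | F.Finite ∧ F ⊆ countableBasis Y},
    (Set.countable_ofPred_finite_subset (countable_countableBasis Y)).image _, ?_, ?_⟩
  · rintro _ ⟨F, hF, rfl⟩
    exact isOpen_sUnion fun b hb => isOpen_of_mem_countableBasis (hF.2 hb)
  · intro C U hC hU hCU
    refine hC.induction_on (p := fun C => ∃ V ∈ _, C ⊆ V ∧ V ⊆ U) ?_ ?_ ?_ ?_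
    · exact ⟨_, ⟨∅, ⟨Set.finite_empty, Set.empty_subset _⟩, rfl⟩, Set.empty_subset _, by simp⟩
    · rintro s t hst ⟨V, hV, h1, h2⟩
      exact ⟨V, hV, hst.trans h1, h2⟩
    · rintro s t ⟨_, ⟨F, hF, rfl⟩, h1, h2⟩ ⟨_, ⟨G, hG, rfl⟩, h3, h4⟩
      refine ⟨_, ⟨F ∪ G, ⟨hF.1.union hG.1, Set.union_subset hF.2 hG.2⟩, rfl⟩, ?_⟩
      simp only [Set.sUnion_union]
      exact ⟨Set.union_subset_union h1 h3, Set.union_subset h2 h4⟩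
    · intro x hx
      obtain ⟨v, hv, hxv, hvU⟩ := (isBasis_countableBasis Y).exists_subset_of_mem_open (hCU hx) hU
      refine ⟨v, mem_nhdsWithin_of_mem_nhds ((isOpen_of_mem_countableBasis hv).mem_nhds hxv), v,
        ⟨{v}, ⟨Set.finite_singleton v, Set.singleton_subset_iff.2 hv⟩, by simp⟩, subset_rfl, hvU⟩

/-- A convergent sequence with its limit, as a map from a compact Hausdorff space. -/
lemma continuous_sequence {Z : Type*} [TopologicalSpace Z] {z : ℕ → Z} {w : Z}
    (h : Tendsto z atTop (𝓝 w)) :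
    Continuous (fun n : ULift.{u} (OnePoint ℕ) => n.down.elim w z) := by
  have : Continuous (fun n : OnePoint ℕ => n.elim w z) :=
    (OnePoint.continuous_iff_from_nat _).2 h
  exact this.comp continuous_uliftDown

/-- Sequential spaces are `k`-spaces. -/
lemma isGeneratedBy_of_sequentialSpace (Z : Type*) [TopologicalSpace Z] [SequentialSpace Z] :
    IsGeneratedBy Test.{u} Z where
  continuous_equiv_symm := by
    refine SeqContinuous.continuous fun z w h => ?_
    have h1 := continuous_sequence.{u} h
    have := isGeneratedBy_of_compact (K := ULift.{u} (OnePoint ℕ))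
    have h2 := (continuous_mk_iff.2 h1).comp (continuous_uliftUp (X := OnePoint ℕ))
    exact (OnePoint.continuous_iff_from_nat _).1 h2

section Exp

variable {Y : Type} [TopologicalSpace Y]

lemma Exp.ext {f g : Exp X Y} (h : ∀ x, f.toMap x = g.toMap x) : f = g := by
  have h2 : ∀ a b : CO X Y, a.toMap = b.toMap → a = b := by
    rintro ⟨a⟩ ⟨b⟩ rfl; rfl
  exact unk.injective (h2 _ _ (ContinuousMap.ext h))

/-- If `X` is separable, evaluation at a countable dense set maps compact subsets of `Y ^ X`
homeomorphically to a first countable space, so that `Y ^ X` is sequential. -/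
lemma Exp.sequentialSpace [SeparableSpace X] [T2Space Y] [FirstCountableTopology Y] :
    SequentialSpace (Exp X Y) := by
  refine ⟨fun F hF => isClosed_of_compact fun K _ _ _ p hp => ?_⟩
  obtain ⟨s, hs, hd⟩ := exists_countable_dense X
  have := hs.to_subtype
  let ev : Exp X Y → s → Y := fun f x => f.toMap x
  have hev : Continuous ev := continuous_pi fun x => Exp.continuous_eval _
  have hinj : Function.Injective ev := fun f g h => Exp.ext fun x => by
    have : (f.toMap : X → Y) = g.toMap := f.toMap.continuous.ext_on hd g.toMap.continuous
      fun x hx => congrFun h ⟨x, hx⟩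
    exact congrFun this x
  have hι : Continuous (ev ∘ p) := hev.comp hp
  have hclosed : IsClosed (ev '' (F ∩ Set.range p)) := by
    refine IsSeqClosed.isClosed fun y z hy hz => ?_
    choose f hf hfy using hy
    choose k hk using fun n => (hf n).2
    have hz1 : z ∈ Set.range (ev ∘ p) := (isCompact_range hι).isClosed.mem_of_tendsto hz
      (Eventually.of_forall fun n => ⟨k n, by rw [Function.comp_apply, hk, hfy]⟩)
    obtain ⟨l, rfl⟩ := hz1
    refine ⟨p l, ⟨hF (x := f) (fun n => (hf n).1) ?_, l, rfl⟩, rfl⟩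
    intro O hO
    obtain ⟨O', hO'O, hO', hl⟩ := mem_nhds_iff.1 hO
    have h1 : IsClosed ((ev ∘ p) '' (p ⁻¹' O'ᶜ)) :=
      ((hO'.isClosed_compl.preimage hp).isCompact.image hι).isClosed
    have h2 : (ev ∘ p) l ∉ (ev ∘ p) '' (p ⁻¹' O'ᶜ) := by
      rintro ⟨m, hm, hml⟩
      exact hm (hinj hml ▸ hl)
    refine (hz.eventually (h1.isOpen_compl.mem_nhds h2)).mono fun n hn => hO'O ?_
    by_contra hno
    exact hn ⟨k n, by rwa [Set.mem_preimage, hk], by rw [Function.comp_apply, hk, hfy]⟩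
  convert hclosed.preimage hι using 1
  ext k
  constructor
  · intro hk
    exact ⟨p k, ⟨hk, k, rfl⟩, rfl⟩
  · rintro ⟨f, ⟨hf, -⟩, hfk⟩
    have : f = p k := hinj hfk
    exact Set.mem_preimage.2 (this ▸ hf)

lemma Exp.isOpen_forall_mem [IsGeneratedBy Test.{u} X] {F : ℕ → Exp X Y} {f : Exp X Y}
    (hF : Tendsto F atTop (𝓝 f)) {V : Set Y} (hV : IsOpen V) :
    IsOpen {x | f.toMap x ∈ V ∧ ∀ n, (F n).toMap x ∈ V} := by
  refine isOpen_of_compact fun L _ _ _ p hp => ?_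
  have h1 := Exp.continuous_iff'.1 (continuous_sequence.{u} hF) L p hp
  have h2 := isClosedMap_snd_of_compactSpace _ (hV.isClosed_compl.preimage h1)
  rw [← isClosed_compl_iff]
  convert h2 using 1
  ext l
  constructor
  · intro hl
    by_contra hcon
    exact hl ⟨by_contra fun h => hcon ⟨(⟨OnePoint.infty⟩, l), h, rfl⟩,
      fun n => by_contra fun h => hcon ⟨(⟨(n : OnePoint ℕ)⟩, l), h, rfl⟩⟩
  · rintro ⟨⟨⟨z⟩, _⟩, hz, rfl⟩ ⟨h3, h4⟩
    induction z using OnePoint.rec with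
    | coe n => exact hz (h4 n)
    | infty => exact hz h3

/-- The pairs of a continuous map `f` and a set of pairs `(N, V)` with `f(N) ⊆ V` that contains,
for all compact `C` and open `U` with `f(C) ⊆ U`, a pair such that `C ⊆ N` and `V ⊆ U`. -/
def Presentation (Y : Type) [TopologicalSpace Y] (𝒩 : Set (Set X)) (𝒱 : Set (Set Y)) : Type u :=
  {a : C(X, Y) × (𝒩 × 𝒱 → Prop) //
    (∀ i, a.2 i → Set.MapsTo a.1 i.1 i.2) ∧
    ∀ (K : Type u) [TopologicalSpace K] [CompactSpace K] [T2Space K] (p : K → X), Continuous p →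
      ∀ U : Set Y, IsOpen U → (∀ k, a.1 (p k) ∈ U) →
        ∃ i, a.2 i ∧ Set.range p ⊆ i.1 ∧ (i.2 : Set Y) ⊆ U}

/-- A point of the space of presentations is close to `(f, s)` if its set of pairs contains a given
finite subset of `s`. -/
instance (𝒩 : Set (Set X)) (𝒱 : Set (Set Y)) : TopologicalSpace (Presentation Y 𝒩 𝒱) :=
  TopologicalSpace.induced (fun a => a.1.2) inferInstance

lemma Presentation.secondCountableTopology {𝒩 : Set (Set X)} {𝒱 : Set (Set Y)}
    (h𝒩 : 𝒩.Countable) (h𝒱 : 𝒱.Countable) :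
    SecondCountableTopology (Presentation Y 𝒩 𝒱) := by
  have := h𝒩.to_subtype
  have := h𝒱.to_subtype
  exact secondCountableTopology_induced _ _ _

/-- The continuous map presented by a presentation. -/
def Presentation.toExp {𝒩 : Set (Set X)} {𝒱 : Set (Set Y)} (a : Presentation Y 𝒩 𝒱) : Exp X Y :=
  Exp.ofMap a.1.1

lemma Presentation.continuous_toExp {𝒩 : Set (Set X)} {𝒱 : Set (Set Y)}
    (h𝒩 : 𝒩.Countable) (h𝒱 : 𝒱.Countable) :
    Continuous (Presentation.toExp (Y := Y) (𝒩 := 𝒩) (𝒱 := 𝒱)) := by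
  have := Presentation.secondCountableTopology (Y := Y) h𝒩 h𝒱
  have := isGeneratedBy_of_sequentialSpace.{u} (Presentation Y 𝒩 𝒱)
  refine continuous_mk_iff.2 (continuous_iInf_rng.2 fun L => continuous_iInf_rng.2 fun p =>
    continuous_induced_rng.2 (ContinuousMap.continuous_compactOpen.2 fun K hK U hU => ?_))
  refine isOpen_iff_mem_nhds.2 fun a ha => ?_
  have := isCompact_iff_compactSpace.1 hK
  obtain ⟨i, hi, hi1, hi2⟩ := a.2.2 K (fun k => p k)
    (p.continuous.comp continuous_subtype_val) U hU (fun k => ha k.2)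
  have hopen : IsOpen {b : Presentation Y 𝒩 𝒱 | b.1.2 i} :=
    continuous_Prop.1 ((continuous_apply i).comp continuous_induced_dom)
  filter_upwards [hopen.mem_nhds hi] with b hb k hk
  exact hi2 (b.2.1 i hb (hi1 ⟨⟨k, hk⟩, rfl⟩))

/-- The exponential `Y ^ X` of a QCB `hk`-space `X` and a second countable Hausdorff space `Y` is a
QCB space: every convergent sequence lifts to the second countable space of presentations. -/
lemma IsQCBSpace.exp (hX : IsHKSpace X) (hQ : IsQCBSpace X) [T2Space Y]
    [SecondCountableTopology Y] : IsQCBSpace (Exp X Y) := by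
  have := hX.kSpace
  obtain ⟨𝒩, h𝒩, hN⟩ := hQ.exists_network hX
  obtain ⟨𝒱, h𝒱, hVo, hV⟩ := exists_open_network Y
  have hsep : SeparableSpace X := by
    obtain ⟨A, q, hA, hq⟩ := hQ
    exact hq.surjective.denseRange.separableSpace hq.continuous
  have hseq := Exp.sequentialSpace (X := X) (Y := Y)
  have hcont := Presentation.continuous_toExp (Y := Y) h𝒩 h𝒱
  have hlift : ∀ (F : ℕ → Exp X Y) (f : Exp X Y), Tendsto F atTop (𝓝 f) →
      ∃ (G : ℕ → Presentation Y 𝒩 𝒱) (g : Presentation Y 𝒩 𝒱), Tendsto G atTop (𝓝 g) ∧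
        (∀ n, (G n).toExp = F n) ∧ g.toExp = f := by
    intro F f hF
    let G : ℕ → Presentation Y 𝒩 𝒱 := fun n =>
      ⟨((F n).toMap, fun i => Set.MapsTo (F n).toMap i.1 i.2), fun _ h => h,
        fun K _ _ _ p hp U hU hpU => by
          obtain ⟨V, hV1, hV2, hV3⟩ := hV (Set.range fun k => (F n).toMap (p k)) U
            (isCompact_range ((F n).toMap.continuous.comp hp)) hU (Set.range_subset_iff.2 hpU)
          obtain ⟨N, hN1, hN2, hN3⟩ := hN K p hp ((F n).toMap ⁻¹' V)
            ((hVo V hV1).preimage (F n).toMap.continuous)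
            (Set.range_subset_iff.2 fun k => hV2 ⟨k, rfl⟩)
          exact ⟨(⟨N, hN1⟩, ⟨V, hV1⟩), hN3, hN2, hV3⟩⟩
    let g : Presentation Y 𝒩 𝒱 :=
      ⟨(f.toMap, fun i => Set.MapsTo f.toMap i.1 i.2 ∧
          ∀ᶠ n in atTop, Set.MapsTo (F n).toMap i.1 i.2), fun _ h => h.1,
        fun K _ _ _ p hp U hU hpU => by
          obtain ⟨V, hV1, hV2, hV3⟩ := hV (Set.range fun k => f.toMap (p k)) U
            (isCompact_range (f.toMap.continuous.comp hp)) hU (Set.range_subset_iff.2 hpU)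
          -- the points mapped to `V` by `f` and by `F n` for `n ≥ m` form an open set
          let O : ℕ → Set X := fun m => {x | f.toMap x ∈ V ∧ ∀ n, (F (n + m)).toMap x ∈ V}
          have hO : ∀ m, IsOpen (O m) := fun m =>
            Exp.isOpen_forall_mem ((tendsto_add_atTop_iff_nat m).2 hF) (hVo V hV1)
          have hmono : Monotone O := monotone_nat_of_le_succ fun m x hx =>
            ⟨hx.1, fun n => by
              have := hx.2 (n + 1)
              rwa [add_assoc, add_comm 1 m] at this⟩
          have hcov : Set.range p ⊆ ⋃ m, O m := by
            rintro _ ⟨k, rfl⟩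
            have h1 : f.toMap (p k) ∈ V := hV2 ⟨k, rfl⟩
            have h2 := (((Exp.continuous_eval (Y := Y) (p k)).tendsto f).comp hF).eventually
              ((hVo V hV1).mem_nhds h1)
            obtain ⟨m, hm⟩ := eventually_atTop.1 h2
            exact Set.mem_iUnion.2 ⟨m, h1, fun n => hm _ (Nat.le_add_left _ _)⟩
          obtain ⟨m, hm⟩ := (isCompact_range hp).elim_directed_cover O hO hcov
            hmono.directed_le
          obtain ⟨N, hN1, hN2, hN3⟩ := hN K p hp (O m) (hO m) hm
          refine ⟨(⟨N, hN1⟩, ⟨V, hV1⟩), ⟨fun x hx => (hN3 hx).1, ?_⟩, hN2, hV3⟩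
          filter_upwards [eventually_ge_atTop m] with n hn x hx
          have := (hN3 hx).2 (n - m)
          rwa [Nat.sub_add_cancel hn] at this⟩
    refine ⟨G, g, ?_, fun n => rfl, rfl⟩
    rw [nhds_induced, tendsto_comap_iff, tendsto_pi_nhds]
    exact fun i => tendsto_nhds_Prop.2 fun h => h.2
  refine ⟨TopCat.of (Presentation Y 𝒩 𝒱), Presentation.toExp,
    Presentation.secondCountableTopology h𝒩 h𝒱, isQuotientMap_iff_isClosed.2 ⟨fun f => ?_, fun S => ?_⟩⟩
  · obtain ⟨G, g, -, -, h⟩ := hlift (fun _ => f) f tendsto_const_nhds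
    exact ⟨g, h⟩
  · refine ⟨fun h => h.preimage hcont, fun h => IsSeqClosed.isClosed fun F f hFS hF => ?_⟩
    obtain ⟨G, g, hG, hGF, rfl⟩ := hlift F f hF
    exact h.mem_of_tendsto hG (Eventually.of_forall fun n => by
      rw [Set.mem_preimage, hGF]; exact hFS n)

end Exp

lemma IsQCBSpace.of_isClosedEmbedding {Z : Type u} [TopologicalSpace Z] (hX : IsQCBSpace X)
    {i : Z → X} (hi : IsClosedEmbedding i) : IsQCBSpace Z := by
  obtain ⟨A, q, hA, hq⟩ := hX
  have hmem : ∀ a : q ⁻¹' Set.range i, ∃ z, i z = q a := fun a => a.2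
  choose r hr using hmem
  have hrc : Continuous r := hi.isInducing.continuous_iff.2 <| by
    have : i ∘ r = fun a => q a.1 := funext hr
    rw [this]
    exact hq.continuous.comp continuous_subtype_val
  refine ⟨TopCat.of (q ⁻¹' Set.range i), r, inferInstanceAs (SecondCountableTopology (q ⁻¹' _)),
    isQuotientMap_iff_isClosed.2 ⟨fun z => ?_, fun S => ⟨fun h => h.preimage hrc, fun h => ?_⟩⟩⟩
  · obtain ⟨a, ha⟩ := hq.surjective (i z)
    exact ⟨⟨a, z, ha.symm⟩, hi.injective (by rw [hr]; exact ha)⟩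
  · rw [hi.isClosed_iff_image_isClosed, ← hq.isClosed_preimage]
    have hcl : IsClosed (q ⁻¹' Set.range i) := hi.isClosed_range.preimage hq.continuous
    convert hcl.isClosedMap_subtype_val _ h using 1
    ext a
    constructor
    · rintro ⟨z, hz, hza⟩
      refine ⟨⟨a, z, hza⟩, ?_, rfl⟩
      rwa [Set.mem_preimage, show r ⟨a, z, hza⟩ = z from hi.injective (by rw [hr, hza])]
    · rintro ⟨b, hb, rfl⟩
      exact ⟨r b, hb, hr b⟩

variable {𝕜 : Type} [RCLike 𝕜]

lemma IsQCBSpace.cb (hX : IsHKSpace X) (hQ : IsQCBSpace X) : IsQCBSpace (Cb 𝕜 X) := by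
  choose A q hA hq using fun n : ℕ => hQ.exp hX (Y := Metric.closedBall (0 : 𝕜) n)
  refine ⟨TopCat.of (Σ n, A n), fun a => Cb.ofBall a.1 (q a.1 a.2),
    inferInstanceAs (SecondCountableTopology (Σ n, A n)), ?_⟩
  refine isQuotientMap_iff_isClosed.2 ⟨fun f => ?_, fun S => ?_⟩
  · obtain ⟨n, hn⟩ := f.exists_bound
    obtain ⟨a, ha⟩ := (hq n).surjective (Exp.ofMap ⟨fun x => ⟨f x, mem_closedBall_zero_iff.2 (hn x)⟩,
      f.continuous.subtype_mk _⟩)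
    exact ⟨⟨n, a⟩, by simp only [ha]; rfl⟩
  · refine isClosed_iSup_iff.trans (Iff.trans ?_ isClosed_sigma_iff.symm)
    refine forall_congr' fun n => isClosed_coinduced.trans ?_
    rw [← (hq n).isClosed_preimage]
    rfl

lemma IsQCBSpace.probability (hX : IsHKSpace X) (hQ : IsQCBSpace X) : IsQCBSpace (P 𝕜 X) :=
  ((hQ.cb hX).exp (isHKSpace_Cb 𝕜 X)).of_isClosedEmbedding
    (NDual.isClosedEmbedding_toExp.comp isClosed_P.isClosedEmbedding_subtypeVal)

end QCB

/-! ### Restriction of monads to full subcategories -/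

section Restrict

variable {C D : Type*} [Category C] [Category D] (T : Monad C) (J : D ⥤ C) [J.Full] [J.Faithful]
  (S : D → D) (i : ∀ X, J.obj (S X) ≅ T.obj (J.obj X))

/-- The restriction of a monad to a full subcategory that it preserves up to isomorphism. -/
def restrictMonad : Monad D where
  toFunctor :=
    { obj := S
      map := fun {X Y} f => J.preimage ((i X).hom ≫ T.map (J.map f) ≫ (i Y).inv)
      map_id := fun X => J.map_injective (by simp)
      map_comp := fun f g => J.map_injective (by simp) }
  η :=
    { app := fun X => J.preimage (T.η.app (J.obj X) ≫ (i X).inv)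
      naturality := fun X Y f => J.map_injective (by
        simpa using T.η.naturality_assoc (J.map f) (i Y).inv) }
  μ :=
    { app := fun X => J.preimage ((i (S X)).hom ≫ T.map (i X).hom ≫ T.μ.app (J.obj X) ≫ (i X).inv)
      naturality := fun X Y f => J.map_injective (by
        have := T.μ.naturality_assoc (J.map f) (i Y).inv
        simp only [Functor.comp_map] at this
        simp [this]) }
  assoc X := J.map_injective (by
    have h1 := T.μ.naturality_assoc (i X).hom (T.μ.app (J.obj X) ≫ (i X).inv)
    have h2 := congrArg (· ≫ (i X).inv) (T.assoc (J.obj X))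
    simp only [Category.assoc] at h2
    simp only [Functor.comp_map] at h1
    simp [h1, h2])
  left_unit X := J.map_injective (by
    have h1 := T.η.naturality_assoc (i X).hom (T.μ.app (J.obj X) ≫ (i X).inv)
    simp only [Functor.id_map] at h1
    simp [← h1])
  right_unit X := J.map_injective (by
    simp)

/-- The restricted monad is a restriction. -/
def restrictMonadRestriction : Restriction T J (restrictMonad T J S i) where
  iso := NatIso.ofComponents i (fun f => by simp [restrictMonad])
  unit X := by
    change J.map (J.preimage _) ≫ (i X).hom = _
    simp
  mult X := by
    change J.map (J.preimage _) ≫ (i X).hom = (i (S X)).hom ≫ T.map (i X).hom ≫ _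
    simp

end Restrict

/-! ### Probability measures on compact Hausdorff spaces -/

section Compact

open scoped BoundedContinuousFunction ComplexOrder ENNReal NNReal

variable {𝕜 : Type} [RCLike 𝕜] {X : Type u} [TopologicalSpace X]

section RadonBasics

/-- The state given by a Radon probability measure. -/
lemma Radon.isState (m : Radon X) : IsState fun f : Cb 𝕜 X => ∫ x, f x ∂m.measure := by
  let _ : MeasurableSpace X := borel X
  have : BorelSpace X := ⟨rfl⟩
  have := m.isProbabilityMeasure
  exact isState_integral (fun f => f.continuous.measurable) m.measure

/-- Weak convergence is convergence of the integrals of bounded continuous functions. -/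
lemma Radon.tendsto_iff (𝕜 : Type) [RCLike 𝕜] {ι : Type*} {l : Filter ι} {m : ι → Radon X}
    {m₀ : Radon X} : Tendsto m l (𝓝 m₀) ↔ ∀ f : Cb 𝕜 X,
      Tendsto (fun i => ∫ x, f x ∂(m i).measure) l (𝓝 (∫ x, f x ∂m₀.measure)) := by
  let _ : MeasurableSpace X := borel X
  have : BorelSpace X := ⟨rfl⟩
  let μ : Radon X → ProbabilityMeasure X := fun m => ⟨m.measure, m.isProbabilityMeasure⟩
  have h1 : Tendsto m l (𝓝 m₀) ↔ Tendsto (fun i => μ (m i)) l (𝓝 (μ m₀)) := by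
    have h2 : IsInducing μ := ⟨rfl⟩
    exact h2.tendsto_nhds_iff
  rw [h1, ProbabilityMeasure.tendsto_iff_forall_integral_rclike_tendsto 𝕜]
  constructor
  · intro h f
    exact h (BoundedContinuousFunction.ofNormedAddCommGroup f f.continuous f.exists_bound.choose
      f.exists_bound.choose_spec)
  · intro h f
    exact h (Cb.ofFun f f.continuous
      ⟨⌈‖f‖⌉₊, fun x => (f.norm_coe_le_norm x).trans (Nat.le_ceil _)⟩)

variable [CompactSpace X] [T2Space X]

lemma Radon.ext_of_integral {m n : Radon X}
    (h : ∀ f : Cb 𝕜 X, ∫ x, f x ∂m.measure = ∫ x, f x ∂n.measure) : m = n := by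
  let _ : MeasurableSpace X := borel X
  have : BorelSpace X := ⟨rfl⟩
  obtain ⟨μ, hμ, hμr⟩ := m
  obtain ⟨ν, hν, hνr⟩ := n
  have : μ = ν := by
    refine Measure.ext_of_integral_eq_on_compactlySupported fun f => ?_
    have h1 := h (Cb.ofReal 𝕜 (BoundedContinuousFunction.mkOfCompact f.toContinuousMap))
    simp only [Cb.ofReal_apply, integral_ofReal] at h1
    exact RCLike.ofReal_injective h1
  subst this
  rfl

/-- The Riesz–Markov–Kakutani theorem for states. -/
lemma IsState.exists_radon {φ : Cb 𝕜 X → 𝕜} (hφ : IsState φ) :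
    ∃ m : Radon X, ∀ f, φ f = ∫ x, f x ∂m.measure := by
  let _ : MeasurableSpace X := borel X
  have : BorelSpace X := ⟨rfl⟩
  let toB : CompactlySupportedContinuousMap X ℝ → X →ᵇ ℝ := fun f =>
    BoundedContinuousFunction.mkOfCompact f.toContinuousMap
  let Λ₀ : CompactlySupportedContinuousMap X ℝ →ₗ[ℝ] ℝ :=
    { toFun := fun f => hφ.real (toB f)
      map_add' := fun f g => by rw [← map_add]; rfl
      map_smul' := fun c f => by
        have : toB (c • f) = c • toB f := rfl
        rw [this, map_smul]; rfl }
  let Λ : CompactlySupportedContinuousMap X ℝ →ₚ[ℝ] ℝ := ⟨Λ₀, fun f g hfg => by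
    have h1 : 0 ≤ hφ.real (toB g - toB f) := hφ.real_nonneg _ fun x => sub_nonneg.2 (hfg x)
    rw [map_sub] at h1
    exact sub_nonneg.1 h1⟩
  have hreg := RealRMK.regular_rieszMeasure Λ
  have hint : ∀ f : X →ᵇ ℝ, hφ.real f = ∫ x, f x ∂(RealRMK.rieszMeasure Λ) := fun f => by
    have h1 := RealRMK.integral_rieszMeasure Λ
      (CompactlySupportedContinuousMap.continuousMapEquiv f.toContinuousMap)
    exact h1.symm
  have hprob : IsProbabilityMeasure (RealRMK.rieszMeasure Λ) := by
    have h1 := hint 1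
    rw [hφ.real_one] at h1
    simp only [BoundedContinuousFunction.coe_one, Pi.one_apply, integral_const, smul_eq_mul,
      mul_one] at h1
    exact isProbabilityMeasure_iff_real.2 h1.symm
  exact ⟨⟨RealRMK.rieszMeasure Λ, hprob, inferInstance⟩,
    hφ.eq_integral (fun f => f.continuous.measurable) hint⟩

lemma IsState.norm_le {φ : Cb 𝕜 X → 𝕜} (hφ : IsState φ) {f : Cb 𝕜 X} {C : ℝ}
    (hf : ∀ x, ‖f x‖ ≤ C) : ‖φ f‖ ≤ C := by
  obtain ⟨m, h⟩ := hφ.exists_radon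
  have := m.isProbabilityMeasure
  rw [h]
  simpa using norm_integral_le_of_norm_le_const (μ := m.measure) (ae_of_all _ hf)

end RadonBasics

/-! ### The weak topology on states -/

variable (𝕜 X) in
/-- The set of states, with the topology of pointwise convergence. -/
def StateSpace : Set (Cb 𝕜 X → 𝕜) := {φ | IsState φ}

lemma isClosed_stateSpace : IsClosed (StateSpace 𝕜 X) := by
  have h : StateSpace 𝕜 X =
      (⋂ (f : Cb 𝕜 X) (g : Cb 𝕜 X), {φ | φ (f + g) = φ f + φ g}) ∩
      (⋂ (c : 𝕜) (f : Cb 𝕜 X), {φ | φ (c • f) = c * φ f}) ∩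
      (⋂ (f : Cb 𝕜 X) (_ : ∀ x, 0 ≤ RCLike.re (f x) ∧ RCLike.im (f x) = 0),
        {φ | 0 ≤ RCLike.re (φ f)} ∩ {φ | RCLike.im (φ f) = 0}) ∩ {φ | φ Cb.one = 1} := by
    ext φ
    simp only [StateSpace, Set.mem_inter_iff, Set.mem_iInter, Set.mem_ofPred_eq]
    constructor
    · intro h
      exact ⟨⟨⟨h.add, h.smul⟩, fun f hf => RCLike.nonneg_iff.1
        (h.nonneg f fun x => RCLike.nonneg_iff.2 (hf x))⟩, h.one⟩
    · rintro ⟨⟨⟨h1, h2⟩, h3⟩, h4⟩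
      exact ⟨h1, h2, fun f hf => RCLike.nonneg_iff.2
        (h3 f fun x => RCLike.nonneg_iff.1 (hf x)), h4⟩
  rw [h]
  refine IsClosed.inter (IsClosed.inter (IsClosed.inter ?_ ?_) ?_) ?_
  · exact isClosed_iInter fun f => isClosed_iInter fun g => isClosed_eq
      (continuous_apply (f + g)) (Continuous.add (continuous_apply f) (continuous_apply g))
  · exact isClosed_iInter fun c => isClosed_iInter fun f => isClosed_eq (continuous_apply _)
      (continuous_const.mul (continuous_apply _))
  · refine isClosed_iInter fun f => isClosed_iInter fun _ => IsClosed.inter ?_ ?_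
    · exact isClosed_le continuous_const (RCLike.continuous_re.comp (continuous_apply f))
    · exact isClosed_eq (RCLike.continuous_im.comp (continuous_apply f)) continuous_const
  · exact isClosed_eq (continuous_apply _) continuous_const

variable [CompactSpace X] [T2Space X]

/-- The state space is compact, by the theorem of Banach and Alaoglu. -/
lemma isCompact_stateSpace : IsCompact (StateSpace 𝕜 X) := by
  choose b hb using fun f : Cb 𝕜 X => f.exists_bound
  refine (isCompact_univ_pi fun f : Cb 𝕜 X => isCompact_closedBall (0 : 𝕜) (b f)).of_isClosed_subset
    isClosed_stateSpace fun φ hφ f _ => ?_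
  exact mem_closedBall_zero_iff.2 (IsState.norm_le hφ (hb f))

instance : CompactSpace (StateSpace 𝕜 X) := isCompact_iff_compactSpace.1 isCompact_stateSpace

/-- The set of states is equicontinuous, so that evaluation is jointly continuous along compact
families. -/
lemma continuous_state_apply {K : Type u} [TopologicalSpace K] [CompactSpace K] [T2Space K]
    {w : K → StateSpace 𝕜 X} (hw : Continuous w) {q : K → Cb 𝕜 X} (hq : Continuous q) :
    Continuous fun k => (w k).1 (q k) := by
  have hQ : Continuous fun k => (q k).toMap :=
    ContinuousMap.continuous_of_continuous_uncurry _
      ((Cb.continuous_iff.1 hq).2 X id continuous_id)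
  refine continuous_iff_continuousAt.2 fun k₀ => ?_
  have h1 : Tendsto (fun k => ‖(q k).toMap - (q k₀).toMap‖) (𝓝 k₀) (𝓝 0) := by
    have h := tendsto_iff_norm_sub_tendsto_zero.1 (hQ.tendsto k₀)
    exact h
  have h2 : Tendsto (fun k => (w k).1 (q k - q k₀)) (𝓝 k₀) (𝓝 0) := by
    refine squeeze_zero_norm (fun k => ?_) h1
    exact IsState.norm_le (w k).2 fun x => ((q k).toMap - (q k₀).toMap).norm_coe_le_norm x
  have h3 : Tendsto (fun k => (w k).1 (q k₀)) (𝓝 k₀) (𝓝 ((w k₀).1 (q k₀))) :=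
    (((continuous_apply (q k₀)).comp continuous_subtype_val).comp hw).tendsto k₀
  have h4 := h2.add h3
  rw [zero_add] at h4
  refine h4.congr fun k => ?_
  rw [← (w k).2.add, sub_add_cancel]

/-- A state as a continuous functional. -/
def stateFunctional (w : StateSpace 𝕜 X) : NDual 𝕜 (Cb 𝕜 X) :=
  (⟨⟨⟨w.1, w.2.add⟩, w.2.smul⟩, continuous_of_compact fun _ _ _ _ _ hp =>
    continuous_state_apply continuous_const hp⟩ : Cb 𝕜 X →L[𝕜] 𝕜)

lemma continuous_stateFunctional :
    Continuous (stateFunctional : StateSpace 𝕜 X → NDual 𝕜 (Cb 𝕜 X)) :=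
  have := isGeneratedBy_of_compact (K := StateSpace 𝕜 X)
  NDual.continuous_of_compact fun _ _ _ _ _ _ hp hq => continuous_state_apply hp hq

/-- States in the linear span of the evaluations are dense: the vector of integrals of finitely many
functions lies in the closed convex hull of the vectors of their values. -/
lemma mem_closure_span (w : StateSpace 𝕜 X) :
    w ∈ closure {w : StateSpace 𝕜 X |
      stateFunctional w ∈ Submodule.span 𝕜 (Set.range (delta (𝕜 := 𝕜) (X := X)))} := by
  rw [mem_closure_iff_nhds]
  intro U hU
  rw [nhds_subtype, mem_comap] at hU
  obtain ⟨U', hU', hUU⟩ := hU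
  rw [nhds_pi, Filter.mem_pi] at hU'
  obtain ⟨I, hI, t, ht, htU⟩ := hU'
  have := hI.fintype
  let C : Set (I → 𝕜) := {e | ∃ w' : StateSpace 𝕜 X,
    stateFunctional w' ∈ Submodule.span 𝕜 (Set.range (delta (𝕜 := 𝕜) (X := X))) ∧
    ∀ i : I, w'.1 i = e i}
  have hconv : Convex ℝ C := by
    rintro e₁ ⟨w₁, hs₁, he₁⟩ e₂ ⟨w₂, hs₂, he₂⟩ a b ha hb hab
    have hst : IsState fun f => (a : 𝕜) * w₁.1 f + (b : 𝕜) * w₂.1 f :=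
      { add := fun f g => by rw [w₁.2.add, w₂.2.add]; ring
        smul := fun c f => by rw [w₁.2.smul, w₂.2.smul]; ring
        nonneg := fun f hf => add_nonneg
          (mul_nonneg (RCLike.ofReal_nonneg.2 ha) (w₁.2.nonneg f hf))
          (mul_nonneg (RCLike.ofReal_nonneg.2 hb) (w₂.2.nonneg f hf))
        one := by
          rw [w₁.2.one, w₂.2.one, mul_one, mul_one, ← RCLike.ofReal_add, hab, RCLike.ofReal_one] }
    refine ⟨⟨_, hst⟩, ?_, fun i => ?_⟩
    · exact Submodule.add_mem _ (Submodule.smul_mem _ (a : 𝕜) hs₁)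
        (Submodule.smul_mem _ (b : 𝕜) hs₂)
    · simp only [Pi.add_apply, Pi.smul_apply, he₁, he₂, RCLike.real_smul_eq_coe_mul]
  obtain ⟨m, hm⟩ := IsState.exists_radon w.2
  let _ : MeasurableSpace X := borel X
  have : BorelSpace X := ⟨rfl⟩
  have := m.isProbabilityMeasure
  have hint : ∀ i : I, Integrable (fun x => (i : Cb 𝕜 X) x) m.measure := fun i =>
    (i : Cb 𝕜 X).integrable (i : Cb 𝕜 X).continuous.measurable
  have hmem : ∫ x, (fun i : I => (i : Cb 𝕜 X) x) ∂m.measure ∈ closure C := by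
    refine hconv.closure.integral_mem isClosed_closure (ae_of_all _ fun x => subset_closure ?_)
      (Integrable.of_eval hint)
    exact ⟨⟨fun f => f x, fun _ _ => rfl, fun _ _ => rfl, fun _ h => h x, rfl⟩,
      Submodule.subset_span ⟨x, rfl⟩, fun _ => rfl⟩
  have hO : {e : I → 𝕜 | ∀ i : I, e i ∈ t i} ∈
      𝓝 (∫ x, (fun i : I => (i : Cb 𝕜 X) x) ∂m.measure) := by
    have : {e : I → 𝕜 | ∀ i : I, e i ∈ t i} = Set.pi Set.univ fun i : I => t i := by
      ext e; simp
    rw [this]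
    refine set_pi_mem_nhds Set.finite_univ fun i _ => ?_
    rw [eval_integral hint, ← hm]
    exact ht i
  obtain ⟨e, he, w', hw', hwe⟩ := mem_closure_iff_nhds.1 hmem _ hO
  exact ⟨w', hUU (htU fun i hi => (hwe ⟨i, hi⟩).symm ▸ he ⟨i, hi⟩), hw'⟩

lemma stateFunctional_mem_P (w : StateSpace 𝕜 X) : stateFunctional w ∈ P 𝕜 X :=
  ⟨map_mem_closure continuous_stateFunctional (mem_closure_span w) fun _ h => h,
    w.2.nonneg, w.2.one⟩

/-- For compact `X`, states with the topology of pointwise convergence are the elements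
of `P(X)`. -/
def ofState (w : StateSpace 𝕜 X) : P 𝕜 X := ⟨stateFunctional w, stateFunctional_mem_P w⟩

lemma continuous_ofState : Continuous (ofState : StateSpace 𝕜 X → P 𝕜 X) :=
  continuous_stateFunctional.subtype_mk _

lemma ofState_surjective : Function.Surjective (ofState : StateSpace 𝕜 X → P 𝕜 X) :=
  fun φ => ⟨⟨_, isState_of_mem φ.2⟩, rfl⟩

instance : CompactSpace (P 𝕜 X) := ofState_surjective.compactSpace continuous_ofState

/-! ### Radon measures on compact Hausdorff spaces -/

/-- The Radon probability measure of an element of `P(X)`. -/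
def radonOf (φ : P 𝕜 X) : Radon X := (isState_of_mem φ.2).exists_radon.choose

lemma apply_eq_integral_radonOf (φ : P 𝕜 X) (f : Cb 𝕜 X) :
    φ.1 f = ∫ x, f x ∂(radonOf φ).measure := (isState_of_mem φ.2).exists_radon.choose_spec f

lemma radonOf_eq {φ : P 𝕜 X} {m : Radon X} (h : ∀ f : Cb 𝕜 X, φ.1 f = ∫ x, f x ∂m.measure) :
    radonOf φ = m :=
  Radon.ext_of_integral (𝕜 := 𝕜) fun f => by rw [← apply_eq_integral_radonOf, h]

lemma continuous_radonOf : Continuous (radonOf : P 𝕜 X → Radon X) := by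
  refine continuous_iff_continuousAt.2 fun φ => (Radon.tendsto_iff 𝕜).2 fun f => ?_
  have h := ((NDual.continuous_eval f).comp (continuous_subtype_val (p := (· ∈ P 𝕜 X)))).tendsto φ
  simp only [Function.comp_def, apply_eq_integral_radonOf] at h
  exact h

lemma continuous_ofRadon :
    Continuous fun m : Radon X => ofState (⟨_, m.isState⟩ : StateSpace 𝕜 X) :=
  continuous_ofState.comp (Continuous.subtype_mk (continuous_pi fun f =>
    continuous_iff_continuousAt.2 fun _ => (Radon.tendsto_iff 𝕜).1 tendsto_id f) _)

variable (𝕜 X) in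
/-- For compact `X`, the space `P(X)` is the space of Radon probability measures with the weak
topology. -/
def radonHomeo : P 𝕜 X ≃ₜ Radon X where
  toFun := radonOf
  invFun m := ofState ⟨_, m.isState⟩
  left_inv φ := Subtype.ext (NDual.ext fun f => (apply_eq_integral_radonOf φ f).symm)
  right_inv _ := radonOf_eq fun _ => rfl
  continuous_toFun := continuous_radonOf
  continuous_invFun := continuous_ofRadon

end Compact

/-! ### The structure of the Radon monad -/

section RadonStructure

open scoped BoundedContinuousFunction ENNReal NNReal

variable {𝕜 : Type} [RCLike 𝕜] {X : Type u} [TopologicalSpace X] [CompactSpace X] [T2Space X]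

lemma radonOf_map {Y : Type u} [TopologicalSpace Y] [CompactSpace Y] [T2Space Y] (g : C(X, Y))
    (φ : P 𝕜 X) (hφ : NDual.transpose (Cb.pullback g) φ.1 ∈ P 𝕜 Y) :
    (radonOf ⟨_, hφ⟩).measure = @Measure.map X Y (borel X) (borel Y) g (radonOf φ).measure := by
  let _ : MeasurableSpace X := borel X
  have : BorelSpace X := ⟨rfl⟩
  let _ : MeasurableSpace Y := borel Y
  have : BorelSpace Y := ⟨rfl⟩
  have := (radonOf φ).isProbabilityMeasure
  have := (radonOf φ).innerRegular
  let m : Radon Y := ⟨(radonOf φ).measure.map g,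
    Measure.isProbabilityMeasure_map g.continuous.measurable.aemeasurable,
    Measure.InnerRegular.map_of_continuous g.continuous⟩
  refine congrArg Radon.measure (radonOf_eq (m := m) fun f => ?_)
  change φ.1 (Cb.pullback g f) = ∫ y, f y ∂((radonOf φ).measure.map g)
  rw [integral_map g.continuous.measurable.aemeasurable
    f.continuous.measurable.aestronglyMeasurable, apply_eq_integral_radonOf]
  rfl

lemma radonOf_delta (x : X) :
    (radonOf (⟨delta x, delta_mem_P x⟩ : P 𝕜 X)).measure = @Measure.dirac X (borel X) x := by
  let _ : MeasurableSpace X := borel X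
  have : BorelSpace X := ⟨rfl⟩
  have hreg : (Measure.dirac x).InnerRegular := ⟨by
    intro A hA r hr
    rw [Measure.dirac_apply' _ hA] at hr
    by_cases hx : x ∈ A
    · refine ⟨{x}, Set.singleton_subset_iff.2 hx, isCompact_singleton, ?_⟩
      rw [Measure.dirac_apply_of_mem (Set.mem_singleton x)]
      simpa [hx] using hr
    · simp [hx] at hr⟩
  refine congrArg Radon.measure
    (radonOf_eq (m := ⟨Measure.dirac x, inferInstance, hreg⟩) fun f => ?_)
  exact (integral_dirac _ x).symm

/-- The real value of an element of `P(X)` at a real function. -/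
def realValue (φ : P 𝕜 X) (f : X →ᵇ ℝ) : ℝ := RCLike.re (φ.1 (Cb.ofReal 𝕜 f))

omit [CompactSpace X] [T2Space X] in
lemma continuous_realValue (f : X →ᵇ ℝ) : Continuous fun φ : P 𝕜 X => realValue φ f :=
  RCLike.continuous_re.comp ((NDual.continuous_eval _).comp continuous_subtype_val)

lemma realValue_eq (φ : P 𝕜 X) (f : X →ᵇ ℝ) : realValue φ f = ∫ x, f x ∂(radonOf φ).measure := by
  rw [realValue, apply_eq_integral_radonOf]
  simp only [Cb.ofReal_apply, integral_ofReal, RCLike.ofReal_re]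

lemma ofReal_realValue (φ : P 𝕜 X) {f : X →ᵇ ℝ} (hf : ∀ x, 0 ≤ f x) :
    ENNReal.ofReal (realValue φ f) =
      @lintegral X (borel X) (radonOf φ).measure fun x => ENNReal.ofReal (f x) := by
  let _ : MeasurableSpace X := borel X
  have : BorelSpace X := ⟨rfl⟩
  have := (radonOf φ).isProbabilityMeasure
  rw [realValue_eq, ofReal_integral_eq_lintegral_ofReal _ (ae_of_all _ hf)]
  exact Integrable.of_bound f.continuous.measurable.aestronglyMeasurable ‖f‖
    (ae_of_all _ f.norm_coe_le_norm)

lemma ofReal_realValue_le (φ : P 𝕜 X) {f : X →ᵇ ℝ} {U : Set X} (hU : IsOpen U)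
    (hf : IsUnitOn f U) : ENNReal.ofReal (realValue φ f) ≤ (radonOf φ).measure U := by
  let _ : MeasurableSpace X := borel X
  have : BorelSpace X := ⟨rfl⟩
  rw [ofReal_realValue φ fun x => (hf x).1, ← lintegral_indicator_one hU.measurableSet]
  refine lintegral_mono fun x => ?_
  by_cases hx : x ∈ U
  · rw [Set.indicator_of_mem hx]
    exact ENNReal.ofReal_le_one.2 (hf x).2.1
  · rw [(hf x).2.2 hx, ENNReal.ofReal_zero]
    exact zero_le

/-- Urysohn's lemma, integrated. -/
lemma exists_le_ofReal_realValue {C U : Set X} (hC : IsCompact C) (hU : IsOpen U) (hCU : C ⊆ U) :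
    ∃ f : X →ᵇ ℝ, IsUnitOn f U ∧
      ∀ φ : P 𝕜 X, (radonOf φ).measure C ≤ ENNReal.ofReal (realValue φ f) := by
  let _ : MeasurableSpace X := borel X
  have : BorelSpace X := ⟨rfl⟩
  obtain ⟨g, hg1, hg0, -, hg⟩ := exists_continuous_one_zero_of_isCompact hC hU.isClosed_compl
    (Set.disjoint_compl_right_iff_subset.2 hCU)
  have hg : ∀ x, 0 ≤ g x ∧ g x ≤ 1 := hg
  refine ⟨unitFun g g.continuous hg, fun x => ⟨(hg x).1, (hg x).2, fun hx => hg0 hx⟩, fun φ => ?_⟩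
  rw [ofReal_realValue φ fun x => (hg x).1, ← lintegral_indicator_one hC.measurableSet]
  refine lintegral_mono fun x => ?_
  by_cases hx : x ∈ C
  · rw [Set.indicator_of_mem hx, unitFun_apply, hg1 hx]
    exact ENNReal.ofReal_one.ge
  · rw [Set.indicator_of_notMem hx]
    exact zero_le

/-- The measure of a fixed Borel set depends measurably on the measure: it is lower semicontinuous
for open sets. -/
lemma measurable_radonOf :
    @Measurable (P 𝕜 X) (@Measure X (borel X)) (borel _) (@Measure.instMeasurableSpace X (borel X))
      fun φ => (radonOf φ).measure := by
  let _ : MeasurableSpace X := borel X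
  have : BorelSpace X := ⟨rfl⟩
  let _ : MeasurableSpace (P 𝕜 X) := borel _
  have : BorelSpace (P 𝕜 X) := ⟨rfl⟩
  have hprob : ∀ φ : P 𝕜 X, IsProbabilityMeasure (radonOf φ).measure :=
    fun φ => (radonOf φ).isProbabilityMeasure
  refine Measurable.measure_of_isPiSystem_of_isProbabilityMeasure (S := {U | IsOpen U})
    rfl isPiSystem_isOpen fun U hU => measurable_of_Ioi fun a => IsOpen.measurableSet ?_
  have hU : IsOpen U := hU
  refine isOpen_iff_mem_nhds.2 fun φ hφ => ?_
  have := (radonOf φ).innerRegular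
  obtain ⟨C, hCU, hC, haC⟩ := hU.exists_lt_isCompact (show a < (radonOf φ).measure U from hφ)
  obtain ⟨f, hf, hCf⟩ := exists_le_ofReal_realValue (𝕜 := 𝕜) hC hU hCU
  have hcont : Continuous fun ψ : P 𝕜 X => ENNReal.ofReal (realValue ψ f) :=
    ENNReal.continuous_ofReal.comp (continuous_realValue f)
  filter_upwards [hcont.continuousAt.eventually (lt_mem_nhds (haC.trans_le (hCf φ)))] with ψ hψ
  exact hψ.trans_le (ofReal_realValue_le ψ hU hf)

lemma ofReal_realValue_join (Φ : P 𝕜 (P 𝕜 X)) {f : X →ᵇ ℝ} (hf : ∀ x, 0 ≤ f x) :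
    ENNReal.ofReal (realValue (join Φ) f) = @lintegral _ (borel (P 𝕜 X)) (radonOf Φ).measure
      fun φ => ENNReal.ofReal (realValue φ f) := by
  let g : P 𝕜 X →ᵇ ℝ := BoundedContinuousFunction.mkOfCompact ⟨_, continuous_realValue f⟩
  have h : evOp 𝕜 X (Cb.ofReal 𝕜 f) = Cb.ofReal 𝕜 g :=
    Cb.ext fun φ => ((isState_of_mem φ.2).ofReal_real f).symm
  have h2 : realValue (join Φ) f = realValue Φ g :=
    congrArg (fun k => RCLike.re (Φ.1 k)) h
  rw [h2]
  exact ofReal_realValue Φ fun φ => (isState_of_mem φ.2).real_nonneg f hf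

/-- The averaged measure of an open set is approximated by the integrals of continuous functions: an
upper semicontinuous minorant of `φ ↦ φ(U)` is, by compactness, dominated up to `ε` by
`φ ↦ φ(f)` for a single continuous function `f` supported in `U`. -/
lemma lintegral_measure_le_join (Φ : P 𝕜 (P 𝕜 X)) {U : Set X} (hU : IsOpen U) :
    @lintegral _ (borel (P 𝕜 X)) (radonOf Φ).measure (fun φ => (radonOf φ).measure U) ≤
      (radonOf (join Φ)).measure U := by
  let _ : MeasurableSpace X := borel X
  have : BorelSpace X := ⟨rfl⟩
  let _ : MeasurableSpace (P 𝕜 X) := borel _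
  have : BorelSpace (P 𝕜 X) := ⟨rfl⟩
  have hprob : ∀ φ : P 𝕜 X, IsProbabilityMeasure (radonOf φ).measure :=
    fun φ => (radonOf φ).isProbabilityMeasure
  have := (radonOf Φ).isProbabilityMeasure
  have := (radonOf Φ).innerRegular
  refine ENNReal.le_of_forall_pos_le_add fun ε hε _ => ?_
  have hε2 : ((ε / 2 : ℝ≥0) : ℝ≥0∞) ≠ 0 := by simpa using (half_pos hε).ne'
  have hcoe : ∀ φ : P 𝕜 X, (((radonOf φ).measure U).toNNReal : ℝ≥0∞) = (radonOf φ).measure U :=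
    fun φ => ENNReal.coe_toNNReal (measure_ne_top _ _)
  obtain ⟨g, hgle, hgusc, hgint⟩ := exists_upperSemicontinuous_le_lintegral_le
    (μ := (radonOf Φ).measure) (fun φ : P 𝕜 X => ((radonOf φ).measure U).toNNReal)
    (by
      simp only [hcoe]
      refine ne_top_of_le_ne_top ENNReal.one_ne_top ?_
      refine (lintegral_mono fun φ => prob_le_one).trans ?_
      simp) hε2
  simp only [hcoe] at hgint
  have hloc : ∀ φ₀ : P 𝕜 X, ∃ f : X →ᵇ ℝ, IsUnitOn f U ∧
      ∀ᶠ φ in 𝓝 φ₀, (g φ : ℝ≥0∞) ≤ ENNReal.ofReal (realValue φ f) + (ε / 2 : ℝ≥0) := by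
    intro φ₀
    have := (radonOf φ₀).innerRegular
    obtain ⟨C, hCU, hC, hlt⟩ := hU.measurableSet.exists_isCompact_lt_add
      (μ := (radonOf φ₀).measure) (measure_ne_top _ _) hε2
    obtain ⟨f, hf, hCf⟩ := exists_le_ofReal_realValue (𝕜 := 𝕜) hC hU hCU
    have h1 : (g φ₀ : ℝ≥0∞) < ENNReal.ofReal (realValue φ₀ f) + (ε / 2 : ℝ≥0) :=
      calc (g φ₀ : ℝ≥0∞) ≤ (radonOf φ₀).measure U := by
            rw [← hcoe]; exact ENNReal.coe_le_coe.2 (hgle φ₀)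
        _ < _ := hlt
        _ ≤ _ := by gcongr; exact hCf φ₀
    obtain ⟨c, hc1, hc2⟩ := ENNReal.lt_iff_exists_nnreal_btwn.1 h1
    have hcont : Continuous fun ψ : P 𝕜 X => ENNReal.ofReal (realValue ψ f) + (ε / 2 : ℝ≥0) :=
      (ENNReal.continuous_ofReal.comp (continuous_realValue f)).add continuous_const
    refine ⟨f, hf, ?_⟩
    filter_upwards [hgusc φ₀ c (ENNReal.coe_lt_coe.1 hc1),
      hcont.continuousAt.eventually (lt_mem_nhds hc2)] with φ h2 h3
    exact (ENNReal.coe_lt_coe.2 h2).le.trans h3.le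
  choose f hf hfg using hloc
  obtain ⟨t, ht⟩ := CompactSpace.elim_nhds_subcover _ hfg
  -- the sum of the local functions, cut off at `1`
  have hs0 : ∀ x, 0 ≤ ∑ φ ∈ t, f φ x := fun x => Finset.sum_nonneg fun φ _ => (hf φ x).1
  let F : X →ᵇ ℝ := unitFun (fun x => min 1 (∑ φ ∈ t, f φ x))
    (continuous_const.min (continuous_finsetSum _ fun φ _ => (f φ).continuous))
    fun x => ⟨le_min zero_le_one (hs0 x), min_le_left _ _⟩
  have hFU : IsUnitOn F U := fun x => ⟨le_min zero_le_one (hs0 x), min_le_left _ _, fun hx => by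
    have : ∑ φ ∈ t, f φ x = 0 := Finset.sum_eq_zero fun φ _ => (hf φ x).2.2 hx
    rw [unitFun_apply, this]
    exact min_eq_right zero_le_one⟩
  have hFg : ∀ φ : P 𝕜 X, (g φ : ℝ≥0∞) ≤ ENNReal.ofReal (realValue φ F) + (ε / 2 : ℝ≥0) := by
    intro φ
    have hφ : φ ∈ ⋃ x ∈ t, {ψ | (g ψ : ℝ≥0∞) ≤ ENNReal.ofReal (realValue ψ (f x)) + (ε / 2 : ℝ≥0)} :=
      ht.ge trivial
    obtain ⟨φ₀, hφ₀, h⟩ := Set.mem_iUnion₂.1 hφ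
    refine le_trans (show (g φ : ℝ≥0∞) ≤ _ from h) ?_
    refine add_le_add ?_ le_rfl
    rw [ofReal_realValue φ fun x => (hf φ₀ x).1, ofReal_realValue φ fun x => (hFU x).1]
    refine lintegral_mono fun x => ENNReal.ofReal_le_ofReal (le_min (hf φ₀ x).2.1 ?_)
    exact Finset.single_le_sum (f := fun φ => f φ x) (fun φ _ => (hf φ x).1) hφ₀
  calc ∫⁻ φ, (radonOf φ).measure U ∂(radonOf Φ).measure
      ≤ ∫⁻ φ, (g φ : ℝ≥0∞) ∂(radonOf Φ).measure + (ε / 2 : ℝ≥0) := hgint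
    _ ≤ ∫⁻ φ, (ENNReal.ofReal (realValue φ F) + (ε / 2 : ℝ≥0)) ∂(radonOf Φ).measure
        + (ε / 2 : ℝ≥0) := by gcongr with φ; exact hFg φ
    _ = ENNReal.ofReal (realValue (join Φ) F) + (ε / 2 : ℝ≥0) + (ε / 2 : ℝ≥0) := by
        rw [lintegral_add_right _ measurable_const, lintegral_const, measure_univ, mul_one,
          ofReal_realValue_join Φ fun x => (hFU x).1]
    _ ≤ (radonOf (join Φ)).measure U + ε := by
        rw [add_assoc, ← ENNReal.coe_add, add_halves]
        gcongr
        exact ofReal_realValue_le _ hU hFU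

/-- The Radon measure of a barycenter is the average of the Radon measures: the average is dominated
by the barycenter on open sets, hence on Borel sets by outer regularity, and both are probability
measures. -/
lemma radonOf_join (Φ : P 𝕜 (P 𝕜 X)) {A : Set X} (hA : MeasurableSet[borel X] A) :
    (radonOf (join Φ)).measure A =
      @lintegral _ (borel (P 𝕜 X)) (radonOf Φ).measure fun φ => (radonOf φ).measure A := by
  let _ : MeasurableSpace X := borel X
  have : BorelSpace X := ⟨rfl⟩
  let _ : MeasurableSpace (P 𝕜 X) := borel _
  have : BorelSpace (P 𝕜 X) := ⟨rfl⟩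
  have hprob : ∀ φ : P 𝕜 X, IsProbabilityMeasure (radonOf φ).measure :=
    fun φ => (radonOf φ).isProbabilityMeasure
  have := (radonOf Φ).isProbabilityMeasure
  have := (radonOf (join Φ)).innerRegular
  let ρ : Measure X := (radonOf Φ).measure.bind fun φ => (radonOf φ).measure
  have hρ : ∀ {B : Set X}, MeasurableSet B →
      ρ B = ∫⁻ φ, (radonOf φ).measure B ∂(radonOf Φ).measure :=
    fun hB => Measure.bind_apply hB measurable_radonOf.aemeasurable
  have hρ1 : ρ Set.univ = 1 := by
    rw [hρ MeasurableSet.univ]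
    simp
  have : IsProbabilityMeasure ρ := ⟨hρ1⟩
  have hle : ρ ≤ (radonOf (join Φ)).measure := by
    intro B
    rw [B.measure_eq_iInf_isOpen (radonOf (join Φ)).measure]
    refine le_iInf fun U => le_iInf fun hBU => le_iInf fun hU => ?_
    refine (measure_mono hBU).trans ?_
    rw [hρ hU.measurableSet]
    exact lintegral_measure_le_join Φ hU
  rw [← hρ hA, Measure.eq_of_le_of_measure_univ_eq hle (by rw [hρ1, measure_univ])]

end RadonStructure

/-! ### The restrictions to compact Hausdorff spaces and to QCB spaces -/

section Restrictions

variable (𝕜 : Type) [RCLike 𝕜]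

instance : compHausToHK.{u}.Full := ⟨fun f => ⟨CompHausLike.ofHom _ (HKTop.toMap f), rfl⟩⟩

instance : compHausToHK.{u}.Faithful := ⟨fun {_ _ _ _} h => by
  ext x
  exact congrArg (fun k => HKTop.toMap k x) h⟩

/-- The space `P(X)` for a compact Hausdorff space `X`. -/
abbrev probCompHaus (X : CompHaus.{u}) : CompHaus.{u} := CompHaus.of (P 𝕜 X)

/-- On compact Hausdorff spaces, `P` takes values in compact Hausdorff spaces. -/
def probCompHausIso (X : CompHaus.{u}) :
    compHausToHK.obj (probCompHaus 𝕜 X) ≅ (probMonad 𝕜).toMonad.obj (compHausToHK.obj X) :=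
  Iso.refl (prob 𝕜 (compHausToHK.obj X))

/-- The Radon monad, as a restriction of the monad `P`. -/
def radonRestrict : Monad CompHaus.{u} :=
  restrictMonad (probMonad 𝕜).toMonad compHausToHK (probCompHaus 𝕜) (probCompHausIso 𝕜)

variable {𝕜}

lemma radonRestrict_map {X Y : CompHaus.{u}} (f : X ⟶ Y) (φ : P 𝕜 X) :
    (show P 𝕜 Y from (radonRestrict 𝕜).map f φ) =
      ⟨NDual.transpose (Cb.pullback (HKTop.toMap (compHausToHK.map f))) φ.1,
        transpose_mem_P _ φ.2⟩ :=
  congrArg (fun k => HKTop.toMap k φ) (compHausToHK.map_preimage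
    ((probCompHausIso 𝕜 X).hom ≫ (probMonad 𝕜).toMonad.map (compHausToHK.map f) ≫
      (probCompHausIso 𝕜 Y).inv))

lemma radonRestrict_unit (X : CompHaus.{u}) (x : X) :
    (show P 𝕜 X from (radonRestrict 𝕜).η.app X x) = ⟨delta x, delta_mem_P x⟩ :=
  congrArg (fun k => HKTop.toMap k x) (compHausToHK.map_preimage
    ((probMonad 𝕜).toMonad.η.app (compHausToHK.obj X) ≫ (probCompHausIso 𝕜 X).inv))

lemma radonRestrict_mult (X : CompHaus.{u}) (Φ : P 𝕜 (P 𝕜 X)) :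
    (show P 𝕜 X from (radonRestrict 𝕜).μ.app X Φ) = join Φ :=
  congrArg (fun k => HKTop.toMap k Φ) (compHausToHK.map_preimage
    ((probCompHausIso 𝕜 (probCompHaus 𝕜 X)).hom ≫
      (probMonad 𝕜).toMonad.map (probCompHausIso 𝕜 X).hom ≫
      (probMonad 𝕜).toMonad.μ.app (compHausToHK.obj X) ≫ (probCompHausIso 𝕜 X).inv))

variable (𝕜)

/-- The restriction of `P` to compact Hausdorff spaces is the Radon monad. -/
def radonMonad : RadonMonad (radonRestrict.{u} 𝕜) where
  homeo X := radonHomeo 𝕜 X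
  map_eq {X Y} f m :=
    (congrArg (fun φ : P 𝕜 Y => (radonOf φ).measure) (radonRestrict_map f m)).trans
      (radonOf_map (𝕜 := 𝕜) (X := X) (Y := Y) (show C(X, Y) from HKTop.toMap (compHausToHK.map f)) m
        (transpose_mem_P _ (Subtype.prop m)))
  unit_eq X x := (congrArg (fun φ : P 𝕜 X => (radonOf φ).measure) (radonRestrict_unit X x)).trans
    (radonOf_delta (𝕜 := 𝕜) (X := X) x)
  mult_eq X π A hA :=
    (congrArg (fun φ : P 𝕜 X => (radonOf (X := X) φ).measure A) (radonRestrict_mult X π)).trans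
      (radonOf_join (𝕜 := 𝕜) (X := X) π hA)

/-- The space `P(X)` for a QCB space `X`. -/
def probQCB (X : HQCB.{u}) : HQCB.{u} :=
  ⟨prob 𝕜 X.obj, IsQCBSpace.probability (𝕜 := 𝕜) X.obj.property X.property⟩

end Restrictions

/-! ### The operations of the monad in terms of measures -/

section Measures

variable (𝕜 : Type) [RCLike 𝕜]

lemma measurable_baire_map {X Y : Type u} [TopologicalSpace X] [TopologicalSpace Y] (g : C(X, Y)) :
    @Measurable X Y (baire 𝕜 X) (baire 𝕜 Y) g := by
  let _ := baire 𝕜 X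
  refine measurable_iff_comap_le.2 ?_
  rw [baire, MeasurableSpace.comap_iSup]
  refine iSup_le fun f => ?_
  rw [MeasurableSpace.comap_comp]
  exact le_iSup (fun f : C(X, 𝕜) => (borel 𝕜).comap f) (f.comp g)

lemma measure_probFunctor_map {X Y : HKTop.{u}} (g : X ⟶ Y) (m : KRegularProb 𝕜 X.carrier) :
    ((regularEquiv 𝕜 Y).symm
        (HKTop.toMap ((probFunctor 𝕜).map g) (regularEquiv 𝕜 X m))).measure =
      @Measure.map _ _ (baire 𝕜 X.carrier) (baire 𝕜 Y.carrier) (HKTop.toMap g) m.measure := by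
  let _ := baire 𝕜 X.carrier
  let _ := baire 𝕜 Y.carrier
  have := m.isProbabilityMeasure
  have hg := measurable_baire_map 𝕜 (HKTop.toMap g)
  refine measure_eq_of_ev (Measure.isProbabilityMeasure_map hg.aemeasurable) fun f => ?_
  rw [integral_map hg.aemeasurable
    (measurable_baire 𝕜 f.continuous).stronglyMeasurable.aestronglyMeasurable]
  exact ev_regularEquiv X m (Cb.pullback (HKTop.toMap g) f)

lemma measure_unitHom (X : HKTop.{u}) (x : X.carrier) :
    ((regularEquiv 𝕜 X).symm (HKTop.toMap (unitHom 𝕜 X) x)).measure =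
      @Measure.dirac _ (baire 𝕜 X.carrier) x := by
  let _ := baire 𝕜 X.carrier
  refine measure_eq_of_ev inferInstance fun f => ?_
  rw [integral_dirac' _ _ (measurable_baire 𝕜 f.continuous).stronglyMeasurable]
  rfl

lemma ev_multHom (X : HKTop.{u}) (π : KRegularProb 𝕜 (prob 𝕜 X).carrier) (f : Cb 𝕜 X.carrier) :
    ev (HKTop.toMap (multHom 𝕜 X) (regularEquiv 𝕜 (prob 𝕜 X) π)) f =
      ∫ φ, (∫ x, f x ∂((regularEquiv 𝕜 X).symm φ).measure) ∂π.measure := by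
  refine (ev_regularEquiv (prob 𝕜 X) π (evOp 𝕜 X.carrier f)).trans ?_
  exact integral_congr_ae (ae_of_all _ fun φ => ev_eq_integral φ f)

lemma ev_tensorHom (X Y : HKTop.{u}) (m : KRegularProb 𝕜 X.carrier) (n : KRegularProb 𝕜 Y.carrier)
    (f : Cb 𝕜 (X ⊗ Y).carrier) :
    ev (HKTop.toMap (tensorHom 𝕜 X Y) (pair (regularEquiv 𝕜 X m) (regularEquiv 𝕜 Y n))) f =
      ∫ y, (∫ x, f (pair x y) ∂m.measure) ∂n.measure := by
  refine (ev_regularEquiv Y n (partialApply (regularEquiv 𝕜 X m).1 f)).trans ?_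
  refine integral_congr_ae (ae_of_all _ fun y => ?_)
  exact ev_regularEquiv X m (Cb.section (X := X.carrier) (Y := Y.carrier) f y)

end Measures

end HK

end

theorem mainTheorem5 (𝕜 : Type) [RCLike 𝕜] :
    ∃ (e : ∀ X : HK.HKTop.{u}, HK.KRegularProb 𝕜 X.carrier ≃ (HK.prob 𝕜 X).carrier)
      (T : HK.CommutativeMonad (HK.probFunctor.{u} 𝕜)),
      (∀ (X : HK.HKTop.{u}) (m : HK.KRegularProb 𝕜 X.carrier) (f : HK.Cb 𝕜 X.carrier),
        HK.ev (e X m) f = ∫ x, f x ∂m.measure) ∧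
      (∀ (X Y : HK.HKTop.{u}) (g : X ⟶ Y) (m : HK.KRegularProb 𝕜 X.carrier),
        ((e Y).symm (HK.HKTop.toMap ((HK.probFunctor 𝕜).map g) (e X m))).measure =
          @Measure.map _ _ (HK.baire 𝕜 X.carrier) (HK.baire 𝕜 Y.carrier)
            (HK.HKTop.toMap g) m.measure) ∧
      (∀ (X : HK.HKTop.{u}) (x : X.carrier),
        ((e X).symm (HK.HKTop.toMap (T.unit.app X) x)).measure =
          @Measure.dirac _ (HK.baire 𝕜 X.carrier) x) ∧
      (∀ (X : HK.HKTop.{u}) (π : HK.KRegularProb 𝕜 (HK.prob 𝕜 X).carrier)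
        (f : HK.Cb 𝕜 X.carrier),
        HK.ev (HK.HKTop.toMap (T.mult.app X) (e (HK.prob 𝕜 X) π)) f =
          ∫ φ, (∫ x, f x ∂((e X).symm φ).measure) ∂π.measure) ∧
      (∀ (X Y : HK.HKTop.{u}) (m : HK.KRegularProb 𝕜 X.carrier) (n : HK.KRegularProb 𝕜 Y.carrier)
        (f : HK.Cb 𝕜 (X ⊗ Y).carrier),
        HK.ev (HK.HKTop.toMap (T.tensor X Y) (HK.pair (e X m) (e Y n))) f =
          ∫ y, (∫ x, f (HK.pair x y) ∂m.measure) ∂n.measure) ∧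
      (∃ (R : Monad CompHaus.{u}) (h : HK.RadonMonad R)
        (s : HK.Restriction T.toMonad HK.compHausToHK R),
        ∀ (X : CompHaus.{u}) (m : R.obj X) (f : HK.Cb 𝕜 (HK.compHausToHK.obj X).carrier),
          HK.ev (HK.HKTop.toMap (s.iso.hom.app X) m) f = ∫ x, f x ∂(h.homeo X m).measure) ∧
      (∃ S : Monad HK.HQCB.{u}, Nonempty (HK.Restriction T.toMonad HK.isQCB.ι S)) :=
  ⟨HK.regularEquiv 𝕜, HK.probMonad 𝕜, HK.ev_regularEquiv,
    fun _ _ => HK.measure_probFunctor_map 𝕜, HK.measure_unitHom 𝕜, HK.ev_multHom 𝕜,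
    HK.ev_tensorHom 𝕜,
    ⟨HK.radonRestrict 𝕜, HK.radonMonad 𝕜, HK.restrictMonadRestriction _ _ _ _,
      fun X m f => HK.apply_eq_integral_radonOf (X := X) m f⟩,
    ⟨HK.restrictMonad (HK.probMonad 𝕜).toMonad HK.isQCB.ι (HK.probQCB 𝕜) (fun _ => Iso.refl _),
      ⟨HK.restrictMonadRestriction _ _ _ _⟩⟩⟩
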